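/- Let $V\colon\mathbb{R}\to\mathbb{R}$ be $C^3$, even, strictly convex, with $\liminf_{|x|\to\infty}V(x)/\log|x|>1$. For a probability measure $\rho$ on $\mathbb{R}$ let $$\mathcal{E}[\rho]=-\tfrac12\iint\log|x-y|\,d\rho(x)\,d\rho(y)+\int V\,d\rho\in(-\infty,+\infty],$$ where the two terms are put under one double integral, with integrand bounded below (so $\mathcal{E}[\rho]=+\infty$ if $\int V\,d\rho=+\infty$). Let $\mathcal{P}(B)$ be the set of probability measures supported in $B$, let $B_R=[-R,R]$, and let $T_n$ be the Chebyshev polynomials of the first kind. For $R>0$ put $$c_n(R)=\frac1{h_n}\int_{-1}^1\frac{V(Ru)T_n(u)}{\sqrt{1-u^2}}\,du,\quad h_0=\pi,\ h_n=\tfrac{\pi}{2}\ (n\ge1),\qquad P_R(x)=1-\sum_{n\ge1}n\,c_n(R)\,T_n(x/R).$$ Then $\sum_n n|c_n(R)|<\infty$ for all $R>0$; the equation $\sum_{n\ge1}n\,c_n(R)=1$ has a smallest positive solution $R_\star$; the energy $\mathcal{E}$ has a minimiser $\rho_{R_\star}$ over all probability measures on $\mathbb{R}$ with support exactly $[-R_\star,R_\star]$;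 and for $0<R<R_\star$ the measure $\frac{1}{\pi}\frac{P_R(x)}{\sqrt{R^2-x^2}}\mathbf 1_{|x|<R}\,dx$ is a minimiser of $\mathcal{E}$ over $\mathcal{P}(B_R)$. The excess free energy $$F(R)=\inf_{\rho\in\mathcal{P}(B_R)}\mathcal{E}[\rho]-\mathcal{E}[\rho_{R_\star}]$$ is finite for every $R>0$ and satisfies $$F(R)=\frac12\int_{\min(R,R_\star)}^{R_\star}\frac{P_r(r)^2}{r}\,dr\qquad(R>0).$$ Moreover $F(R)>0$ for $0<R<R_\star$ and $F(R)=0$ for $R\ge R_\star$, and there is a constant $C_\star>0$ such that $$F(R)\sim C_\star(R_\star-R)^3\,\mathbf 1_{R\le R_\star}\qquad\text{as }R\to R_\star.$$ Finally, $F$ is $C^2$ near $R_\star$ and $C^3$ on $(0,R_\star)$, with $$F(R_\star)=F'(R_\star)=F''(R_\star)=0,\qquad \lim_{R\uparrow R_\star}F'''(R)=-3!\,C_\star<0,\qquad \lim_{R\downarrow R_\star}F'''(R)=0,$$ so the transition between the two regimes is of third order. -/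

import Mathlib

open MeasureTheory Set Filter Topology
open scoped ENNReal

namespace LogGas

/-- Assumptions on the potential: `V` is `C³` on `ℝ`, even, strictly convex, and
`liminf V(x) / log |x| > 1` as `|x| → ∞` (the `liminf` is taken in the extended reals). -/
structure IsAdmissible (V : ℝ → ℝ) : Prop where
  contDiff : ContDiff ℝ 3 V
  even : ∀ x, V (-x) = V x
  strictConvex : StrictConvexOn ℝ univ V
  superLog : (1 : EReal) <
    liminf (fun x : ℝ => ((V x / Real.log |x| : ℝ) : EReal)) (Bornology.cobounded ℝ)

/-- `𝓟(B)` for a closed set `B`: probability measures on `ℝ` that do not charge the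
complement of `B`, i.e. whose support lies in `B`. -/
def probOn (B : Set ℝ) : Set (Measure ℝ) :=
  {ρ | IsProbabilityMeasure ρ ∧ ρ Bᶜ = 0}

/-- Integral of an extended-real function, as (positive part) - (negative part).
It is used only where the negative part has a finite integral. -/
noncomputable def eintegral {α : Type*} [MeasurableSpace α] (μ : Measure α) (f : α → EReal) :
    EReal :=
  ((∫⁻ a, (f a).toENNReal ∂μ : ℝ≥0∞) : EReal) - ((∫⁻ a, (-f a).toENNReal ∂μ : ℝ≥0∞) : EReal)

/-- `(Φ(x - y) + V(x) + V(y)) / 2` for `Φ = -log |·|`, with the value `+∞` on the diagonal. -/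
noncomputable def energyKernel (V : ℝ → ℝ) (x y : ℝ) : EReal :=
  open Classical in
  if x = y then ⊤ else (((-Real.log |x - y| + V x + V y) / 2 : ℝ) : EReal)

/-- The mean-field energy `𝓔[ρ] = -½ ∬ log |x - y| dρ dρ + ∫ V dρ ∈ (-∞, +∞]`. The two terms
are put under one double integral, whose integrand is bounded below for an admissible `V`, so
that the energy of every probability measure is meaningful (and `+∞` when `∫ V dρ = +∞`). -/
noncomputable def energy (V : ℝ → ℝ) (ρ : Measure ℝ) : EReal :=
  eintegral (ρ.prod ρ) (fun p => energyKernel V p.1 p.2)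

/-- Where both terms of the energy are finite, it is the sum of the two terms. -/
theorem energy_eq (V : ℝ → ℝ) (ρ : Measure ℝ) [IsProbabilityMeasure ρ]
    (hdiag : (ρ.prod ρ) {p | p.1 = p.2} = 0)
    (hlog : Integrable (fun p : ℝ × ℝ => Real.log |p.1 - p.2|) (ρ.prod ρ))
    (hV : Integrable V ρ) :
    energy V ρ =
      ((-(1 / 2) * (∫ p : ℝ × ℝ, Real.log |p.1 - p.2| ∂(ρ.prod ρ)) + ∫ x, V x ∂ρ : ℝ) :
        EReal) := by
  have h1 : Integrable (fun p : ℝ × ℝ => V p.1) (ρ.prod ρ) := hV.comp_fst ρ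
  have h2 : Integrable (fun p : ℝ × ℝ => V p.2) (ρ.prod ρ) := hV.comp_snd ρ
  have hf : Integrable (fun p : ℝ × ℝ => (-Real.log |p.1 - p.2| + V p.1 + V p.2) / 2)
      (ρ.prod ρ) := ((hlog.neg.add h1).add h2).div_const 2
  have hae : ∀ᵐ p ∂(ρ.prod ρ), energyKernel V p.1 p.2 =
      (((-Real.log |p.1 - p.2| + V p.1 + V p.2) / 2 : ℝ) : EReal) := by
    have : ∀ᵐ p ∂(ρ.prod ρ), ¬ p.1 = p.2 := by
      rw [ae_iff]; simpa using hdiag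
    filter_upwards [this] with p hp
    simp [energyKernel, hp]
  have key : ∫ p : ℝ × ℝ, (-Real.log |p.1 - p.2| + V p.1 + V p.2) / 2 ∂(ρ.prod ρ) =
      -(1 / 2) * (∫ p : ℝ × ℝ, Real.log |p.1 - p.2| ∂(ρ.prod ρ)) + ∫ x, V x ∂ρ := by
    have a1 : ∫ p : ℝ × ℝ, V p.1 ∂(ρ.prod ρ) = ∫ x, V x ∂ρ := by
      rw [integral_fun_fst (μ := ρ) (ν := ρ) V]; simp
    have a2 : ∫ p : ℝ × ℝ, V p.2 ∂(ρ.prod ρ) = ∫ x, V x ∂ρ := by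
      rw [integral_fun_snd (μ := ρ) (ν := ρ) V]; simp
    have a3 : ∫ p : ℝ × ℝ, (-Real.log |p.1 - p.2| + V p.1 + V p.2) ∂(ρ.prod ρ) =
        (∫ p : ℝ × ℝ, (-Real.log |p.1 - p.2| + V p.1) ∂(ρ.prod ρ)) +
          ∫ p : ℝ × ℝ, V p.2 ∂(ρ.prod ρ) := integral_add (hlog.neg.add h1) h2
    have a4 : ∫ p : ℝ × ℝ, (-Real.log |p.1 - p.2| + V p.1) ∂(ρ.prod ρ) =
        (∫ p : ℝ × ℝ, -Real.log |p.1 - p.2| ∂(ρ.prod ρ)) +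
          ∫ p : ℝ × ℝ, V p.1 ∂(ρ.prod ρ) := integral_add hlog.neg h1
    rw [integral_div, a3, a4, integral_neg, a1, a2]
    ring
  rw [← key, integral_eq_lintegral_pos_part_sub_lintegral_neg_part hf, energy, eintegral]
  have e1 : ∫⁻ p, (energyKernel V p.1 p.2).toENNReal ∂(ρ.prod ρ) =
      ∫⁻ p, ENNReal.ofReal ((-Real.log |p.1 - p.2| + V p.1 + V p.2) / 2) ∂(ρ.prod ρ) := by
    apply lintegral_congr_ae
    filter_upwards [hae] with p hp
    rw [hp, EReal.toENNReal_of_ne_top (EReal.coe_ne_top _), EReal.toReal_coe]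
  have e2 : ∫⁻ p, (-energyKernel V p.1 p.2).toENNReal ∂(ρ.prod ρ) =
      ∫⁻ p, ENNReal.ofReal (-((-Real.log |p.1 - p.2| + V p.1 + V p.2) / 2)) ∂(ρ.prod ρ) := by
    apply lintegral_congr_ae
    filter_upwards [hae] with p hp
    rw [hp, ← EReal.coe_neg, EReal.toENNReal_of_ne_top (EReal.coe_ne_top _), EReal.toReal_coe]
  have hneg : ∫⁻ p, ENNReal.ofReal (-((-Real.log |p.1 - p.2| + V p.1 + V p.2) / 2))
      ∂(ρ.prod ρ) ≠ ⊤ := hf.neg.lintegral_lt_top.ne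
  rw [e1, e2, EReal.coe_sub, EReal.coe_ennreal_toReal hf.lintegral_lt_top.ne,
    EReal.coe_ennreal_toReal hneg]

/-- Chebyshev coefficients of `u ↦ V(R u)` on `[-1, 1]`:
`c_n(R) = h_n⁻¹ ∫_{-1}^1 V(R u) T_n(u) / √(1 - u²) du`, `h_0 = π`, `h_n = π / 2` for `n ≥ 1`. -/
noncomputable def chebCoeff (V : ℝ → ℝ) (n : ℕ) (R : ℝ) : ℝ :=
  (if n = 0 then Real.pi else Real.pi / 2)⁻¹ *
    ∫ u in (-1 : ℝ)..1, V (R * u) * (Polynomial.Chebyshev.T ℝ (n : ℤ)).eval u / √(1 - u ^ 2)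

/-- `P_R(x) = 1 - ∑_{n ≥ 1} n c_n(R) T_n(x / R)` (the term `n = 0` of the sum vanishes). -/
noncomputable def P (V : ℝ → ℝ) (R x : ℝ) : ℝ :=
  1 - ∑' n : ℕ, (n : ℝ) * chebCoeff V n R * (Polynomial.Chebyshev.T ℝ (n : ℤ)).eval (x / R)

/-- The critical radius: the smallest `R > 0` with `∑_{n ≥ 1} n c_n(R) = 1`. -/
def IsCriticalRadius (V : ℝ → ℝ) (Rs : ℝ) : Prop :=
  IsLeast {R : ℝ | 0 < R ∧ HasSum (fun n : ℕ => (n : ℝ) * chebCoeff V n R) 1} Rs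

/-- The measure with density `P_R(x) / (π √(R² - x²))` on `(-R, R)`. -/
noncomputable def gasMeasure (V : ℝ → ℝ) (R : ℝ) : Measure ℝ :=
  (volume.restrict (Ioo (-R) R)).withDensity
    (fun x => ENNReal.ofReal (P V R x / (Real.pi * √(R ^ 2 - x ^ 2))))

/-- `ρ` minimises the energy over `𝓟(B)`. -/
def IsEquilibrium (V : ℝ → ℝ) (B : Set ℝ) (ρ : Measure ℝ) : Prop :=
  ρ ∈ probOn B ∧ ∀ ρ' ∈ probOn B, energy V ρ ≤ energy V ρ'

/-- The excess free energy `inf_{ρ ∈ 𝓟(B_R)} 𝓔[ρ] - 𝓔[ρs]`, relative to a measure `ρs`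
(the unconstrained equilibrium measure); `B_R = [-R, R]`. -/
noncomputable def excessFreeEnergy (V : ℝ → ℝ) (ρs : Measure ℝ) (R : ℝ) : EReal :=
  (⨅ ρ ∈ probOn (Metric.closedBall 0 R), energy V ρ) - energy V ρs

/-- The excess free energy as a real function (meaningful where it is finite). -/
noncomputable def excessFreeEnergyReal (V : ℝ → ℝ) (ρs : Measure ℝ) (R : ℝ) : ℝ :=
  (excessFreeEnergy V ρs R).toReal

end LogGas

open LogGas

namespace LogGas
open Real

/-! ### Trigonometric integrals -/

/-! Substitute x = R cos φ and work with Chebyshev coefficients. One function governs the problem: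
S(R) = `virial V R`, the mean of x V'(x) under the arcsine law on [-R, R], for which S(R) = ∑ n
c_n(R) = 1 - P_R(R).

The engine is `hasSum_nat_mul_chebCoeff`. If e_0 = 1, e_{n+2} = 2ξ e_{n+1} - e_n and |e_n| ≤ 1, then
∑ n c_n e_n = S + R V'(Rξ)(e_1 - ξ) - (1 - ξ²) D, where D is R times the arcsine mean of the divided
difference of u ↦ V'(Ru) divided by R again, as normalised in `meanDivDiff`; strict convexity makes
D > 0 for R > 0. The proof is a Christoffel–Darboux telescoping together with the Riemann–Lebesgue
lemma. Three choices of e matter: e = 1 at ξ = 1 evaluates S; e_n = T_n(ξ) gives P_R(Rξ) = 1 - S +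
(1 - ξ²) D, so the candidate density is nonnegative when S ≤ 1; e_n = exp(-nt) at ξ = cosh t
controls the potential outside the support.

Minimality rests on -log(2|u - v|) = ∑ (2/n) T_n(u) T_n(v), used through its Abel regularisation and
shifted to be nonnegative, so that Fatou applies. The nonnegative diagonal coefficients make the
kernel positive definite on neutral measures (`two_mul_logEnergy_le`). The n-th moment of the
candidate is -n c_n/2, which makes its logarithmic potential a constant minus V on [-R, R]; only the
lower bound for the potential is needed. It persists outside when S(R) = 1 (`le_sub_tsum_exp`).
Hence `gasEnergy_le_energy`; truncation then removes compactness of the support.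

The minimal energy is E(R) = ½ log(2/R) + c_0 - ¼ ∑ n c_n². With d_n = R c_n', the relation d_n -
d_{n+2} = n c_n + (n+2) c_{n+2} makes ∑ n c_n d_n telescope to S², so E' = -(1 - S)²/(2R). Since
S(R)/R is nondecreasing, S < 1 before the critical radius, S ≥ 1 after it, and S' > 0 there. Thus F'
= -max(1 - S, 0)²/(2R) with a simple zero of 1 - S: a cubic contact, with C = S'²/(6R) at the
critical radius. -/

theorem tendsto_integral_mul_cos_nat {f : ℝ → ℝ} (hf : IntervalIntegrable f volume 0 π) :
    Tendsto (fun n : ℕ => ∫ φ in (0 : ℝ)..π, f φ * cos (n * φ)) atTop (𝓝 0) := by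
  have h := Real.tendsto_integral_exp_smul_cocompact
    (fun φ => (((Ioc 0 π).indicator f φ : ℝ) : ℂ))
  -- `Real.fourierChar` carries a factor 2π, so frequency n/(2π) has real part cos(nφ): the claim is
  -- the Riemann–Lebesgue lemma for the extension by zero.
  have h2 : Tendsto (fun n : ℕ => (n : ℝ) / (2 * π)) atTop (cocompact ℝ) := by
    have h3 : Tendsto (fun n : ℕ => (n : ℝ) / (2 * π)) atTop atTop :=
      tendsto_natCast_atTop_atTop.atTop_div_const (by positivity)
    exact h3.mono_right atTop_le_cocompact
  have h4 := (Complex.continuous_re.tendsto 0).comp (h.comp h2)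
  simp only [Complex.zero_re] at h4
  refine h4.congr fun n => ?_
  simp only [Function.comp_apply]
  have hint : Integrable (fun v : ℝ => Real.fourierChar (-(v * ((n : ℝ) / (2 * π)))) •
      (((Ioc 0 π).indicator f v : ℝ) : ℂ)) := by
    have h5 : Integrable ((Ioc 0 π).indicator f) :=
      (integrable_indicator_iff measurableSet_Ioc).2
        ((intervalIntegrable_iff_integrableOn_Ioc_of_le pi_pos.le).1 hf)
    have h6 := (Real.fourierIntegral_convergent_iff (μ := volume)
      (f := fun v => (((Ioc 0 π).indicator f v : ℝ) : ℂ)) ((n : ℝ) / (2 * π))).2 h5.ofReal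
    simpa [mul_comm] using h6
  have e := integral_re hint
  simp only [RCLike.re_eq_complex_re] at e
  rw [← e, intervalIntegral.integral_of_le pi_pos.le, ← integral_indicator measurableSet_Ioc]
  congr 1
  ext v
  by_cases hv : v ∈ Ioc 0 π
  · simp only [hv, indicator_of_mem]
    rw [Circle.smul_def, Real.fourierChar_apply]
    have : ((2 * π * -(v * ((n : ℝ) / (2 * π))) : ℝ) : ℂ) * Complex.I
        = ((-(n * v) : ℝ) : ℂ) * Complex.I := by
      congr 2; field_simp
    rw [this, smul_eq_mul, Complex.re_mul_ofReal, Complex.exp_ofReal_mul_I_re, cos_neg, mul_comm]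
  · simp [hv]

theorem integral_cos_nat_mul (n : ℕ) :
    ∫ φ in (0 : ℝ)..π, cos (n * φ) = if n = 0 then π else 0 := by
  split_ifs with h
  · simp [h]
  · have hn : (n : ℝ) ≠ 0 := by exact_mod_cast h
    rw [intervalIntegral.integral_comp_mul_left (fun x => cos x) hn, integral_cos]
    simp [sin_nat_mul_pi]

theorem integral_cos_int_mul (n : ℤ) :
    ∫ φ in (0 : ℝ)..π, cos (n * φ) = if n = 0 then π else 0 := by
  have h := integral_cos_nat_mul n.natAbs
  rw [Nat.cast_natAbs] at h
  have h2 : ∀ φ : ℝ, cos (((|n| : ℤ) : ℝ) * φ) = cos (n * φ) := by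
    intro φ
    rcases abs_choice n with h | h <;> rw [h]
    push_cast; rw [neg_mul, cos_neg]
  simp only [h2, Int.natAbs_eq_zero] at h
  exact h

theorem integral_cos_mul_cos (m n : ℕ) :
    ∫ φ in (0 : ℝ)..π, cos (m * φ) * cos (n * φ) =
      if m = n then (if n = 0 then π else π / 2) else 0 := by
  have h : ∀ φ : ℝ, cos (m * φ) * cos (n * φ) =
      (cos (((m + n : ℤ) : ℝ) * φ) + cos (((m - n : ℤ) : ℝ) * φ)) / 2 := by
    intro φ
    push_cast
    rw [add_mul, sub_mul, cos_add, cos_sub]; ring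
  simp only [h]
  rw [intervalIntegral.integral_div, intervalIntegral.integral_add
    (by apply Continuous.intervalIntegrable; fun_prop)
    (by apply Continuous.intervalIntegrable; fun_prop), integral_cos_int_mul, integral_cos_int_mul]
  by_cases h1 : m = n
  · subst h1
    by_cases h2 : m = 0
    · simp [h2]
    · have : ((m : ℤ) + m) ≠ 0 := by omega
      simp [h2, this]
  · have h3 : ((m : ℤ) - n) ≠ 0 := by omega
    have h4 : ((m : ℤ) + n) ≠ 0 := by omega
    simp [h1, h3, h4]

theorem integral_sin_mul_sin_nat (n : ℕ) :
    ∫ φ in (0 : ℝ)..π, sin φ * sin ((n + 1 : ℕ) * φ) = if n = 0 then π / 2 else 0 := by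
  have h : ∀ φ : ℝ, sin φ * sin ((n + 1 : ℕ) * φ) =
      (cos ((n : ℕ) * φ) - cos ((n + 2 : ℕ) * φ)) / 2 := by
    intro φ
    rw [show ((n : ℕ) : ℝ) * φ = (n + 1 : ℕ) * φ - φ by push_cast; ring,
      show ((n + 2 : ℕ) : ℝ) * φ = (n + 1 : ℕ) * φ + φ by push_cast; ring, cos_add, cos_sub]; ring
  simp only [h]
  rw [intervalIntegral.integral_div, intervalIntegral.integral_sub
    (by apply Continuous.intervalIntegrable; fun_prop)
    (by apply Continuous.intervalIntegrable; fun_prop), integral_cos_nat_mul, integral_cos_nat_mul]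
  split_ifs <;> simp_all

/-- Integration by parts against `sin (n φ)`. -/
theorem nat_mul_integral_mul_sin {f f' : ℝ → ℝ} (hf : ∀ x, HasDerivAt f (f' x) x)
    (hf' : Continuous f') (n : ℕ) :
    n * ∫ φ in (0 : ℝ)..π, f φ * sin (n * φ) =
      f 0 - f π * cos (n * π) + ∫ φ in (0 : ℝ)..π, f' φ * cos (n * φ) := by
  have h := intervalIntegral.integral_mul_deriv_eq_deriv_mul (a := 0) (b := π) (u := f)
    (v := fun φ => -cos (n * φ)) (u' := f') (v' := fun φ => n * sin (n * φ))
    (fun x _ => hf x)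
    (fun x _ => by
      have := ((hasDerivAt_cos (n * x)).comp x ((hasDerivAt_id x).const_mul (n : ℝ))).neg
      convert! this using 1
      simp [mul_comm])
    (hf'.intervalIntegrable _ _)
    (by apply Continuous.intervalIntegrable; fun_prop)
  have h2 : ∀ φ, f φ * (n * sin (n * φ)) = n * (f φ * sin (n * φ)) := fun φ => by ring
  simp only [h2, intervalIntegral.integral_const_mul, mul_neg,
    intervalIntegral.integral_neg] at h
  rw [h]; simp; ring

/-- Integration by parts against `cos (n φ)`. -/
theorem nat_mul_integral_mul_cos {f f' : ℝ → ℝ} (hf : ∀ x, HasDerivAt f (f' x) x)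
    (hf' : Continuous f') (n : ℕ) :
    n * ∫ φ in (0 : ℝ)..π, f φ * cos (n * φ) = - ∫ φ in (0 : ℝ)..π, f' φ * sin (n * φ) := by
  have h := intervalIntegral.integral_mul_deriv_eq_deriv_mul (a := 0) (b := π) (u := f)
    (v := fun φ => sin (n * φ)) (u' := f') (v' := fun φ => n * cos (n * φ))
    (fun x _ => hf x)
    (fun x _ => by
      have := ((hasDerivAt_sin (n * x)).comp x ((hasDerivAt_id x).const_mul (n : ℝ)))
      convert! this using 1
      simp [mul_comm])
    (hf'.intervalIntegrable _ _)
    (by apply Continuous.intervalIntegrable; fun_prop)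
  have h2 : ∀ φ, f φ * (n * cos (n * φ)) = n * (f φ * cos (n * φ)) := fun φ => by ring
  simp only [h2, intervalIntegral.integral_const_mul] at h
  rw [h]; simp [sin_nat_mul_pi]

/-! ### Divided differences and summation of cosine series -/

/-- The divided difference of `u ↦ G (R u)` between `ξ` and `cos φ`. -/
noncomputable def divDiff (G : ℝ → ℝ) (R ξ φ : ℝ) : ℝ :=
  (G (R * ξ) - G (R * cos φ)) / (ξ - cos φ)

/-- Survives coincidence ξ = cos φ: the quotient is then 0 by convention, but both sides vanish. No
limiting value on the diagonal is needed. -/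
theorem divDiff_mul (G : ℝ → ℝ) (R ξ φ : ℝ) :
    divDiff G R ξ φ * (ξ - cos φ) = G (R * ξ) - G (R * cos φ) := by
  unfold divDiff
  by_cases h : ξ - cos φ = 0
  · rw [sub_eq_zero.1 h]; simp
  · exact div_mul_cancel₀ _ h

theorem measurable_divDiff {G : ℝ → ℝ} (hG : Continuous G) (R ξ : ℝ) :
    Measurable (divDiff G R ξ) := by
  unfold divDiff
  apply Measurable.div <;> apply Continuous.measurable <;> fun_prop

/-- Mean value inequality on an interval containing both arguments. The point ξ may lie outside [-1,
1], as needed for ξ = cosh t. Boundedness and measurability suffice for all later integrals. -/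
theorem exists_abs_divDiff_le {G : ℝ → ℝ} (hG : ContDiff ℝ 1 G) (R ξ : ℝ) :
    ∃ K, ∀ φ, |divDiff G R ξ φ| ≤ K := by
  set M := |R| * max 1 |ξ| with hM
  obtain ⟨C, hC⟩ := isCompact_Icc.exists_bound_of_continuousOn (s := Icc (-M) M)
    (hG.continuous_deriv le_rfl).continuousOn
  have hin : ∀ u, |u| ≤ max 1 |ξ| → R * u ∈ Icc (-M) M := by
    intro u hu
    rw [mem_Icc, ← abs_le, abs_mul]
    exact mul_le_mul_of_nonneg_left hu (abs_nonneg _)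
  have hC0 : 0 ≤ C := (norm_nonneg _).trans (hC (R * 0) (hin 0 (by simp)))
  refine ⟨C * |R|, fun φ => ?_⟩
  have h := Convex.norm_image_sub_le_of_norm_deriv_le (𝕜 := ℝ) (f := G) (C := C)
    (fun x _ => (hG.differentiable one_ne_zero).differentiableAt) hC (convex_Icc _ _)
    (hin (cos φ) ((abs_cos_le_one φ).trans (le_max_left _ _))) (hin ξ (le_max_right _ _))
  rw [divDiff, abs_div]
  apply div_le_of_le_mul₀ (abs_nonneg _) (by positivity)
  rw [← mul_sub, norm_mul, Real.norm_eq_abs, Real.norm_eq_abs, Real.norm_eq_abs, ← mul_assoc] at h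
  exact h

theorem intervalIntegrable_divDiff_mul {G : ℝ → ℝ} (hG : ContDiff ℝ 1 G) (R ξ : ℝ) {g : ℝ → ℝ}
    (hg : Continuous g) (a b : ℝ) :
    IntervalIntegrable (fun φ => divDiff G R ξ φ * g φ) volume a b := by
  obtain ⟨K, hK⟩ := exists_abs_divDiff_le hG R ξ
  have h1 : IntervalIntegrable (divDiff G R ξ) volume a b := by
    rw [intervalIntegrable_iff]
    exact Measure.integrableOn_of_bounded (M := K) (by simp)
      (measurable_divDiff hG.continuous R ξ).aestronglyMeasurable
      (ae_of_all _ fun φ => hK φ)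
  exact h1.mul_continuousOn hg.continuousOn

theorem intervalIntegrable_divDiff {G : ℝ → ℝ} (hG : ContDiff ℝ 1 G) (R ξ a b : ℝ) :
    IntervalIntegrable (divDiff G R ξ) volume a b := by
  simpa using intervalIntegrable_divDiff_mul hG R ξ (g := fun _ => 1) continuous_const a b

/-- A Christoffel–Darboux summation. -/
theorem sum_range_mul_of_three_term {ξ : ℝ} {e w : ℕ → ℝ}
    (he : ∀ n, e (n + 2) = 2 * ξ * e (n + 1) - e n) (N : ℕ) :
    ∑ n ∈ Finset.range N, (w (n + 2) + w n - 2 * ξ * w (n + 1)) * e (n + 1) =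
      (e N * w (N + 1) - e (N + 1) * w N) - (e 0 * w 1 - e 1 * w 0) := by
  induction N with
  | zero => simp
  | succ N ih => rw [Finset.sum_range_succ, ih, he N]; ring

theorem tendsto_christoffel_boundary {e w : ℕ → ℝ} (hb : ∀ n, |e n| ≤ 1)
    (hw : Tendsto w atTop (𝓝 0)) :
    Tendsto (fun N => e N * w (N + 1) - e (N + 1) * w N) atTop (𝓝 0) := by
  have h1 : Tendsto (fun N => |w (N + 1)| + |w N|) atTop (𝓝 0) := by
    simpa using ((hw.comp (tendsto_add_atTop_nat 1)).abs).add hw.abs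
  refine squeeze_zero_norm (fun N => ?_) h1
  calc ‖e N * w (N + 1) - e (N + 1) * w N‖ ≤ ‖e N * w (N + 1)‖ + ‖e (N + 1) * w N‖ := norm_sub_le _ _
    _ ≤ _ := by
      rw [norm_mul, norm_mul]
      simp only [Real.norm_eq_abs]
      gcongr
      · exact mul_le_of_le_one_left (abs_nonneg _) (hb _)
      · exact mul_le_of_le_one_left (abs_nonneg _) (hb _)

/-- Cosine integrals `∫ G (R cos φ) cos (n φ)` sum to `G`. -/
theorem tendsto_sum_cos_integral {G : ℝ → ℝ} (hG : ContDiff ℝ 1 G) (R ξ : ℝ) {e : ℕ → ℝ}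
    (he0 : e 0 = 1) (he1 : e 1 = ξ) (he : ∀ n, e (n + 2) = 2 * ξ * e (n + 1) - e n)
    (hb : ∀ n, |e n| ≤ 1) :
    Tendsto (fun N => ∑ n ∈ Finset.range N,
        2 * (∫ φ in (0 : ℝ)..π, G (R * cos φ) * cos ((n + 1 : ℕ) * φ)) * e (n + 1)) atTop
      (𝓝 (π * G (R * ξ) - ∫ φ in (0 : ℝ)..π, G (R * cos φ))) := by
  set w : ℕ → ℝ := fun n => ∫ φ in (0 : ℝ)..π, divDiff G R ξ φ * cos (n * φ) with hw
  have hcont : Continuous fun φ => G (R * cos φ) := hG.continuous.comp (by fun_prop)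
  have hi : ∀ n : ℕ, IntervalIntegrable (fun φ => divDiff G R ξ φ * cos (n * φ)) volume 0 π :=
    fun n => intervalIntegrable_divDiff_mul hG R ξ (by fun_prop) _ _
  have h0 : ∫ φ in (0 : ℝ)..π, G (R * cos φ) = π * G (R * ξ) - ξ * w 0 + w 1 := by
    have : ∀ φ, G (R * cos φ) = G (R * ξ) - ξ * (divDiff G R ξ φ * cos ((0 : ℕ) * φ)) +
        divDiff G R ξ φ * cos ((1 : ℕ) * φ) := by
      intro φ
      have := divDiff_mul G R ξ φ
      simp only [Nat.cast_zero, zero_mul, cos_zero, Nat.cast_one, one_mul]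
      linear_combination this
    simp only [this]
    rw [intervalIntegral.integral_add (intervalIntegrable_const.sub ((hi 0).const_mul ξ)) (hi 1),
      intervalIntegral.integral_sub (by simp) ((hi 0).const_mul ξ),
      intervalIntegral.integral_const_mul]
    simp [hw]
  -- Write G(R cos φ) as G(Rξ) minus (ξ - cos φ) times the divided difference. Multiplication by cos
  -- φ shifts frequencies by ±1, so the recurrence operator acts on `w`; it annihilates `e`, and the
  -- sum reduces to boundary terms.
  have hn : ∀ n : ℕ, 2 * (∫ φ in (0 : ℝ)..π, G (R * cos φ) * cos ((n + 1 : ℕ) * φ)) =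
      w (n + 2) + w n - 2 * ξ * w (n + 1) := by
    intro n
    have : ∀ φ, G (R * cos φ) * cos ((n + 1 : ℕ) * φ) =
        G (R * ξ) * cos ((n + 1 : ℕ) * φ) - ξ * (divDiff G R ξ φ * cos ((n + 1 : ℕ) * φ)) +
        ((divDiff G R ξ φ * cos ((n + 2 : ℕ) * φ)) / 2 + (divDiff G R ξ φ * cos (n * φ)) / 2) := by
      intro φ
      have h := divDiff_mul G R ξ φ
      rw [show ((n : ℕ) : ℝ) * φ = (n + 1 : ℕ) * φ - φ by push_cast; ring,
        show ((n + 2 : ℕ) : ℝ) * φ = (n + 1 : ℕ) * φ + φ by push_cast; ring, cos_add, cos_sub]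
      linear_combination cos ((n + 1 : ℕ) * φ) * h
    have i1 : IntervalIntegrable (fun φ : ℝ => G (R * ξ) * cos ((n + 1 : ℕ) * φ)) volume 0 π := by
      apply Continuous.intervalIntegrable; fun_prop
    simp only [this]
    rw [intervalIntegral.integral_add (i1.sub ((hi _).const_mul ξ))
        (((hi _).div_const 2).add ((hi _).div_const 2)),
      intervalIntegral.integral_sub i1 ((hi _).const_mul ξ),
      intervalIntegral.integral_add ((hi _).div_const 2) ((hi _).div_const 2),
      intervalIntegral.integral_const_mul, intervalIntegral.integral_const_mul,
      intervalIntegral.integral_div, intervalIntegral.integral_div, integral_cos_nat_mul]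
    simp [hw]; ring
  simp only [hn]
  simp only [sum_range_mul_of_three_term he]
  have hw0 : Tendsto w atTop (𝓝 0) :=
    tendsto_integral_mul_cos_nat (intervalIntegrable_divDiff hG R ξ _ _)
  have := (tendsto_christoffel_boundary hb hw0).sub_const (e 0 * w 1 - e 1 * w 0)
  convert! this using 2
  rw [h0, he0, he1]; ring

/-- The conjugate series of `∫ G (R cos φ) sin φ sin (n φ)`. -/
theorem tendsto_sum_sin_integral {G : ℝ → ℝ} (hG : ContDiff ℝ 1 G) (hodd : ∀ x, G (-x) = -G x)
    (R ξ : ℝ) {e : ℕ → ℝ}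
    (he0 : e 0 = 1) (he : ∀ n, e (n + 2) = 2 * ξ * e (n + 1) - e n)
    (hb : ∀ n, |e n| ≤ 1) :
    Tendsto (fun N => ∑ n ∈ Finset.range N,
        2 * (∫ φ in (0 : ℝ)..π, G (R * cos φ) * sin φ * sin ((n + 1 : ℕ) * φ)) * e (n + 1)) atTop
      (𝓝 (π * G (R * ξ) * (e 1 - ξ) + (∫ φ in (0 : ℝ)..π, cos φ * G (R * cos φ)) -
        (1 - ξ ^ 2) * ∫ φ in (0 : ℝ)..π, divDiff G R ξ φ)) := by
  set w : ℕ → ℝ := fun n => ∫ φ in (0 : ℝ)..π, divDiff G R ξ φ * cos (n * φ) with hw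
  set v : ℕ → ℝ := fun n => ∫ φ in (0 : ℝ)..π, divDiff G R ξ φ * (2 * sin φ * sin (n * φ)) with hv
  have hcont : Continuous fun φ => G (R * cos φ) := hG.continuous.comp (by fun_prop)
  have hiw : ∀ n : ℕ, IntervalIntegrable (fun φ => divDiff G R ξ φ * cos (n * φ)) volume 0 π :=
    fun n => intervalIntegrable_divDiff_mul hG R ξ (by fun_prop) _ _
  have hi : ∀ n : ℕ, IntervalIntegrable
      (fun φ => divDiff G R ξ φ * (2 * sin φ * sin (n * φ))) volume 0 π :=
    fun n => intervalIntegrable_divDiff_mul hG R ξ (by fun_prop) _ _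
  have hv0 : v 0 = 0 := by simp [hv]
  -- Differences of cosine coefficients: decay of `v` follows from the cosine Riemann–Lebesgue
  -- lemma.
  have hvw : ∀ n, v (n + 1) = w n - w (n + 2) := by
    intro n
    simp only [hv, hw]
    rw [← intervalIntegral.integral_sub (hiw _) (hiw _)]
    congr 1; ext φ
    rw [show ((n : ℕ) : ℝ) * φ = (n + 1 : ℕ) * φ - φ by push_cast; ring,
        show ((n + 2 : ℕ) : ℝ) * φ = (n + 1 : ℕ) * φ + φ by push_cast; ring, cos_add, cos_sub]
    ring
  have hw0 : Tendsto w atTop (𝓝 0) :=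
    tendsto_integral_mul_cos_nat (intervalIntegrable_divDiff hG R ξ _ _)
  have hvt : Tendsto v atTop (𝓝 0) := by
    rw [← tendsto_add_atTop_iff_nat 1]
    simp only [hvw]
    simpa using hw0.sub (hw0.comp (tendsto_add_atTop_nat 2))
  -- Unlike in the cosine case, the constant G(Rξ) contributes once, since sin φ is orthogonal to
  -- sin((n+1)φ) only for n ≥ 1.
  have hn : ∀ n : ℕ, 2 * (∫ φ in (0 : ℝ)..π, G (R * cos φ) * sin φ * sin ((n + 1 : ℕ) * φ)) =
      (if n = 0 then π * G (R * ξ) else 0) +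
        2⁻¹ * (v (n + 2) + v n - 2 * ξ * v (n + 1)) := by
    intro n
    have : ∀ φ, G (R * cos φ) * sin φ * sin ((n + 1 : ℕ) * φ) =
        G (R * ξ) * (sin φ * sin ((n + 1 : ℕ) * φ)) -
          (ξ / 2) * (divDiff G R ξ φ * (2 * sin φ * sin ((n + 1 : ℕ) * φ))) +
        ((divDiff G R ξ φ * (2 * sin φ * sin ((n + 2 : ℕ) * φ))) / 4 +
          (divDiff G R ξ φ * (2 * sin φ * sin (n * φ))) / 4) := by
      intro φ
      have h := divDiff_mul G R ξ φ
      rw [show ((n : ℕ) : ℝ) * φ = (n + 1 : ℕ) * φ - φ by push_cast; ring,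
        show ((n + 2 : ℕ) : ℝ) * φ = (n + 1 : ℕ) * φ + φ by push_cast; ring, sin_add, sin_sub]
      linear_combination sin φ * sin ((n + 1 : ℕ) * φ) * h
    have i1 : IntervalIntegrable (fun φ : ℝ => G (R * ξ) * (sin φ * sin ((n + 1 : ℕ) * φ)))
        volume 0 π := by
      apply Continuous.intervalIntegrable; fun_prop
    simp only [this]
    rw [intervalIntegral.integral_add (i1.sub ((hi _).const_mul _))
        (((hi _).div_const 4).add ((hi _).div_const 4)),
      intervalIntegral.integral_sub i1 ((hi _).const_mul _),
      intervalIntegral.integral_add ((hi _).div_const 4) ((hi _).div_const 4),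
      intervalIntegral.integral_const_mul, intervalIntegral.integral_const_mul,
      intervalIntegral.integral_div, intervalIntegral.integral_div, integral_sin_mul_sin_nat]
    simp only [hv]
    split_ifs <;> ring
  -- The range is N + 1 so that the exceptional index n = 0 is always included.
  have hsum : ∀ N : ℕ, ∑ n ∈ Finset.range (N + 1),
        2 * (∫ φ in (0 : ℝ)..π, G (R * cos φ) * sin φ * sin ((n + 1 : ℕ) * φ)) * e (n + 1) =
      π * G (R * ξ) * e 1 + 2⁻¹ * ((e (N + 1) * v (N + 2) - e (N + 2) * v (N + 1)) - v 1) := by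
    intro N
    have h := sum_range_mul_of_three_term (w := v) he (N + 1)
    rw [hv0, he0] at h
    have h' : ∀ n, 2 * (∫ φ in (0 : ℝ)..π, G (R * cos φ) * sin φ * sin ((n + 1 : ℕ) * φ)) *
        e (n + 1) = (if n = 0 then π * G (R * ξ) * e 1 else 0) +
        2⁻¹ * ((v (n + 2) + v n - 2 * ξ * v (n + 1)) * e (n + 1)) := by
      intro n
      rw [hn]
      split_ifs with h0
      · subst h0; ring
      · ring
    simp only [h']
    rw [Finset.sum_add_distrib, ← Finset.mul_sum, h]
    simp
  -- Use sin² φ = (1 - ξ²) + (ξ - cos φ)(ξ + cos φ); the second product clears the denominator of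
  -- the divided difference, and oddness of G removes ∫ G(R cos φ).
  have hv1 : 2⁻¹ * v 1 = (1 - ξ ^ 2) * (∫ φ in (0 : ℝ)..π, divDiff G R ξ φ) + π * G (R * ξ) * ξ -
      ∫ φ in (0 : ℝ)..π, cos φ * G (R * cos φ) := by
    have hz : ∫ φ in (0 : ℝ)..π, G (R * cos φ) = 0 := by
      have h := intervalIntegral.integral_comp_sub_left (a := 0) (b := π)
        (fun φ => G (R * cos φ)) π
      simp only [cos_pi_sub, mul_neg, hodd, intervalIntegral.integral_neg, sub_self, sub_zero] at h
      linarith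
    have hc : ∫ φ in (0 : ℝ)..π, cos φ = 0 := by simp [integral_cos]
    have : ∀ φ, divDiff G R ξ φ * (2 * sin φ * sin ((1 : ℕ) * φ)) =
        2 * ((1 - ξ ^ 2) * divDiff G R ξ φ + ((G (R * ξ) * ξ + G (R * ξ) * cos φ) -
          (ξ * G (R * cos φ) + cos φ * G (R * cos φ)))) := by
      intro φ
      have h := divDiff_mul G R ξ φ
      have hs := sin_sq_add_cos_sq φ
      rw [Nat.cast_one, one_mul]
      linear_combination 2 * (ξ + cos φ) * h + 2 * divDiff G R ξ φ * hs
    simp only [hv, this]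
    have c1 : IntervalIntegrable (fun φ => ξ * G (R * cos φ)) volume 0 π :=
      (hcont.const_mul ξ).intervalIntegrable _ _
    have c2 : IntervalIntegrable (fun φ => cos φ * G (R * cos φ)) volume 0 π :=
      (continuous_cos.mul hcont).intervalIntegrable _ _
    have c3 : IntervalIntegrable (fun φ => G (R * ξ) * cos φ) volume 0 π :=
      (continuous_cos.const_mul _).intervalIntegrable _ _
    rw [intervalIntegral.integral_const_mul, intervalIntegral.integral_add
      ((intervalIntegrable_divDiff hG R ξ _ _).const_mul _)
      ((intervalIntegrable_const.add c3).sub (c1.add c2)),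
      intervalIntegral.integral_sub (intervalIntegrable_const.add c3) (c1.add c2),
      intervalIntegral.integral_add intervalIntegrable_const c3,
      intervalIntegral.integral_add c1 c2, intervalIntegral.integral_const_mul (1 - ξ ^ 2),
      intervalIntegral.integral_const_mul ξ, intervalIntegral.integral_const_mul (G (R * ξ)) cos,
      hz, hc, intervalIntegral.integral_const]
    simp only [sub_zero, smul_eq_mul]; ring
  rw [← tendsto_add_atTop_iff_nat 1]
  simp only [hsum]
  have hB := (tendsto_christoffel_boundary hb hvt).comp (tendsto_add_atTop_nat 1)
  have := ((hB.sub_const (v 1)).const_mul 2⁻¹).const_add (π * G (R * ξ) * e 1)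
  convert! this using 2
  rw [zero_sub, mul_neg, hv1]; ring

end LogGas

namespace LogGas
open Real

/-! ### The potential and its Chebyshev coefficients -/

theorem chebCoeff_eq_integral_cos (V : ℝ → ℝ) (n : ℕ) (R : ℝ) :
    chebCoeff V n R = (if n = 0 then π else π / 2)⁻¹ *
      ∫ φ in (0 : ℝ)..π, V (R * cos φ) * cos (n * φ) := by
  have h := Polynomial.Chebyshev.integral_measureT_eq_integral_cos
    (f := fun u => V (R * u) * (Polynomial.Chebyshev.T ℝ (n : ℤ)).eval u)
  rw [Polynomial.Chebyshev.integral_measureT] at h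
  simp only [Polynomial.Chebyshev.T_real_cos, Int.cast_natCast] at h
  rw [chebCoeff, ← h]
  congr 2
  ext u
  rw [Real.sqrt_inv, div_eq_mul_inv]

theorem chebCoeff_zero (V : ℝ → ℝ) (R : ℝ) :
    chebCoeff V 0 R = π⁻¹ * ∫ φ in (0 : ℝ)..π, V (R * cos φ) := by
  simp [chebCoeff_eq_integral_cos]

theorem chebCoeff_of_ne_zero (V : ℝ → ℝ) {n : ℕ} (hn : n ≠ 0) (R : ℝ) :
    chebCoeff V n R = 2 * π⁻¹ * ∫ φ in (0 : ℝ)..π, V (R * cos φ) * cos (n * φ) := by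
  simp [chebCoeff_eq_integral_cos, hn, div_eq_mul_inv]

/-- `S(R) = π⁻¹ ∫ x V'(x)` over the arcsine law, which is `∑ n c_n(R)`. -/
noncomputable def virial (V : ℝ → ℝ) (R : ℝ) : ℝ :=
  π⁻¹ * ∫ φ in (0 : ℝ)..π, R * cos φ * deriv V (R * cos φ)

/-- The average of the divided difference of `V'` over the arcsine law. -/
noncomputable def meanDivDiff (V : ℝ → ℝ) (R ξ : ℝ) : ℝ :=
  R * π⁻¹ * ∫ φ in (0 : ℝ)..π, divDiff (deriv V) R ξ φ

namespace IsAdmissible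

variable {V : ℝ → ℝ} (hV : IsAdmissible V)

include hV

theorem contDiff_deriv : ContDiff ℝ 2 (deriv V) := by
  have := hV.contDiff
  rw [show (3 : WithTop ℕ∞) = 2 + 1 by norm_num, contDiff_succ_iff_deriv] at this
  exact this.2.2

theorem contDiff_deriv2 : ContDiff ℝ 1 (deriv (deriv V)) := by
  have := hV.contDiff_deriv
  rw [show (2 : WithTop ℕ∞) = 1 + 1 by norm_num, contDiff_succ_iff_deriv] at this
  exact this.2.2

theorem hasDerivAt (x : ℝ) : HasDerivAt V (deriv V x) x :=
  (hV.contDiff.differentiable (by norm_num)).differentiableAt.hasDerivAt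

theorem hasDerivAt_deriv (x : ℝ) : HasDerivAt (deriv V) (deriv (deriv V) x) x :=
  (hV.contDiff_deriv.differentiable (by norm_num)).differentiableAt.hasDerivAt

theorem hasDerivAt_deriv2 (x : ℝ) :
    HasDerivAt (deriv (deriv V)) (deriv (deriv (deriv V)) x) x :=
  (hV.contDiff_deriv2.differentiable (by norm_num)).differentiableAt.hasDerivAt

theorem continuous : Continuous V := hV.contDiff.continuous

theorem continuous_deriv : Continuous (deriv V) := hV.contDiff_deriv.continuous

theorem continuous_deriv2 : Continuous (deriv (deriv V)) := hV.contDiff_deriv2.continuous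

theorem continuous_deriv3 : Continuous (deriv (deriv (deriv V))) :=
  hV.contDiff_deriv2.continuous_deriv le_rfl

theorem deriv_odd (x : ℝ) : deriv V (-x) = -deriv V x := by
  have h : (fun x => V (-x)) = V := funext hV.even
  have h2 := deriv_comp_neg V x
  rw [h] at h2
  linarith

theorem strictMono_deriv : StrictMono (deriv V) := fun x y hxy =>
  (hV.strictConvex.deriv_lt_slope (mem_univ x) (mem_univ y) hxy
    (hV.hasDerivAt x).differentiableAt).trans
  (hV.strictConvex.slope_lt_deriv (mem_univ x) (mem_univ y) hxy
    (hV.hasDerivAt y).differentiableAt)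

theorem deriv_zero : deriv V 0 = 0 := by
  have := hV.deriv_odd 0
  rw [neg_zero] at this
  linarith

theorem mul_deriv_pos {x : ℝ} (hx : x ≠ 0) : 0 < x * deriv V x := by
  rcases hx.lt_or_gt with h | h
  · have := hV.strictMono_deriv h
    rw [hV.deriv_zero] at this
    exact mul_pos_of_neg_of_neg h this
  · have := hV.strictMono_deriv h
    rw [hV.deriv_zero] at this
    exact mul_pos h this

theorem mul_deriv_nonneg (x : ℝ) : 0 ≤ x * deriv V x := by
  rcases eq_or_ne x 0 with rfl | h
  · simp
  · exact (hV.mul_deriv_pos h).le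

theorem deriv_one_pos : 0 < deriv V 1 := by
  simpa using hV.mul_deriv_pos one_ne_zero

theorem hasDerivAt_comp_cos (R φ : ℝ) :
    HasDerivAt (fun φ => V (R * cos φ)) (-(R * deriv V (R * cos φ) * sin φ)) φ := by
  convert! (hV.hasDerivAt (R * cos φ)).comp φ ((hasDerivAt_cos φ).const_mul R) using 1
  ring

/-- One integration by parts; the sine form is the one summed by `tendsto_sum_sin_integral`. -/
theorem nat_mul_chebCoeff (n : ℕ) (R : ℝ) : n * chebCoeff V n R =
    R * π⁻¹ * (2 * ∫ φ in (0 : ℝ)..π, deriv V (R * cos φ) * sin φ * sin (n * φ)) := by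
  rcases eq_or_ne n 0 with rfl | hn
  · simp
  have h1 := hV.continuous_deriv
  have h := nat_mul_integral_mul_cos (hV.hasDerivAt_comp_cos R) (by fun_prop) n
  rw [chebCoeff_of_ne_zero V hn, mul_left_comm, h, ← intervalIntegral.integral_neg]
  have : ∀ φ, -(-(R * deriv V (R * cos φ) * sin φ) * sin (n * φ)) =
    R * (deriv V (R * cos φ) * sin φ * sin (n * φ)) := fun φ => by ring
  simp only [this, intervalIntegral.integral_const_mul]
  ring

/-- Two further integrations by parts, which use up the third derivative of V. Uniformity in R is
what later permits termwise differentiation in R. -/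
theorem exists_nat_sq_mul_le (B : ℝ) :
    ∃ K, ∀ R, |R| ≤ B → ∀ n : ℕ, (n : ℝ) ^ 2 * |n * chebCoeff V n R| ≤ K := by
  have c1 := hV.continuous_deriv
  have c2 := hV.continuous_deriv2
  have c3 := hV.continuous_deriv3
  -- The second φ-derivative of V'(R cos φ) sin φ. The factor sin φ kills the boundary terms of the
  -- first integration by parts.
  set g2 : ℝ × ℝ → ℝ := fun p => p.1 ^ 2 * deriv (deriv (deriv V)) (p.1 * cos p.2) * sin p.2 ^ 3 -
    3 * p.1 * deriv (deriv V) (p.1 * cos p.2) * sin p.2 * cos p.2 -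
      deriv V (p.1 * cos p.2) * sin p.2 with hg2
  have hg2c : Continuous g2 := by fun_prop
  obtain ⟨M, hM⟩ := (isCompact_Icc.prod isCompact_Icc).exists_bound_of_continuousOn
    (s := Icc (-B) B ×ˢ Icc 0 π) hg2c.continuousOn
  refine ⟨2 * (B * M), fun R hR n => ?_⟩
  have hM0 : 0 ≤ M := (norm_nonneg _).trans (hM (R, 0) ⟨abs_le.1 hR, by simp [pi_pos.le]⟩)
  have d1 : ∀ φ, HasDerivAt (fun φ => deriv V (R * cos φ))
      (deriv (deriv V) (R * cos φ) * (R * -sin φ)) φ := fun φ =>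
    HasDerivAt.comp (h₂ := deriv V) φ (hV.hasDerivAt_deriv _) ((hasDerivAt_cos φ).const_mul R)
  have d2 : ∀ φ, HasDerivAt (fun φ => deriv (deriv V) (R * cos φ))
      (deriv (deriv (deriv V)) (R * cos φ) * (R * -sin φ)) φ := fun φ =>
    HasDerivAt.comp (h₂ := deriv (deriv V)) φ (hV.hasDerivAt_deriv2 _)
      ((hasDerivAt_cos φ).const_mul R)
  have i1 := nat_mul_integral_mul_sin (f := fun φ => deriv V (R * cos φ) * sin φ)
    (fun φ => (d1 φ).mul (hasDerivAt_sin φ)) (by fun_prop) n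
  have i2 := nat_mul_integral_mul_cos (f := fun φ => deriv (deriv V) (R * cos φ) * (R * -sin φ) *
      sin φ + deriv V (R * cos φ) * cos φ) (f' := fun φ => g2 (R, φ))
    (fun φ => by
      convert! (((d2 φ).mul ((hasDerivAt_sin φ).neg.const_mul R)).mul (hasDerivAt_sin φ)).add
        ((d1 φ).mul (hasDerivAt_cos φ)) using 1
      simp only [hg2, Pi.mul_apply, Pi.neg_apply]
      ring) (by fun_prop) n
  simp only [sin_zero, sin_pi, mul_zero, zero_mul, sub_zero, zero_add] at i1
  have key : (n : ℝ) ^ 2 * (n * chebCoeff V n R) =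
      - (R * (2 * π⁻¹) * ∫ φ in (0 : ℝ)..π, g2 (R, φ) * sin (n * φ)) := by
    rw [hV.nat_mul_chebCoeff]
    have e : ∀ I : ℝ, (n : ℝ) ^ 2 * (R * π⁻¹ * (2 * I)) = R * (2 * π⁻¹) * (n * (n * I)) := by
      intro I; ring
    rw [e, i1, i2, mul_neg]
  have hb : |∫ φ in (0 : ℝ)..π, g2 (R, φ) * sin (n * φ)| ≤ M * π := by
    have := intervalIntegral.norm_integral_le_of_norm_le_const (a := 0) (b := π) (C := M)
      (f := fun φ => g2 (R, φ) * sin (n * φ)) (fun φ hφ => by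
        rw [uIoc_of_le pi_pos.le] at hφ
        rw [norm_mul]
        exact (mul_le_of_le_one_right (norm_nonneg _) (abs_sin_le_one _)).trans
          (hM (R, φ) ⟨abs_le.1 hR, hφ.1.le, hφ.2⟩))
    simpa [abs_of_pos pi_pos] using this
  have e1 : (n : ℝ) ^ 2 * |n * chebCoeff V n R| = |(n : ℝ) ^ 2 * (n * chebCoeff V n R)| := by
    rw [abs_mul ((n : ℝ) ^ 2), abs_of_nonneg (sq_nonneg (n : ℝ))]
  rw [e1, key, abs_neg, abs_mul, abs_mul, abs_of_pos (show 0 < 2 * π⁻¹ by positivity)]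
  calc |R| * (2 * π⁻¹) * |∫ φ in (0 : ℝ)..π, g2 (R, φ) * sin (n * φ)|
      ≤ B * (2 * π⁻¹) * (M * π) := by
        gcongr
        exact mul_nonneg ((abs_nonneg _).trans hR) (by positivity)
    _ = _ := by field_simp

theorem exists_abs_nat_mul_chebCoeff_le (B : ℝ) :
    ∃ K, 0 ≤ K ∧ ∀ R, |R| ≤ B → ∀ n : ℕ, |n * chebCoeff V n R| ≤ K * (1 / (n : ℝ) ^ 2) := by
  obtain ⟨K, hK⟩ := hV.exists_nat_sq_mul_le B
  refine ⟨|K|, abs_nonneg K, fun R hR n => ?_⟩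
  rcases eq_or_ne n 0 with rfl | hn
  · simp
  have : 0 < (n : ℝ) ^ 2 := by positivity
  rw [mul_one_div, le_div_iff₀ this, mul_comm]
  exact (hK R hR n).trans (le_abs_self K)

theorem summable_abs_nat_mul_chebCoeff (R : ℝ) :
    Summable (fun n : ℕ => |(n : ℝ) * chebCoeff V n R|) := by
  obtain ⟨K, -, hK⟩ := hV.exists_abs_nat_mul_chebCoeff_le |R|
  exact Summable.of_nonneg_of_le (fun _ => abs_nonneg _) (hK R le_rfl)
    ((Real.summable_one_div_nat_pow.2 (by norm_num)).mul_left K)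

theorem summable_nat_mul_chebCoeff_mul (R : ℝ) {e : ℕ → ℝ} (he : ∀ n, |e n| ≤ 1) :
    Summable (fun n : ℕ => (n : ℝ) * chebCoeff V n R * e n) :=
  Summable.of_norm_bounded (hV.summable_abs_nat_mul_chebCoeff R) fun n => by
    rw [norm_mul]
    exact mul_le_of_le_one_right (abs_nonneg _) (he n)

theorem summable_abs_chebCoeff (R : ℝ) : Summable (fun n : ℕ => |chebCoeff V (n + 1) R|) := by
  refine Summable.of_nonneg_of_le (fun _ => abs_nonneg _) (fun n => ?_)
    ((summable_nat_add_iff 1).2 (hV.summable_abs_nat_mul_chebCoeff R))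
  rw [abs_mul]
  refine le_mul_of_one_le_left (abs_nonneg _) ?_
  rw [abs_of_nonneg (by positivity)]
  push_cast
  linarith [Nat.cast_nonneg (α := ℝ) n]

theorem summable_chebCoeff_mul (R : ℝ) {e : ℕ → ℝ} (he : ∀ n, |e n| ≤ 1) :
    Summable (fun n : ℕ => chebCoeff V (n + 1) R * e (n + 1)) :=
  Summable.of_norm_bounded (hV.summable_abs_chebCoeff R) fun n => by
    rw [norm_mul]
    exact mul_le_of_le_one_right (abs_nonneg _) (he _)

/-- Chebyshev expansion of the potential. -/
theorem hasSum_chebCoeff (R ξ : ℝ) {e : ℕ → ℝ} (he0 : e 0 = 1) (he1 : e 1 = ξ)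
    (he : ∀ n, e (n + 2) = 2 * ξ * e (n + 1) - e n) (hb : ∀ n, |e n| ≤ 1) :
    HasSum (fun n : ℕ => chebCoeff V (n + 1) R * e (n + 1)) (V (R * ξ) - chebCoeff V 0 R) := by
  have h := (tendsto_sum_cos_integral (hV.contDiff.of_le (by norm_num)) R ξ he0 he1 he hb).const_mul
    π⁻¹
  have h2 := (hV.summable_chebCoeff_mul R hb).hasSum
  convert! h2 using 1
  refine tendsto_nhds_unique (h.congr fun N => ?_ ) h2.tendsto_sum_nat |>.symm ▸ ?_
  · rw [Finset.mul_sum]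
    refine Finset.sum_congr rfl fun n _ => ?_
    rw [chebCoeff_of_ne_zero V n.succ_ne_zero]
    ring
  · rw [chebCoeff_zero, mul_sub, inv_mul_cancel_left₀ pi_ne_zero]

/-- Summation of the conjugate series `∑ n c_n e_n`. -/
theorem hasSum_nat_mul_chebCoeff (R ξ : ℝ) {e : ℕ → ℝ} (he0 : e 0 = 1)
    (he : ∀ n, e (n + 2) = 2 * ξ * e (n + 1) - e n) (hb : ∀ n, |e n| ≤ 1) :
    HasSum (fun n : ℕ => n * chebCoeff V n R * e n)
      (virial V R + R * deriv V (R * ξ) * (e 1 - ξ) - (1 - ξ ^ 2) * meanDivDiff V R ξ) := by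
  have h := (tendsto_sum_sin_integral (hV.contDiff_deriv.of_le (by norm_num)) hV.deriv_odd R ξ he0
    he hb).const_mul (R * π⁻¹)
  have h2 := (hV.summable_nat_mul_chebCoeff_mul R hb).hasSum
  convert! h2 using 1
  have h3 := (tendsto_add_atTop_iff_nat 1).2 h2.tendsto_sum_nat
  refine tendsto_nhds_unique (h.congr fun N => ?_ ) h3 |>.symm ▸ ?_
  · rw [Finset.mul_sum, Finset.sum_range_succ']
    simp only [hV.nat_mul_chebCoeff]
    simp only [CharP.cast_eq_zero, zero_mul, sin_zero, mul_zero, intervalIntegral.integral_zero,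
      add_zero]
    refine Finset.sum_congr rfl fun n _ => ?_
    ring
  · rw [virial, meanDivDiff]
    simp only [mul_assoc R, intervalIntegral.integral_const_mul]
    field_simp
    ring

theorem meanDivDiff_nonneg {R : ℝ} (hR : 0 ≤ R) (ξ : ℝ) : 0 ≤ meanDivDiff V R ξ := by
  refine mul_nonneg (by positivity) (intervalIntegral.integral_nonneg pi_pos.le fun φ _ => ?_)
  rw [divDiff]
  rcases le_total ξ (cos φ) with h | h
  · exact div_nonneg_of_nonpos (sub_nonpos.2 (hV.strictMono_deriv.monotone
      (mul_le_mul_of_nonneg_left h hR))) (sub_nonpos.2 h)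
  · exact div_nonneg (sub_nonneg.2 (hV.strictMono_deriv.monotone
      (mul_le_mul_of_nonneg_left h hR))) (sub_nonneg.2 h)

theorem meanDivDiff_pos {R : ℝ} (hR : 0 < R) (ξ : ℝ) : 0 < meanDivDiff V R ξ := by
  refine mul_pos (by positivity) ?_
  have hpos : ∀ φ, cos φ ≠ ξ → 0 < divDiff (deriv V) R ξ φ := by
    intro φ hφ
    rw [divDiff]
    rcases hφ.lt_or_gt with h | h
    · exact div_pos (sub_pos.2 (hV.strictMono_deriv (mul_lt_mul_of_pos_left h hR)))
        (sub_pos.2 h)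
    · exact div_pos_of_neg_of_neg (sub_neg.2 (hV.strictMono_deriv (mul_lt_mul_of_pos_left h hR)))
        (sub_neg.2 h)
  have hnn : ∀ φ, 0 ≤ divDiff (deriv V) R ξ φ := by
    intro φ
    by_cases h : cos φ = ξ
    · simp [divDiff, h]
    · exact (hpos φ h).le
  rw [intervalIntegral.integral_pos_iff_support_of_nonneg_ae (ae_of_all _ hnn)
    (intervalIntegrable_divDiff (hV.contDiff_deriv.of_le (by norm_num)) R ξ _ _)]
  refine ⟨pi_pos, ?_⟩
  -- The divided difference can vanish only where cos φ = ξ, where its value is the division-by-zero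
  -- default; this is at most one angle.
  have hsub : Ioo 0 π \ {arccos ξ} ⊆ Function.support (divDiff (deriv V) R ξ) ∩ Ioc 0 π := by
    rintro φ ⟨hφ, hne⟩
    refine ⟨(hpos φ fun h => hne ?_).ne', hφ.1, hφ.2.le⟩
    rw [mem_singleton_iff, ← h, arccos_cos hφ.1.le hφ.2.le]
  refine lt_of_lt_of_le ?_ (measure_mono hsub)
  rw [measure_sdiff_null (by simp)]
  simp [pi_pos]

end IsAdmissible

theorem chebyshev_T_eval_succ_succ (ξ : ℝ) (n : ℕ) :
    (Polynomial.Chebyshev.T ℝ ((n + 2 : ℕ) : ℤ)).eval ξ =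
      2 * ξ * (Polynomial.Chebyshev.T ℝ ((n + 1 : ℕ) : ℤ)).eval ξ -
        (Polynomial.Chebyshev.T ℝ (n : ℤ)).eval ξ := by
  push_cast
  rw [Polynomial.Chebyshev.T_add_two]
  simp

namespace IsAdmissible

variable {V : ℝ → ℝ} (hV : IsAdmissible V)

include hV

theorem hasSum_chebCoeff_T (R : ℝ) {ξ : ℝ} (hξ : |ξ| ≤ 1) :
    HasSum (fun n : ℕ => chebCoeff V (n + 1) R *
      (Polynomial.Chebyshev.T ℝ ((n + 1 : ℕ) : ℤ)).eval ξ) (V (R * ξ) - chebCoeff V 0 R) :=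
  hV.hasSum_chebCoeff R ξ (e := fun n => (Polynomial.Chebyshev.T ℝ (n : ℤ)).eval ξ)
    (by simp) (by simp) (chebyshev_T_eval_succ_succ ξ)
    (fun n => Polynomial.Chebyshev.abs_eval_T_real_le_one n hξ)

/-- For e_n = T_n(ξ) one has e_1 = ξ, so the V' term of the summation formula drops out. This closed
form makes the sign of the density visible. -/
theorem P_eq (R : ℝ) {x : ℝ} (hx : |x / R| ≤ 1) :
    P V R x = 1 - virial V R + (1 - (x / R) ^ 2) * meanDivDiff V R (x / R) := by
  have h := hV.hasSum_nat_mul_chebCoeff R (x / R)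
    (e := fun n => (Polynomial.Chebyshev.T ℝ (n : ℤ)).eval (x / R))
    (by simp) (chebyshev_T_eval_succ_succ _)
    (fun n => Polynomial.Chebyshev.abs_eval_T_real_le_one n hx)
  rw [P, h.tsum_eq]
  simp
  ring

/-- The constant sequence solves the recurrence at ξ = 1, where both correction terms vanish. -/
theorem hasSum_virial (R : ℝ) : HasSum (fun n : ℕ => (n : ℝ) * chebCoeff V n R) (virial V R) := by
  simpa using hV.hasSum_nat_mul_chebCoeff R 1 (e := fun _ => 1) rfl (fun _ => by norm_num)
    (fun _ => by simp)

theorem P_self {R : ℝ} (hR : 0 < R) : P V R R = 1 - virial V R := by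
  rw [hV.P_eq R (by simp [hR.ne']), div_self hR.ne']
  ring

theorem P_nonneg {R x : ℝ} (hR : 0 < R) (hS : virial V R ≤ 1) (hx : |x / R| ≤ 1) :
    0 ≤ P V R x := by
  rw [hV.P_eq R hx]
  have h1 := hV.meanDivDiff_nonneg hR.le (x / R)
  have h2 : (x / R) ^ 2 ≤ 1 := (sq_le_one_iff_abs_le_one _).2 hx
  nlinarith [mul_nonneg (sub_nonneg.2 h2) h1]

theorem P_pos {R x : ℝ} (hR : 0 < R) (hS : virial V R ≤ 1) (hx : |x / R| < 1) :
    0 < P V R x := by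
  rw [hV.P_eq R hx.le]
  have h1 := hV.meanDivDiff_pos hR (x / R)
  have h2 : (x / R) ^ 2 < 1 := (sq_lt_one_iff_abs_lt_one _).2 hx
  nlinarith [mul_pos (sub_pos.2 h2) h1]

/-- Reflection φ ↦ π - φ. In this form it removes the factor σ^n at the left end σ = -1; for n = 1
it makes the coefficient vanish. -/
theorem neg_one_pow_mul_chebCoeff (n : ℕ) (R : ℝ) :
    (-1) ^ n * chebCoeff V n R = chebCoeff V n R := by
  have h := intervalIntegral.integral_comp_sub_left (a := 0) (b := π)
    (fun φ => V (R * cos φ) * cos (n * φ)) π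
  have h2 : ∀ φ : ℝ, V (R * cos (π - φ)) * cos (n * (π - φ)) =
      (-1) ^ n * (V (R * cos φ) * cos (n * φ)) := by
    intro φ
    rw [cos_pi_sub, mul_neg, hV.even, mul_sub, cos_sub, sin_nat_mul_pi, cos_nat_mul_pi]
    ring
  simp only [h2, sub_self, sub_zero, intervalIntegral.integral_const_mul] at h
  rw [chebCoeff_eq_integral_cos, mul_left_comm, h]

end IsAdmissible
end LogGas

namespace LogGas
open Real

/-! ### The measure `gasMeasure` in the angular variable -/

theorem image_mul_cos_Ioo {R : ℝ} (hR : 0 < R) : (fun φ => R * cos φ) '' Ioo 0 π = Ioo (-R) R := by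
  ext x
  constructor
  · rintro ⟨φ, hφ, rfl⟩
    have h1 : cos φ < 1 := by
      have := strictAntiOn_cos (left_mem_Icc.2 pi_pos.le) (Ioo_subset_Icc_self hφ) hφ.1
      rwa [cos_zero] at this
    have h2 : -1 < cos φ := by
      have := strictAntiOn_cos (Ioo_subset_Icc_self hφ) (right_mem_Icc.2 pi_pos.le) hφ.2
      rwa [cos_pi] at this
    constructor <;> dsimp only <;> nlinarith
  · intro hx
    have h1 : -1 < x / R := by rw [lt_div_iff₀ hR]; linarith [hx.1]
    have h2 : x / R < 1 := by rw [div_lt_iff₀ hR]; linarith [hx.2]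
    refine ⟨arccos (x / R), ⟨arccos_pos.2 h2, arccos_lt_pi.2 h1⟩, ?_⟩
    dsimp only
    rw [cos_arccos h1.le h2.le]
    field_simp

/-- In the angular variable dx/√(R² - x²) becomes dφ, so the edge singularities disappear and the
density is continuous. -/
theorem gasMeasure_eq_map (V : ℝ → ℝ) {R : ℝ} (hR : 0 < R) :
    gasMeasure V R = ((volume.restrict (Ioo 0 π)).withDensity
      (fun φ => ENNReal.ofReal (P V R (R * cos φ) / π))).map (fun φ => R * cos φ) := by
  have hmeas : Measurable fun φ => R * cos φ := by fun_prop
  ext s hs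
  rw [Measure.map_apply hmeas hs, gasMeasure, withDensity_apply _ hs,
    withDensity_apply _ (hmeas hs), ← lintegral_indicator hs, ← lintegral_indicator (hmeas hs),
    ← image_mul_cos_Ioo hR, lintegral_image_eq_lintegral_abs_deriv_mul measurableSet_Ioo
      (f := fun φ => R * cos φ) (f' := fun φ => R * -sin φ)
      (fun φ _ => ((hasDerivAt_cos φ).const_mul R).hasDerivWithinAt)
      (fun x hx y hy hxy => injOn_cos (Ioo_subset_Icc_self hx) (Ioo_subset_Icc_self hy)
        (mul_left_cancel₀ hR.ne' hxy))]
  refine setLIntegral_congr_fun measurableSet_Ioo fun φ hφ => ?_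
  have hsin : 0 < sin φ := sin_pos_of_pos_of_lt_pi hφ.1 hφ.2
  by_cases hφs : R * cos φ ∈ s
  · rw [indicator_of_mem hφs, indicator_of_mem (show φ ∈ (fun φ => R * cos φ) ⁻¹' s from hφs),
      ← ENNReal.ofReal_mul (abs_nonneg _)]
    congr 1
    have h1 : R ^ 2 - (R * cos φ) ^ 2 = (R * sin φ) ^ 2 := by
      rw [mul_pow, mul_pow, sin_sq]; ring
    rw [h1, sqrt_sq (by positivity), mul_neg, abs_neg, abs_of_pos (by positivity)]
    field_simp
  · rw [indicator_of_notMem hφs,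
      indicator_of_notMem (show φ ∉ (fun φ => R * cos φ) ⁻¹' s from hφs), mul_zero]

theorem gasMeasure_compl (V : ℝ → ℝ) (R : ℝ) : gasMeasure V R (Metric.closedBall 0 R)ᶜ = 0 := by
  rw [gasMeasure, withDensity_apply _ Metric.isClosed_closedBall.measurableSet.compl,
    Measure.restrict_restrict Metric.isClosed_closedBall.measurableSet.compl]
  have : (Metric.closedBall (0 : ℝ) R)ᶜ ∩ Ioo (-R) R = ∅ := by
    rw [Real.closedBall_eq_Icc]
    ext x
    simp only [zero_sub, zero_add, mem_inter_iff, mem_compl_iff, mem_Icc, mem_Ioo,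
      mem_empty_iff_false, iff_false]
    rintro ⟨h1, h2⟩
    exact h1 ⟨h2.1.le, h2.2.le⟩
  simp [this]

theorem P_mul_cos (V : ℝ → ℝ) {R : ℝ} (hR : R ≠ 0) (φ : ℝ) :
    P V R (R * cos φ) = 1 - ∑' n : ℕ, (n : ℝ) * chebCoeff V n R * cos (n * φ) := by
  rw [P, mul_div_cancel_left₀ _ hR]
  simp [Polynomial.Chebyshev.T_real_cos]

theorem abs_mul_cos_div_le (R φ : ℝ) : |R * cos φ / R| ≤ 1 := by
  rcases eq_or_ne R 0 with rfl | hR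
  · simp
  · rw [mul_div_cancel_left₀ _ hR]
    exact abs_cos_le_one φ

namespace IsAdmissible

variable {V : ℝ → ℝ} (hV : IsAdmissible V)

include hV

theorem continuous_P_mul_cos {R : ℝ} (hR : R ≠ 0) : Continuous fun φ => P V R (R * cos φ) := by
  simp only [P_mul_cos V hR]
  refine continuous_const.sub (continuous_tsum (fun n => by fun_prop)
    (hV.summable_abs_nat_mul_chebCoeff R) fun n φ => ?_)
  rw [norm_mul]
  exact mul_le_of_le_one_right (abs_nonneg _) (abs_cos_le_one _)

/-- Termwise integration of the absolutely convergent cosine series of 1 - P. Taking g = 1, cos(nφ)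
and V(R cos φ) gives the mass, the Chebyshev moments and the potential energy. -/
theorem hasSum_integral_mul_P {R : ℝ} (hR : R ≠ 0) {g : ℝ → ℝ} (hg : Continuous g) :
    HasSum (fun n : ℕ => (n : ℝ) * chebCoeff V n R * ∫ φ in (0 : ℝ)..π, g φ * cos (n * φ))
      ((∫ φ in (0 : ℝ)..π, g φ) - ∫ φ in (0 : ℝ)..π, g φ * P V R (R * cos φ)) := by
  have hP := hV.continuous_P_mul_cos hR
  obtain ⟨M, hM⟩ := isCompact_Icc.exists_bound_of_continuousOn (s := Icc 0 π) hg.continuousOn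
  have hs := hV.summable_abs_nat_mul_chebCoeff R
  have h := intervalIntegral.hasSum_integral_of_dominated_convergence (μ := volume) (a := 0)
    (b := π) (F := fun (n : ℕ) φ => (n : ℝ) * chebCoeff V n R * (g φ * cos (n * φ)))
    (f := fun φ => g φ - g φ * P V R (R * cos φ))
    (fun n _ => |(n : ℝ) * chebCoeff V n R| * M)
    (fun n => by apply Continuous.aestronglyMeasurable; fun_prop)
    (fun n => ae_of_all _ fun φ hφ => by
      rw [uIoc_of_le pi_pos.le] at hφ
      rw [norm_mul, Real.norm_eq_abs (_ * _), norm_mul (g φ)]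
      exact mul_le_mul_of_nonneg_left ((mul_le_of_le_one_right (norm_nonneg _)
        (abs_cos_le_one _)).trans (hM φ ⟨hφ.1.le, hφ.2⟩)) (abs_nonneg _))
    (ae_of_all _ fun φ _ => hs.mul_right M) (by simp)
    (ae_of_all _ fun φ _ => by
      have h1 := (hV.summable_nat_mul_chebCoeff_mul R (e := fun n => cos (n * φ))
        (fun n => abs_cos_le_one _)).hasSum.mul_left (g φ)
      rw [P_mul_cos V hR]
      convert! h1 using 1
      · ext n; ring
      · ring)
  rw [intervalIntegral.integral_sub (hg.intervalIntegrable _ _)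
    (Continuous.intervalIntegrable (by fun_prop) _ _)] at h
  simpa only [intervalIntegral.integral_const_mul] using h

theorem integral_P_mul_cos {R : ℝ} (hR : R ≠ 0) : ∫ φ in (0 : ℝ)..π, P V R (R * cos φ) = π := by
  have h := hV.hasSum_integral_mul_P hR (g := fun _ => 1) continuous_const
  simp only [one_mul, integral_cos_nat_mul] at h
  have h2 : ∀ n : ℕ, (n : ℝ) * chebCoeff V n R * (if n = 0 then π else 0) = 0 := by
    intro n
    split_ifs with h
    · simp [h]
    · simp
  simp only [h2] at h
  have := h.unique hasSum_zero
  simp at this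
  linarith

/-- The series has no constant mode, so the mass is 1; S ≤ 1 makes P nonnegative, so
`ENNReal.ofReal` truncates nothing. -/
theorem isProbabilityMeasure_gasMeasure {R : ℝ} (hR : 0 < R) (hS : virial V R ≤ 1) :
    IsProbabilityMeasure (gasMeasure V R) := by
  constructor
  rw [gasMeasure_eq_map V hR, Measure.map_apply (by fun_prop) MeasurableSet.univ, preimage_univ,
    withDensity_apply _ MeasurableSet.univ, Measure.restrict_univ, Measure.restrict_congr_set Ioo_ae_eq_Ioc,
    ← ofReal_integral_eq_lintegral_ofReal, ← intervalIntegral.integral_of_le pi_pos.le,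
    intervalIntegral.integral_div, hV.integral_P_mul_cos hR.ne', div_self pi_ne_zero,
    ENNReal.ofReal_one]
  · exact (((hV.continuous_P_mul_cos hR.ne').div_const π).integrableOn_Icc (a := 0) (b := π)).mono_set
      Ioc_subset_Icc_self
  · exact ae_of_all _ fun φ => div_nonneg (hV.P_nonneg hR hS (abs_mul_cos_div_le R φ)) pi_pos.le

theorem gasMeasure_mem_probOn {R : ℝ} (hR : 0 < R) (hS : virial V R ≤ 1) {L : ℝ} (hL : R ≤ L) :
    gasMeasure V R ∈ probOn (Metric.closedBall 0 L) :=
  ⟨hV.isProbabilityMeasure_gasMeasure hR hS, measure_mono_null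
    (compl_subset_compl.2 (Metric.closedBall_subset_closedBall hL)) (gasMeasure_compl V R)⟩

theorem integral_gasMeasure {R : ℝ} (hR : 0 < R) (hS : virial V R ≤ 1) {f : ℝ → ℝ}
    (hf : Continuous f) :
    ∫ x, f x ∂(gasMeasure V R) = π⁻¹ * ∫ φ in (0 : ℝ)..π, f (R * cos φ) * P V R (R * cos φ) := by
  have hP := hV.continuous_P_mul_cos hR.ne'
  rw [gasMeasure_eq_map V hR, integral_map (by fun_prop) hf.aestronglyMeasurable,
    integral_withDensity_eq_integral_toReal_smul
      (by apply Measurable.ennreal_ofReal; exact (hP.div_const π).measurable) (by simp),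
    Measure.restrict_congr_set Ioo_ae_eq_Ioc, ← intervalIntegral.integral_of_le pi_pos.le,
    ← intervalIntegral.integral_const_mul]
  congr 1
  ext φ
  rw [ENNReal.toReal_ofReal
    (div_nonneg (hV.P_nonneg hR hS (abs_mul_cos_div_le R φ)) pi_pos.le), smul_eq_mul]
  ring

theorem integral_T_gasMeasure {R : ℝ} (hR : 0 < R) (hS : virial V R ≤ 1) {n : ℕ} (hn : n ≠ 0) :
    ∫ x, (Polynomial.Chebyshev.T ℝ (n : ℤ)).eval (x / R) ∂(gasMeasure V R) =
      - (n * chebCoeff V n R / 2) := by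
  rw [hV.integral_gasMeasure hR hS (by fun_prop)]
  simp only [mul_div_cancel_left₀ _ hR.ne', Polynomial.Chebyshev.T_real_cos, Int.cast_natCast]
  have h := hV.hasSum_integral_mul_P hR.ne' (g := fun φ => cos (n * φ)) (by fun_prop)
  have h2 := hasSum_single (f := fun m : ℕ => (m : ℝ) * chebCoeff V m R *
    ∫ φ in (0 : ℝ)..π, cos (n * φ) * cos (m * φ)) n (fun m hm => by
      rw [integral_cos_mul_cos, if_neg hm.symm, mul_zero])
  have h3 := h.unique h2
  rw [integral_cos_mul_cos, integral_cos_nat_mul, if_neg hn, if_pos rfl, if_neg hn] at h3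
  have h4 : ∫ φ in (0 : ℝ)..π, cos (n * φ) * P V R (R * cos φ) =
    - (n * chebCoeff V n R * (π / 2)) := by linarith
  rw [h4]
  field_simp

/-- A Parseval identity: V and 1 - P have the cosine coefficients c_n and n c_n. -/
theorem hasSum_integral_gasMeasure {R : ℝ} (hR : 0 < R) (hS : virial V R ≤ 1) :
    HasSum (fun n : ℕ => n * chebCoeff V n R ^ 2)
      (2 * (chebCoeff V 0 R - ∫ x, V x ∂(gasMeasure V R))) := by
  have hc := hV.continuous
  rw [hV.integral_gasMeasure hR hS hV.continuous]
  have h := (hV.hasSum_integral_mul_P hR.ne' (g := fun φ => V (R * cos φ)) (by fun_prop)).mul_left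
    (2 * π⁻¹)
  convert! h using 1
  · ext n
    rcases eq_or_ne n 0 with rfl | hn
    · simp
    · rw [mul_left_comm, ← chebCoeff_of_ne_zero V hn]
      ring
  · rw [chebCoeff_zero]
    ring

/-- P is strictly positive in the open interval even if S = 1, where it vanishes only at the edges.
-/
theorem support_gasMeasure {R : ℝ} (hR : 0 < R) (hS : virial V R ≤ 1) :
    (gasMeasure V R).support = Icc (-R) R := by
  apply Subset.antisymm
  · refine Measure.support_subset_of_isClosed isClosed_Icc ?_
    rw [mem_ae_iff]
    have := gasMeasure_compl V R
    rwa [Real.closedBall_eq_Icc, zero_sub, zero_add] at this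
  · rw [← closure_Ioo (by linarith : -R ≠ R)]
    refine closure_minimal (fun x hx => ?_) Measure.isClosed_support
    rw [Measure.mem_support_iff_forall]
    intro U hU
    obtain ⟨U', hU'U, hU'o, hxU'⟩ := mem_nhds_iff.1 hU
    refine lt_of_lt_of_le ?_ (measure_mono hU'U)
    have hcont : Continuous fun φ => R * cos φ := by fun_prop
    have hP := hV.continuous_P_mul_cos hR.ne'
    have hopen : IsOpen ((fun φ => R * cos φ) ⁻¹' U' ∩ Ioo 0 π) :=
      (hU'o.preimage hcont).inter isOpen_Ioo
    rw [gasMeasure_eq_map V hR, Measure.map_apply hcont.measurable hU'o.measurableSet,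
      withDensity_apply _ (hcont.measurable hU'o.measurableSet),
      Measure.restrict_restrict (hcont.measurable hU'o.measurableSet), pos_iff_ne_zero, Ne,
      setLIntegral_eq_zero_iff hopen.measurableSet
        (by apply Measurable.ennreal_ofReal; exact (hP.div_const π).measurable)]
    intro h0
    rw [← image_mul_cos_Ioo hR] at hx
    obtain ⟨φ₀, hφ₀, rfl⟩ := hx
    have hvol := hopen.measure_pos volume ⟨φ₀, hxU', hφ₀⟩
    refine hvol.ne' (measure_mono_null (fun φ hφ => ?_) (ae_iff.1 h0))
    simp only [mem_ofPred_eq, not_forall]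
    refine ⟨hφ, (ENNReal.ofReal_pos.2 (div_pos (hV.P_pos hR hS ?_) pi_pos)).ne'⟩
    have h1 : R * cos φ ∈ Ioo (-R) R := by
      rw [← image_mul_cos_Ioo hR]
      exact ⟨φ, hφ.2, rfl⟩
    rw [abs_div, abs_of_pos hR, div_lt_one hR, abs_lt]
    exact h1

end IsAdmissible
end LogGas

namespace LogGas
open Real

/-! ### The logarithmic kernel and its regularisation -/

theorem one_sub_two_mul_cos_add_sq_pos {r : ℝ} (hr : |r| < 1) (α : ℝ) :
    0 < 1 - 2 * r * cos α + r ^ 2 := by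
  have h1 : r * cos α ≤ |r| := by
    calc r * cos α ≤ |r * cos α| := le_abs_self _
      _ = |r| * |cos α| := abs_mul _ _
      _ ≤ |r| := mul_le_of_le_one_right (abs_nonneg _) (abs_cos_le_one _)
  have h2 : r ^ 2 = |r| ^ 2 := (sq_abs r).symm
  nlinarith

/-- Real part of the Taylor series of -log(1 - z) at z = r exp(iα). -/
theorem hasSum_pow_div_mul_cos {r : ℝ} (hr : |r| < 1) (α : ℝ) :
    HasSum (fun n : ℕ => r ^ n / n * cos (n * α)) (-(log (1 - 2 * r * cos α + r ^ 2) / 2)) := by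
  have hz : ‖(r : ℂ) * Complex.exp (α * Complex.I)‖ < 1 := by
    rw [norm_mul, Complex.norm_exp_ofReal_mul_I, mul_one, Complex.norm_real]
    exact hr
  have h := Complex.hasSum_re (Complex.hasSum_taylorSeries_neg_log hz)
  convert! h using 1
  · ext n
    have : ((r : ℂ) * Complex.exp (α * Complex.I)) ^ n / n =
        ((r ^ n / n : ℝ) : ℂ) * Complex.exp ((n * α : ℝ) * Complex.I) := by
      rw [mul_pow, ← Complex.exp_nat_mul]
      push_cast
      ring_nf
    rw [this, Complex.re_ofReal_mul, Complex.exp_ofReal_mul_I_re]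
  · rw [Complex.neg_re, Complex.log_re]
    have h2 : 1 - 2 * r * cos α + r ^ 2 = ‖1 - (r : ℂ) * Complex.exp (α * Complex.I)‖ ^ 2 := by
      rw [← Complex.normSq_eq_norm_sq, Complex.normSq_apply]
      simp only [Complex.sub_re, Complex.one_re, Complex.re_ofReal_mul, Complex.exp_ofReal_mul_I_re,
        Complex.sub_im, Complex.one_im, Complex.im_ofReal_mul, Complex.exp_ofReal_mul_I_im]
      have := sin_sq_add_cos_sq α
      linear_combination (-(r ^ 2)) * this
    rw [h2, log_pow]
    push_cast
    ring

/-- The Chebyshev polynomial of degree `n` on `[-1, 1]`, extended continuously by constants. -/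
noncomputable def chebCos (n : ℕ) (u : ℝ) : ℝ := cos (n * arccos u)

theorem continuous_chebCos (n : ℕ) : Continuous (chebCos n) :=
  continuous_cos.comp (continuous_const.mul continuous_arccos)

theorem abs_chebCos_le_one (n : ℕ) (u : ℝ) : |chebCos n u| ≤ 1 := abs_cos_le_one _

theorem chebCos_eq_T (n : ℕ) {u : ℝ} (hu : |u| ≤ 1) :
    chebCos n u = (Polynomial.Chebyshev.T ℝ (n : ℤ)).eval u := by
  obtain ⟨h1, h2⟩ := abs_le.1 hu
  conv_rhs => rw [← cos_arccos h1 h2]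
  rw [Polynomial.Chebyshev.T_real_cos, Int.cast_natCast, chebCos]

/-- The regularised logarithmic kernel `∑ (2 / n) q ^ n T_n(u) T_n(v)`. -/
noncomputable def regKernel (q u v : ℝ) : ℝ :=
  ∑' n : ℕ, 2 / n * q ^ n * chebCos n u * chebCos n v

theorem abs_regKernel_term_le {q : ℝ} (hq : 0 ≤ q) (n : ℕ) (u v : ℝ) :
    |2 / n * q ^ n * chebCos n u * chebCos n v| ≤ 2 * q ^ n := by
  rw [abs_mul, abs_mul, abs_mul, abs_of_nonneg (show (0 : ℝ) ≤ 2 / n by positivity),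
    abs_of_nonneg (show 0 ≤ q ^ n by positivity)]
  have h : (2 : ℝ) / n ≤ 2 := by
    rcases Nat.eq_zero_or_pos n with rfl | h
    · simp
    · exact div_le_self (by norm_num) (by exact_mod_cast h)
  calc _ ≤ 2 * q ^ n * 1 * 1 := by
        gcongr
        · exact abs_chebCos_le_one _ _
        · exact abs_chebCos_le_one _ _
    _ = _ := by ring

theorem summable_two_mul_pow {q : ℝ} (hq : 0 ≤ q) (hq1 : q < 1) :
    Summable fun n : ℕ => 2 * q ^ n :=
  (summable_geometric_of_lt_one hq hq1).mul_left 2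

theorem hasSum_regKernel {q : ℝ} (hq : 0 ≤ q) (hq1 : q < 1) (u v : ℝ) :
    HasSum (fun n : ℕ => 2 / n * q ^ n * chebCos n u * chebCos n v) (regKernel q u v) :=
  (Summable.of_norm_bounded (summable_two_mul_pow hq hq1)
    fun n => abs_regKernel_term_le hq n u v).hasSum

theorem continuous_regKernel {q : ℝ} (hq : 0 ≤ q) (hq1 : q < 1) :
    Continuous fun p : ℝ × ℝ => regKernel q p.1 p.2 :=
  continuous_tsum (fun n => (continuous_const.mul ((continuous_chebCos n).comp continuous_fst)).mul
    ((continuous_chebCos n).comp continuous_snd)) (summable_two_mul_pow hq hq1)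
    fun n p => abs_regKernel_term_le hq n p.1 p.2

theorem abs_regKernel_le {q : ℝ} (hq : 0 ≤ q) (hq1 : q < 1) (u v : ℝ) :
    |regKernel q u v| ≤ ∑' n : ℕ, 2 * q ^ n :=
  tsum_of_norm_bounded (f := fun n : ℕ => 2 / n * q ^ n * chebCos n u * chebCos n v)
    (summable_two_mul_pow hq hq1).hasSum fun n => abs_regKernel_term_le hq n u v

/-- From 2 cos(nθ) cos(nφ) = cos(n(θ + φ)) + cos(n(θ - φ)), two Poisson-type logarithms. -/
theorem regKernel_eq {q : ℝ} (hq : 0 ≤ q) (hq1 : q < 1) (u v : ℝ) :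
    regKernel q u v = -(log (1 - 2 * q * cos (arccos u + arccos v) + q ^ 2) / 2) +
      -(log (1 - 2 * q * cos (arccos u - arccos v) + q ^ 2) / 2) := by
  have hq' : |q| < 1 := by rwa [abs_of_nonneg hq]
  refine (hasSum_regKernel hq hq1 u v).unique ?_
  convert! (hasSum_pow_div_mul_cos hq' (arccos u + arccos v)).add
    (hasSum_pow_div_mul_cos hq' (arccos u - arccos v)) using 1
  ext n
  rw [mul_add, mul_sub, cos_add, cos_sub, chebCos, chebCos]
  ring

/-- The arguments of the two logarithms at q = 1 multiply to this square, which identifies the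
limiting kernel as -log(2|u - v|). -/
theorem two_mul_one_sub_cos_mul (θ φ : ℝ) :
    (2 * (1 - cos (θ + φ))) * (2 * (1 - cos (θ - φ))) = (2 * |cos θ - cos φ|) ^ 2 := by
  rw [mul_pow, sq_abs, cos_add, cos_sub]
  have h1 := sin_sq_add_cos_sq θ
  have h2 := sin_sq_add_cos_sq φ
  have h1' : sin θ ^ 2 = 1 - cos θ ^ 2 := by linarith
  have h2' : sin φ ^ 2 = 1 - cos φ ^ 2 := by linarith
  linear_combination (-4 * sin φ ^ 2) * h1' + (-4 * (1 - cos θ ^ 2)) * h2'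

theorem log_one_sub_le {q : ℝ} (hq : 0 ≤ q) (hq1 : q < 1) (α : ℝ) :
    log (1 - 2 * q * cos α + q ^ 2) ≤ 2 * log 2 := by
  have : 2 * log 2 = log (2 ^ 2) := by rw [log_pow]; norm_num
  rw [this]
  have hq' : |q| < 1 := by rwa [abs_of_nonneg hq]
  refine log_le_log (one_sub_two_mul_cos_add_sq_pos hq' α) ?_
  nlinarith [neg_one_le_cos α]

/-- Each logarithm has argument at most (1 + q)² ≤ 4. The shift by log 4 gives the nonnegativity
needed for Fatou, uniformly in q. -/
theorem neg_log_four_le_regKernel {q : ℝ} (hq : 0 ≤ q) (hq1 : q < 1) (u v : ℝ) :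
    0 ≤ log 4 + regKernel q u v := by
  have : log 4 = 2 * log 2 := by
    rw [show (4 : ℝ) = 2 ^ 2 by norm_num, log_pow]; norm_num
  rw [regKernel_eq hq hq1, this]
  linarith [log_one_sub_le hq hq1 (arccos u + arccos v),
    log_one_sub_le hq hq1 (arccos u - arccos v)]

/-- Since (1 - q)² ≥ 0, each argument 1 - 2q cos α + q² is at least q times its value at q = 1. The
price log q vanishes as q → 1. -/
theorem regKernel_le {q : ℝ} (hq : 0 < q) (hq1 : q < 1) {u v : ℝ} (hu : |u| ≤ 1) (hv : |v| ≤ 1)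
    (huv : u ≠ v) : regKernel q u v ≤ -log (2 * |u - v|) - log q := by
  obtain ⟨hu1, hu2⟩ := abs_le.1 hu
  obtain ⟨hv1, hv2⟩ := abs_le.1 hv
  have h := two_mul_one_sub_cos_mul (arccos u) (arccos v)
  rw [cos_arccos hu1 hu2, cos_arccos hv1 hv2] at h
  have hpos : 0 < 2 * |u - v| := by
    have := abs_pos.2 (sub_ne_zero.2 huv)
    positivity
  have hq' : |q| < 1 := by rwa [abs_of_pos hq]
  have a1 := one_sub_two_mul_cos_add_sq_pos hq' (arccos u + arccos v)
  have a2 := one_sub_two_mul_cos_add_sq_pos hq' (arccos u - arccos v)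
  have b : ∀ α : ℝ, q * (2 * (1 - cos α)) ≤ 1 - 2 * q * cos α + q ^ 2 := fun α => by
    nlinarith [sq_nonneg (1 - q)]
  have b0 : ∀ α : ℝ, 0 ≤ q * (2 * (1 - cos α)) := fun α =>
    mul_nonneg hq.le (by linarith [cos_le_one α])
  have h2 : (q * (2 * |u - v|)) ^ 2 ≤ (1 - 2 * q * cos (arccos u + arccos v) + q ^ 2) *
      (1 - 2 * q * cos (arccos u - arccos v) + q ^ 2) := by
    rw [mul_pow, ← h]
    calc _ = (q * (2 * (1 - cos (arccos u + arccos v)))) *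
          (q * (2 * (1 - cos (arccos u - arccos v)))) := by ring
      _ ≤ _ := mul_le_mul (b _) (b _) (b0 _) a1.le
  have h3 := log_le_log (by positivity) h2
  rw [log_mul a1.ne' a2.ne', log_pow, log_mul hq.ne' hpos.ne'] at h3
  rw [regKernel_eq hq.le hq1]
  push_cast at h3
  linarith

/-- The shifted logarithmic kernel `c - log |x - y|`, truncated below at `0`. -/
noncomputable def logKernel (c x y : ℝ) : ℝ≥0∞ :=
  open Classical in if x = y then ⊤ else ENNReal.ofReal (c - log |x - y|)

theorem measurable_logKernel (c : ℝ) : Measurable fun p : ℝ × ℝ => logKernel c p.1 p.2 := by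
  unfold logKernel
  refine Measurable.ite (measurableSet_eq_fun measurable_fst measurable_snd) measurable_const ?_
  exact ((measurable_log.comp (measurable_fst.sub measurable_snd).abs).const_sub c).ennreal_ofReal

/-- The shift log(2L) is the log of the diameter: after rescaling to [-1, 1] it becomes the shift
log 4 of the regularised kernel. -/
theorem logKernel_log_two_mul {L : ℝ} (hL : 0 < L) {x y : ℝ} (hxy : x ≠ y) :
    logKernel (log (2 * L)) x y = ENNReal.ofReal (log 4 + -log (2 * |x / L - y / L|)) := by
  rw [logKernel, if_neg hxy]
  congr 1
  have h : 0 < |x - y| := abs_pos.2 (sub_ne_zero.2 hxy)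
  rw [← sub_div, abs_div, abs_of_pos hL, log_mul two_ne_zero hL.ne',
    log_mul two_ne_zero (by positivity), log_div h.ne' hL.ne',
    show (4 : ℝ) = 2 * 2 by norm_num, log_mul two_ne_zero two_ne_zero]
  ring

theorem abs_div_le_one_of_mem {L x : ℝ} (hL : 0 < L) (hx : x ∈ Metric.closedBall 0 L) :
    |x / L| ≤ 1 := by
  rw [abs_div, abs_of_pos hL, div_le_one hL]
  simpa using hx

theorem ofReal_regKernel_le_logKernel {q : ℝ} (hq : 0 < q) (hq1 : q < 1) {L x y : ℝ} (hL : 0 < L)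
    (hx : x ∈ Metric.closedBall 0 L) (hy : y ∈ Metric.closedBall 0 L) :
    ENNReal.ofReal (log 4 + regKernel q (x / L) (y / L) + log q) ≤
      logKernel (log (2 * L)) x y := by
  by_cases hxy : x = y
  · simp [logKernel, hxy]
  · rw [logKernel_log_two_mul hL hxy]
    apply ENNReal.ofReal_le_ofReal
    have := regKernel_le hq hq1 (abs_div_le_one_of_mem hL hx) (abs_div_le_one_of_mem hL hy)
      (fun h => hxy ((div_left_inj' hL.ne').1 h))
    linarith

/-- A sequence in `(0, 1)` converging to `1`. -/
noncomputable def abelSeq (j : ℕ) : ℝ := 1 - 1 / ((j : ℝ) + 2)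

theorem abelSeq_pos (j : ℕ) : 0 < abelSeq j := by
  have : 1 / ((j : ℝ) + 2) < 1 := by
    rw [div_lt_one (by positivity)]
    linarith [Nat.cast_nonneg (α := ℝ) j]
  unfold abelSeq
  linarith

theorem abelSeq_lt_one (j : ℕ) : abelSeq j < 1 := by
  have : 0 < 1 / ((j : ℝ) + 2) := by positivity
  unfold abelSeq
  linarith

theorem tendsto_abelSeq : Tendsto abelSeq atTop (𝓝 1) := by
  have h : Tendsto (fun j : ℕ => 1 / ((j : ℝ) + 2)) atTop (𝓝 0) :=
    tendsto_const_nhds.div_atTop (tendsto_atTop_add_const_right _ _ tendsto_natCast_atTop_atTop)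
  have h2 := h.const_sub 1
  rwa [sub_zero] at h2

theorem tendsto_log_abelSeq : Tendsto (fun j => log (abelSeq j)) atTop (𝓝 0) := by
  simpa using tendsto_abelSeq.log one_ne_zero

theorem tendsto_regKernel_of_ne {u v : ℝ} (hu : |u| ≤ 1) (hv : |v| ≤ 1) (huv : u ≠ v) :
    Tendsto (fun j => regKernel (abelSeq j) u v) atTop (𝓝 (-log (2 * |u - v|))) := by
  obtain ⟨hu1, hu2⟩ := abs_le.1 hu
  obtain ⟨hv1, hv2⟩ := abs_le.1 hv
  have h := two_mul_one_sub_cos_mul (arccos u) (arccos v)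
  rw [cos_arccos hu1 hu2, cos_arccos hv1 hv2] at h
  have hpos : 0 < 2 * |u - v| := by
    have := abs_pos.2 (sub_ne_zero.2 huv)
    positivity
  have hne : (2 * |u - v|) ^ 2 ≠ 0 := by positivity
  rw [← h] at hne
  have n1 := left_ne_zero_of_mul hne
  have n2 := right_ne_zero_of_mul hne
  have t : ∀ α : ℝ, Tendsto (fun j => 1 - 2 * abelSeq j * cos α + abelSeq j ^ 2) atTop
      (𝓝 (2 * (1 - cos α))) := by
    intro α
    have h1 : Continuous fun q : ℝ => 1 - 2 * q * cos α + q ^ 2 := by fun_prop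
    convert! (h1.tendsto 1).comp tendsto_abelSeq using 2
    ring
  have h2 := (((t (arccos u + arccos v)).log n1).div_const 2).neg.add
    (((t (arccos u - arccos v)).log n2).div_const 2).neg
  simp only [← regKernel_eq (abelSeq_pos _).le (abelSeq_lt_one _)] at h2
  convert! h2 using 2
  have h3 := congrArg log h
  rw [log_mul n1 n2, log_pow] at h3
  push_cast at h3
  linarith

/-- On the diagonal one logarithm is log (1 - q)², whose divergence matches the value `⊤` of
`logKernel`. -/
theorem tendsto_regKernel_self (u : ℝ) :
    Tendsto (fun j => regKernel (abelSeq j) u u) atTop atTop := by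
  have h1 : Tendsto (fun j => log (1 - abelSeq j)) atTop atBot := by
    refine tendsto_log_nhdsGT_zero.comp (tendsto_nhdsWithin_iff.2 ⟨?_, ?_⟩)
    · simpa using tendsto_abelSeq.const_sub 1
    · exact Eventually.of_forall fun j => sub_pos.2 (abelSeq_lt_one j)
  have h2 := tendsto_atTop_add_const_left _ (-log 2) (tendsto_neg_atBot_atTop.comp h1)
  refine tendsto_atTop_mono (fun j => ?_) h2
  have hq := abelSeq_pos j
  have hq1 := abelSeq_lt_one j
  rw [regKernel_eq hq.le hq1, sub_self, cos_zero]
  have h3 : 1 - 2 * abelSeq j * 1 + abelSeq j ^ 2 = (1 - abelSeq j) ^ 2 := by ring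
  rw [h3, log_pow]
  have := log_one_sub_le hq.le hq1 (arccos u + arccos u)
  simp only [Function.comp_apply]
  push_cast
  linarith

theorem tendsto_ofReal_regKernel {L x y : ℝ} (hL : 0 < L)
    (hx : x ∈ Metric.closedBall 0 L) (hy : y ∈ Metric.closedBall 0 L) :
    Tendsto (fun j => ENNReal.ofReal (log 4 + regKernel (abelSeq j) (x / L) (y / L))) atTop
      (𝓝 (logKernel (log (2 * L)) x y)) := by
  by_cases hxy : x = y
  · subst hxy
    rw [logKernel, if_pos rfl]
    exact ENNReal.tendsto_ofReal_atTop.comp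
      (tendsto_atTop_add_const_left _ _ (tendsto_regKernel_self _))
  · rw [logKernel_log_two_mul hL hxy]
    exact ENNReal.tendsto_ofReal ((tendsto_regKernel_of_ne (abs_div_le_one_of_mem hL hx)
      (abs_div_le_one_of_mem hL hy)
      (fun h => hxy ((div_left_inj' hL.ne').1 h))).const_add (log 4))

/-- No integrability is required, because the Bochner integral of a nonintegrable function is 0. -/
theorem ofReal_integral_le_lintegral {α : Type*} [MeasurableSpace α] {ν : Measure α} {f : α → ℝ} :
    ENNReal.ofReal (∫ a, f a ∂ν) ≤ ∫⁻ a, ENNReal.ofReal (f a) ∂ν := by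
  by_cases hf : Integrable f ν
  · apply ENNReal.ofReal_le_of_le_toReal
    rw [integral_eq_lintegral_pos_part_sub_lintegral_neg_part hf]
    exact sub_le_self _ ENNReal.toReal_nonneg
  · simp [integral_undef hf]

/-! ### Energies in terms of Chebyshev moments -/

/-- The mutual energy of two measures for the shifted logarithmic kernel. -/
noncomputable def logEnergy (c : ℝ) (ρ μ : Measure ℝ) : ℝ≥0∞ :=
  ∫⁻ p, logKernel c p.1 p.2 ∂(ρ.prod μ)

/-- The Chebyshev moments of a measure on `[-L, L]`. -/
noncomputable def chebMoment (L : ℝ) (ρ : Measure ℝ) (n : ℕ) : ℝ := ∫ x, chebCos n (x / L) ∂ρ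

theorem integrable_regKernel {q : ℝ} (hq : 0 ≤ q) (hq1 : q < 1) (L : ℝ) {α : Type*}
    [MeasurableSpace α] (ν : Measure α) [IsFiniteMeasure ν] {f g : α → ℝ} (hf : Measurable f)
    (hg : Measurable g) : Integrable (fun a => regKernel q (f a / L) (g a / L)) ν :=
  Integrable.of_bound ((continuous_regKernel hq hq1).measurable.comp
    ((hf.div_const L).prodMk (hg.div_const L))).aestronglyMeasurable _
    (ae_of_all _ fun _ => abs_regKernel_le hq hq1 _ _)

theorem hasSum_integral_regKernel_prod {q : ℝ} (hq : 0 ≤ q) (hq1 : q < 1) (L : ℝ) (ρ μ : Measure ℝ)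
    [IsProbabilityMeasure ρ] [IsProbabilityMeasure μ] :
    HasSum (fun n : ℕ => 2 / n * q ^ n * chebMoment L ρ n * chebMoment L μ n)
      (∫ p : ℝ × ℝ, regKernel q (p.1 / L) (p.2 / L) ∂(ρ.prod μ)) := by
  have h := hasSum_integral_of_dominated_convergence (μ := ρ.prod μ)
    (F := fun (n : ℕ) (p : ℝ × ℝ) => 2 / n * q ^ n * chebCos n (p.1 / L) * chebCos n (p.2 / L))
    (f := fun p : ℝ × ℝ => regKernel q (p.1 / L) (p.2 / L)) (fun n _ => 2 * q ^ n)
    (fun n => by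
      have := continuous_chebCos n
      apply Continuous.aestronglyMeasurable
      fun_prop)
    (fun n => ae_of_all _ fun p => abs_regKernel_term_le hq n _ _)
    (ae_of_all _ fun _ => summable_two_mul_pow hq hq1) (integrable_const _)
    (ae_of_all _ fun p => hasSum_regKernel hq hq1 _ _)
  convert! h using 1
  ext n
  have h2 := integral_prod_mul (μ := ρ) (ν := μ) (fun x => 2 / n * q ^ n * chebCos n (x / L))
    (fun y => chebCos n (y / L))
  rw [h2, integral_const_mul]
  rfl

theorem hasSum_integral_regKernel {q : ℝ} (hq : 0 ≤ q) (hq1 : q < 1) (L u : ℝ) (μ : Measure ℝ)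
    [IsProbabilityMeasure μ] :
    HasSum (fun n : ℕ => 2 / n * q ^ n * chebCos n u * chebMoment L μ n)
      (∫ y, regKernel q u (y / L) ∂μ) := by
  have h := hasSum_integral_of_dominated_convergence (μ := μ)
    (F := fun (n : ℕ) (y : ℝ) => 2 / n * q ^ n * chebCos n u * chebCos n (y / L))
    (f := fun y : ℝ => regKernel q u (y / L)) (fun n _ => 2 * q ^ n)
    (fun n => by
      have := continuous_chebCos n
      apply Continuous.aestronglyMeasurable
      fun_prop)
    (fun n => ae_of_all _ fun p => abs_regKernel_term_le hq n _ _)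
    (ae_of_all _ fun _ => summable_two_mul_pow hq hq1) (integrable_const _)
    (ae_of_all _ fun p => hasSum_regKernel hq hq1 _ _)
  convert! h using 1
  ext n
  rw [integral_const_mul]
  rfl

/-- The energy of the regularised kernel. -/
noncomputable def regEnergy (q L : ℝ) (ρ μ : Measure ℝ) : ℝ :=
  log 4 + ∫ p : ℝ × ℝ, regKernel q (p.1 / L) (p.2 / L) ∂(ρ.prod μ)

section

variable {L : ℝ} (hL : 0 < L) {ρ μ : Measure ℝ}

theorem lintegral_regKernel {q : ℝ} (hq : 0 ≤ q) (hq1 : q < 1) (L : ℝ) (ρ μ : Measure ℝ)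
    [IsProbabilityMeasure ρ] [IsProbabilityMeasure μ] :
    ∫⁻ p : ℝ × ℝ, ENNReal.ofReal (log 4 + regKernel q (p.1 / L) (p.2 / L)) ∂(ρ.prod μ) =
      ENNReal.ofReal (regEnergy q L ρ μ) := by
  have hi := integrable_regKernel hq hq1 L (ρ.prod μ) measurable_fst measurable_snd
  have hi2 : Integrable (fun p : ℝ × ℝ => log 4 + regKernel q (p.1 / L) (p.2 / L)) (ρ.prod μ) :=
    (integrable_const _).add hi
  rw [← ofReal_integral_eq_lintegral_ofReal hi2
    (ae_of_all _ fun p => neg_log_four_le_regKernel hq hq1 _ _),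
    integral_add (integrable_const _) hi]
  simp [regEnergy]

theorem ae_mem_of_mem_probOn {B : Set ℝ} {ρ : Measure ℝ} (hρ : ρ ∈ probOn B) : ∀ᵐ x ∂ρ, x ∈ B :=
  ae_iff.2 hρ.2

theorem ae_prod_mem_of_mem_probOn {B : Set ℝ} {ρ μ : Measure ℝ} (hρ : ρ ∈ probOn B)
    (hμ : μ ∈ probOn B) : ∀ᵐ p ∂(ρ.prod μ), p.1 ∈ B ∧ p.2 ∈ B := by
  have := hρ.1
  have := hμ.1
  filter_upwards [Measure.quasiMeasurePreserving_fst.ae (ae_mem_of_mem_probOn hρ),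
    Measure.quasiMeasurePreserving_snd.ae (ae_mem_of_mem_probOn hμ)] with p h1 h2
  exact ⟨h1, h2⟩

include hL

/-- Fatou's lemma for the shifted, hence nonnegative, regularised kernels. -/
theorem logEnergy_le_liminf (hρ : ρ ∈ probOn (Metric.closedBall 0 L))
    (hμ : μ ∈ probOn (Metric.closedBall 0 L)) :
    logEnergy (log (2 * L)) ρ μ ≤
      liminf (fun j => ENNReal.ofReal (regEnergy (abelSeq j) L ρ μ)) atTop := by
  have := hρ.1
  have := hμ.1
  simp only [← lintegral_regKernel (abelSeq_pos _).le (abelSeq_lt_one _)]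
  refine le_trans (lintegral_mono_ae ?_) (lintegral_liminf_le fun j => ?_)
  · filter_upwards [ae_prod_mem_of_mem_probOn hρ hμ] with p hp
    exact (tendsto_ofReal_regKernel hL hp.1 hp.2).liminf_eq.ge
  · have := continuous_regKernel (abelSeq_pos j).le (abelSeq_lt_one j)
    refine ((this.measurable.comp (f := fun p : ℝ × ℝ => (p.1 / L, p.2 / L)) ?_).const_add
      _).ennreal_ofReal
    fun_prop

/-- Companion to the Fatou bound, from the pointwise kernel inequality. Together they pass
inequalities to q = 1 even when energies are infinite. -/
theorem ofReal_regEnergy_le (hρ : ρ ∈ probOn (Metric.closedBall 0 L))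
    (hμ : μ ∈ probOn (Metric.closedBall 0 L)) {q : ℝ} (hq : 0 < q) (hq1 : q < 1) :
    ENNReal.ofReal (regEnergy q L ρ μ) ≤
      logEnergy (log (2 * L)) ρ μ + ENNReal.ofReal (-log q) := by
  have := hρ.1
  have := hμ.1
  have e : logEnergy (log (2 * L)) ρ μ + ENNReal.ofReal (-log q) =
      ∫⁻ p, logKernel (log (2 * L)) p.1 p.2 + ENNReal.ofReal (-log q) ∂(ρ.prod μ) := by
    rw [lintegral_add_right _ measurable_const, lintegral_const, measure_univ, mul_one, logEnergy]
  rw [← lintegral_regKernel hq.le hq1, e]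
  refine lintegral_mono_ae ?_
  filter_upwards [ae_prod_mem_of_mem_probOn hρ hμ] with p hp
  have h := ofReal_regKernel_le_logKernel hq hq1 hL hp.1 hp.2
  calc ENNReal.ofReal (log 4 + regKernel q (p.1 / L) (p.2 / L))
      = ENNReal.ofReal ((log 4 + regKernel q (p.1 / L) (p.2 / L) + log q) + -log q) := by ring_nf
    _ ≤ _ := ENNReal.ofReal_add_le
    _ ≤ _ := add_le_add_left h _

/-- Positive definiteness of the logarithmic kernel on neutral signed measures. -/
theorem two_mul_logEnergy_le (hρ : ρ ∈ probOn (Metric.closedBall 0 L))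
    (hμ : μ ∈ probOn (Metric.closedBall 0 L)) :
    2 * logEnergy (log (2 * L)) ρ μ ≤
      logEnergy (log (2 * L)) ρ ρ + logEnergy (log (2 * L)) μ μ := by
  have := hρ.1
  have := hμ.1
  have h1 : ∀ j, ENNReal.ofReal (regEnergy (abelSeq j) L ρ μ) ≤
      2⁻¹ * (logEnergy (log (2 * L)) ρ ρ + logEnergy (log (2 * L)) μ μ) +
        ENNReal.ofReal (-log (abelSeq j)) := by
    intro j
    set q := abelSeq j
    have hq : 0 < q := abelSeq_pos j
    have hq1 : q < 1 := abelSeq_lt_one j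
    have a := hasSum_integral_regKernel_prod hq.le hq1 L ρ ρ
    have b := hasSum_integral_regKernel_prod hq.le hq1 L μ μ
    have c := hasSum_integral_regKernel_prod hq.le hq1 L ρ μ
    -- Termwise (2/n) qⁿ (a_n - b_n)² ≥ 0 for the moments; the constants log 4 balance because both
    -- masses are 1.
    have d : 2 * regEnergy q L ρ μ ≤ regEnergy q L ρ ρ + regEnergy q L μ μ := by
      have := hasSum_le (fun n => ?_) (c.mul_left 2) (a.add b)
      · unfold regEnergy; linarith
      · have : 0 ≤ 2 / n * q ^ n * (chebMoment L ρ n - chebMoment L μ n) ^ 2 := by positivity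
        nlinarith
    have n1 : ∀ ρ μ : Measure ℝ, IsProbabilityMeasure ρ → IsProbabilityMeasure μ →
        0 ≤ regEnergy q L ρ μ := by
      intro ρ μ h1 h2
      have hi := integrable_regKernel hq.le hq1 L (ρ.prod μ) measurable_fst measurable_snd
      have : regEnergy q L ρ μ =
          ∫ p : ℝ × ℝ, (log 4 + regKernel q (p.1 / L) (p.2 / L)) ∂(ρ.prod μ) := by
        rw [integral_add (integrable_const _) hi]; simp [regEnergy]
      rw [this]
      exact integral_nonneg fun p => neg_log_four_le_regKernel hq.le hq1 _ _
    calc ENNReal.ofReal (regEnergy q L ρ μ)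
        ≤ ENNReal.ofReal (2⁻¹ * (regEnergy q L ρ ρ + regEnergy q L μ μ)) :=
          ENNReal.ofReal_le_ofReal (by linarith)
      _ = 2⁻¹ * (ENNReal.ofReal (regEnergy q L ρ ρ) + ENNReal.ofReal (regEnergy q L μ μ)) := by
          rw [ENNReal.ofReal_mul (by norm_num), ENNReal.ofReal_add (n1 _ _ ‹_› ‹_›)
            (n1 _ _ ‹_› ‹_›), ENNReal.ofReal_inv_of_pos two_pos]
          norm_num
      _ ≤ 2⁻¹ * ((logEnergy (log (2 * L)) ρ ρ + ENNReal.ofReal (-log q)) +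
          (logEnergy (log (2 * L)) μ μ + ENNReal.ofReal (-log q))) := by
          gcongr
          · exact ofReal_regEnergy_le hL hρ hρ hq hq1
          · exact ofReal_regEnergy_le hL hμ hμ hq hq1
      _ = _ := by
          rw [add_add_add_comm, mul_add, ← two_mul (ENNReal.ofReal _), ← mul_assoc,
            ENNReal.inv_mul_cancel two_ne_zero ENNReal.ofNat_ne_top, one_mul]
  have h2 : Tendsto (fun j => 2⁻¹ * (logEnergy (log (2 * L)) ρ ρ + logEnergy (log (2 * L)) μ μ) +
        ENNReal.ofReal (-log (abelSeq j))) atTop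
      (𝓝 (2⁻¹ * (logEnergy (log (2 * L)) ρ ρ + logEnergy (log (2 * L)) μ μ))) := by
    have : Tendsto (fun j => ENNReal.ofReal (-log (abelSeq j))) atTop (𝓝 0) := by
      simpa using ENNReal.tendsto_ofReal tendsto_log_abelSeq.neg
    simpa using this.const_add
      (2⁻¹ * (logEnergy (log (2 * L)) ρ ρ + logEnergy (log (2 * L)) μ μ))
  have h3 := (logEnergy_le_liminf hL hρ hμ).trans
    ((liminf_le_liminf (Eventually.of_forall h1)).trans h2.liminf_eq.le)
  calc 2 * logEnergy (log (2 * L)) ρ μ ≤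
      2 * (2⁻¹ * (logEnergy (log (2 * L)) ρ ρ + logEnergy (log (2 * L)) μ μ)) := by gcongr
    _ = _ := by
      rw [← mul_assoc, ENNReal.mul_inv_cancel two_ne_zero ENNReal.ofNat_ne_top, one_mul]

/-- The regularised energy is a sum of nonnegative terms weighted by qⁿ ≤ 1; Fatou then carries the
bound to q = 1. -/
theorem logEnergy_self_le (hμ : μ ∈ probOn (Metric.closedBall 0 L)) {s : ℝ}
    (hs : HasSum (fun n : ℕ => 2 / n * chebMoment L μ n ^ 2) s) :
    logEnergy (log (2 * L)) μ μ ≤ ENNReal.ofReal (log 4 + s) := by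
  have := hμ.1
  refine (logEnergy_le_liminf hL hμ hμ).trans ?_
  refine liminf_le_of_le (by isBoundedDefault) fun b hb => ?_
  obtain ⟨j, hj⟩ := hb.exists
  refine hj.trans (ENNReal.ofReal_le_ofReal ?_)
  have hq := (abelSeq_pos j).le
  have := hasSum_le (fun n => ?_)
    (hasSum_integral_regKernel_prod hq (abelSeq_lt_one j) L μ μ) hs
  · unfold regEnergy; linarith
  · have h1 : abelSeq j ^ n ≤ 1 := pow_le_one₀ hq (abelSeq_lt_one j).le
    have h2 : 0 ≤ 2 / n * chebMoment L μ n ^ 2 := by positivity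
    nlinarith

/-- Lower bound for the logarithmic potential on `[-L, L]`. -/
theorem le_lintegral_logKernel (hμ : μ ∈ probOn (Metric.closedBall 0 L)) {x : ℝ}
    (hx : x ∈ Metric.closedBall 0 L)
    (hs : Summable fun n : ℕ => |2 / n * chebMoment L μ n|) :
    ENNReal.ofReal (log 4 + ∑' n : ℕ, 2 / n * chebCos n (x / L) * chebMoment L μ n) ≤
      ∫⁻ y, logKernel (log (2 * L)) x y ∂μ := by
  have := hμ.1
  have h1 : ∀ j, ENNReal.ofReal (log 4 + (∑' n : ℕ, 2 / n * (abelSeq j) ^ n * chebCos n (x / L) *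
      chebMoment L μ n) + log (abelSeq j)) ≤ ∫⁻ y, logKernel (log (2 * L)) x y ∂μ := by
    intro j
    have hq := abelSeq_pos j
    have hq1 := abelSeq_lt_one j
    rw [(hasSum_integral_regKernel hq.le hq1 L (x / L) μ).tsum_eq]
    have hi := integrable_regKernel hq.le hq1 L μ (f := fun _ => x) measurable_const measurable_id
    have e : log 4 + (∫ y, regKernel (abelSeq j) (x / L) (y / L) ∂μ) + log (abelSeq j) =
        ∫ y, (log 4 + regKernel (abelSeq j) (x / L) (y / L) + log (abelSeq j)) ∂μ := by
      have i1 : Integrable (fun y => log 4 + regKernel (abelSeq j) (x / L) (y / L)) μ :=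
        (integrable_const _).add hi
      have i2 : Integrable (fun y => regKernel (abelSeq j) (x / L) (y / L)) μ := hi
      rw [integral_add i1 (integrable_const _), integral_add (integrable_const _) i2]
      simp
    rw [e]
    refine ofReal_integral_le_lintegral.trans (lintegral_mono_ae ?_)
    filter_upwards [ae_mem_of_mem_probOn hμ] with y hy
    exact ofReal_regKernel_le_logKernel hq hq1 hL hx hy
  -- Abel limit by dominated convergence, with the moment series as majorant.
  have h2 : Tendsto (fun j => ∑' n : ℕ, 2 / n * (abelSeq j) ^ n * chebCos n (x / L) *
      chebMoment L μ n) atTop (𝓝 (∑' n : ℕ, 2 / n * chebCos n (x / L) * chebMoment L μ n)) := by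
    refine tendsto_tsum_of_dominated_convergence hs (fun n => ?_) (Eventually.of_forall fun j n => ?_)
    · have h3 := tendsto_abelSeq.pow n
      rw [one_pow] at h3
      simpa using ((h3.const_mul (2 / (n : ℝ))).mul_const (chebCos n (x / L))).mul_const
        (chebMoment L μ n)
    · have hq := (abelSeq_pos j).le
      have h1 : |abelSeq j ^ n| ≤ 1 := by
        rw [abs_of_nonneg (by positivity)]
        exact pow_le_one₀ hq (abelSeq_lt_one j).le
      rw [Real.norm_eq_abs, show 2 / (n : ℝ) * abelSeq j ^ n * chebCos n (x / L) * chebMoment L μ n =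
        2 / n * chebMoment L μ n * (abelSeq j ^ n * chebCos n (x / L)) by ring, abs_mul]
      refine mul_le_of_le_one_right (abs_nonneg _) ?_
      rw [abs_mul]
      exact mul_le_one₀ h1 (abs_nonneg _) (abs_chebCos_le_one _ _)
  have h3 := (h2.const_add (log 4)).add tendsto_log_abelSeq
  rw [add_zero] at h3
  exact le_of_tendsto' (ENNReal.tendsto_ofReal h3) h1

end
end LogGas

namespace LogGas
open Real

/-! ### The energy through nonnegative kernels -/

/-- For f = k + r this reads f⁺ + r⁻ = k + r⁺ + f⁻, an additive form free of truncated subtraction.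
-/
theorem EReal_toENNReal_coe_add (k : ℝ≥0∞) (r : ℝ) :
    ((k : EReal) + (r : EReal)).toENNReal + ENNReal.ofReal (-r) =
      k + ENNReal.ofReal r + (-((k : EReal) + (r : EReal))).toENNReal := by
  induction k with
  | top => simp
  | coe t =>
    have h1 : (((t : ℝ≥0∞) : EReal) + (r : EReal)) = ((t + r : ℝ) : EReal) := by
      rw [EReal.coe_add, EReal.coe_nnreal_eq_coe_real]
    have h2 : (t : ℝ≥0∞) = ENNReal.ofReal (t : ℝ) := by simp
    have ht : (0 : ℝ) ≤ t := t.2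
    have e : ∀ x : ℝ, ((x : ℝ) : EReal).toENNReal = ENNReal.ofReal x := fun x => by
      rw [EReal.toENNReal_of_ne_top (EReal.coe_ne_top _), EReal.toReal_coe]
    rw [h1, ← EReal.coe_neg, e, e, h2]
    generalize (t : ℝ) = t at ht
    rcases le_total 0 r with hr | hr
    · rw [ENNReal.ofReal_of_nonpos (by linarith : -r ≤ 0),
        ENNReal.ofReal_of_nonpos (by linarith : -(t + r) ≤ 0), add_zero, add_zero,
        ENNReal.ofReal_add ht hr]
    · rw [ENNReal.ofReal_of_nonpos hr]
      rcases le_total 0 (t + r) with h | h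
      · rw [ENNReal.ofReal_of_nonpos (by linarith : -(t + r) ≤ 0), add_zero, add_zero,
          ← ENNReal.ofReal_add h (by linarith)]
        congr 1; ring
      · rw [ENNReal.ofReal_of_nonpos h, zero_add, add_zero,
          ← ENNReal.ofReal_add ht (by linarith)]
        congr 1; ring

/-- The additive identity integrates using measurability of k and r alone, and f⁻ ≤ r⁻ excludes ∞ -
∞. The integral of k may be infinite. -/
theorem eintegral_eq {α : Type*} [MeasurableSpace α] {ν : Measure α} {f : α → EReal}
    {k : α → ℝ≥0∞} {r : α → ℝ} (hk : Measurable k) (hr : Integrable r ν)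
    (hf : ∀ᵐ a ∂ν, f a = (k a : EReal) + (r a : EReal)) :
    eintegral ν f = ((∫⁻ a, k a ∂ν : ℝ≥0∞) : EReal) + ((∫ a, r a ∂ν : ℝ) : EReal) := by
  have hm : AEMeasurable r ν := hr.1.aemeasurable
  have h1 : ∫⁻ a, (f a).toENNReal ∂ν + ∫⁻ a, ENNReal.ofReal (-r a) ∂ν =
      ∫⁻ a, k a ∂ν + ∫⁻ a, ENNReal.ofReal (r a) ∂ν + ∫⁻ a, (-f a).toENNReal ∂ν := by
    have hm' : AEMeasurable (fun a => ENNReal.ofReal (-r a)) ν := hm.neg.ennreal_ofReal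
    have hm'' : AEMeasurable (fun a => k a + ENNReal.ofReal (r a)) ν :=
      hk.aemeasurable.add hm.ennreal_ofReal
    rw [← lintegral_add_right' _ hm', ← lintegral_add_left hk,
      ← lintegral_add_left' hm'']
    refine lintegral_congr_ae ?_
    filter_upwards [hf] with a ha
    rw [ha]
    exact EReal_toENNReal_coe_add _ _
  have h2 : ∫⁻ a, (-f a).toENNReal ∂ν ≤ ∫⁻ a, ENNReal.ofReal (-r a) ∂ν := by
    refine lintegral_mono_ae ?_
    filter_upwards [hf] with a ha
    rw [ha]
    have : -((k a : EReal) + (r a : EReal)) ≤ ((-r a : ℝ) : EReal) := by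
      rw [EReal.coe_neg, EReal.neg_le_neg_iff]
      exact le_add_of_nonneg_left (EReal.coe_ennreal_nonneg _)
    refine (EReal.toENNReal_le_toENNReal this).trans ?_
    rw [EReal.toENNReal_of_ne_top (EReal.coe_ne_top _), EReal.toReal_coe]
  have hp : ∫⁻ a, ENNReal.ofReal (r a) ∂ν ≠ ⊤ := hr.lintegral_lt_top.ne
  have hn : ∫⁻ a, ENNReal.ofReal (-r a) ∂ν ≠ ⊤ := hr.neg.lintegral_lt_top.ne
  have hg : ∫⁻ a, (-f a).toENNReal ∂ν ≠ ⊤ := ne_top_of_le_ne_top hn h2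
  rw [eintegral, integral_eq_lintegral_pos_part_sub_lintegral_neg_part hr]
  clear h2 hf
  generalize ∫⁻ a, ENNReal.ofReal (r a) ∂ν = A at *
  generalize ∫⁻ a, ENNReal.ofReal (-r a) ∂ν = B at *
  generalize ∫⁻ a, (-f a).toENNReal ∂ν = G at *
  generalize ∫⁻ a, (f a).toENNReal ∂ν = F at *
  generalize ∫⁻ a, k a ∂ν = K at *
  lift A to NNReal using hp
  lift B to NNReal using hn
  lift G to NNReal using hg
  induction K with
  | top =>
    have : F = ⊤ := by
      by_contra hF
      lift F to NNReal using hF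
      simp only [top_add] at h1
      exact ENNReal.coe_ne_top (by exact_mod_cast h1)
    subst this
    simp only [EReal.coe_ennreal_top, EReal.top_add_coe]
    rw [EReal.coe_nnreal_eq_coe_real, EReal.top_sub_coe]
  | coe K =>
    have hF : F ≠ ⊤ := by
      rintro rfl
      simp only [top_add] at h1
      exact ENNReal.coe_ne_top (by exact_mod_cast h1.symm)
    lift F to NNReal using hF
    have h2 : (F : ℝ) + B = K + A + G := by exact_mod_cast h1
    simp only [EReal.coe_nnreal_eq_coe_real, ENNReal.coe_toReal]
    rw [← EReal.coe_sub, ← EReal.coe_add, EReal.coe_eq_coe_iff]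
    linarith

/-- On the ball |x - y| ≤ 2L, so the truncation in `logKernel` is inactive. -/
theorem energyKernel_eq_logKernel (V : ℝ → ℝ) {L x y : ℝ}
    (hx : x ∈ Metric.closedBall 0 L) (hy : y ∈ Metric.closedBall 0 L) :
    energyKernel V x y = ((2⁻¹ * logKernel (log (2 * L)) x y : ℝ≥0∞) : EReal) +
      (((V x + V y - log (2 * L)) / 2 : ℝ) : EReal) := by
  by_cases hxy : x = y
  · have : (2⁻¹ : ℝ≥0∞) * ⊤ = ⊤ := ENNReal.mul_top (by simp)
    simp only [energyKernel, logKernel, hxy, if_true, this, EReal.coe_ennreal_top,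
      EReal.top_add_coe]
  · have h0 : 0 < |x - y| := abs_pos.2 (sub_ne_zero.2 hxy)
    have h1 : |x - y| ≤ 2 * L := by
      simp only [Metric.mem_closedBall, dist_zero_right, Real.norm_eq_abs] at hx hy
      linarith [abs_sub x y]
    have h2 := log_le_log h0 h1
    rw [energyKernel, if_neg hxy, logKernel, if_neg hxy,
      show (2⁻¹ : ℝ≥0∞) = ENNReal.ofReal 2⁻¹ by rw [ENNReal.ofReal_inv_of_pos two_pos]; norm_num,
      ← ENNReal.ofReal_mul (by norm_num), EReal.coe_ennreal_ofReal,
      max_eq_left (by nlinarith), ← EReal.coe_add]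
    congr 1
    ring

theorem integrable_of_mem_probOn {V : ℝ → ℝ} (hV : Continuous V) {L : ℝ} {ρ : Measure ℝ}
    (hρ : ρ ∈ probOn (Metric.closedBall 0 L)) : Integrable V ρ := by
  have := hρ.1
  obtain ⟨M, hM⟩ := (isCompact_closedBall (0 : ℝ) L).exists_bound_of_continuousOn hV.continuousOn
  refine Integrable.of_bound hV.aestronglyMeasurable M ?_
  filter_upwards [ae_mem_of_mem_probOn hρ] with x hx using hM x hx

theorem energy_eq_logEnergy {V : ℝ → ℝ} (hV : Continuous V) {L : ℝ} {ρ : Measure ℝ}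
    (hρ : ρ ∈ probOn (Metric.closedBall 0 L)) :
    energy V ρ = ((2⁻¹ * logEnergy (log (2 * L)) ρ ρ : ℝ≥0∞) : EReal) +
      ((∫ x, V x ∂ρ - log (2 * L) / 2 : ℝ) : EReal) := by
  have := hρ.1
  have hi := integrable_of_mem_probOn hV hρ
  have h1 : Integrable (fun p : ℝ × ℝ => V p.1) (ρ.prod ρ) := hi.comp_fst ρ
  have h2 : Integrable (fun p : ℝ × ℝ => V p.2) (ρ.prod ρ) := hi.comp_snd ρ
  have h12 : Integrable (fun p : ℝ × ℝ => V p.1 + V p.2) (ρ.prod ρ) := h1.add h2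
  have h := eintegral_eq (ν := ρ.prod ρ) (f := fun p => energyKernel V p.1 p.2)
    (k := fun p => 2⁻¹ * logKernel (log (2 * L)) p.1 p.2)
    (r := fun p => (V p.1 + V p.2 - log (2 * L)) / 2)
    ((measurable_logKernel _).const_mul _) ((h12.sub (integrable_const _)).div_const 2)
    (by
      filter_upwards [ae_prod_mem_of_mem_probOn hρ hρ] with p hp
      exact energyKernel_eq_logKernel V hp.1 hp.2)
  rw [energy, h, lintegral_const_mul _ (measurable_logKernel _), logEnergy]
  congr 2
  rw [integral_div, integral_sub h12 (integrable_const _), integral_add h1 h2,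
    integral_fun_fst (μ := ρ) (ν := ρ) V, integral_fun_snd (μ := ρ) (ν := ρ) V]
  simp
  ring

theorem logKernel_mono_shift {c c' : ℝ} (hc : c ≤ c') {x y : ℝ} (h : log |x - y| ≤ c) :
    logKernel c' x y = logKernel c x y + ENNReal.ofReal (c' - c) := by
  by_cases hxy : x = y
  · simp [logKernel, hxy]
  · rw [logKernel, logKernel, if_neg hxy, if_neg hxy, ← ENNReal.ofReal_add (by linarith)
      (by linarith)]
    congr 1
    ring

theorem log_abs_sub_le {L x y : ℝ} (hL : 1 / 2 ≤ L ∨ x ≠ y) (hx : x ∈ Metric.closedBall 0 L)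
    (hy : y ∈ Metric.closedBall 0 L) : log |x - y| ≤ log (2 * L) := by
  by_cases hxy : x = y
  · rcases hL with hL | hL
    · simp only [hxy, sub_self, abs_zero, log_zero]
      exact log_nonneg (by linarith)
    · exact absurd hxy hL
  · have h1 : |x - y| ≤ 2 * L := by
      simp only [Metric.mem_closedBall, dist_zero_right, Real.norm_eq_abs] at hx hy
      linarith [abs_sub x y]
    exact log_le_log (abs_pos.2 (sub_ne_zero.2 hxy)) h1

/-- The candidate is computed at scale R but compared with measures on the larger ball at scale L;
for points in the small ball only the additive constant changes. -/
theorem logKernel_shift {R L x y : ℝ} (hR : 0 < R) (hRL : R ≤ L)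
    (hx : x ∈ Metric.closedBall 0 R) (hy : y ∈ Metric.closedBall 0 R) :
    logKernel (log (2 * L)) x y =
      logKernel (log (2 * R)) x y + ENNReal.ofReal (log (2 * L) - log (2 * R)) := by
  by_cases hxy : x = y
  · simp [logKernel, hxy]
  · exact logKernel_mono_shift (log_le_log (by positivity) (by linarith))
      (log_abs_sub_le (Or.inr hxy) hx hy)

/-- The energy of the gas confined to `[-R, R]`, as a series. -/
noncomputable def gasEnergy (V : ℝ → ℝ) (R : ℝ) : ℝ :=
  log (2 / R) / 2 + chebCoeff V 0 R - (∑' n : ℕ, n * chebCoeff V n R ^ 2) / 4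

theorem chebMoment_eq_integral_T {L : ℝ} (hL : 0 < L) {ρ : Measure ℝ}
    (hρ : ρ ∈ probOn (Metric.closedBall 0 L)) (n : ℕ) :
    chebMoment L ρ n = ∫ x, (Polynomial.Chebyshev.T ℝ (n : ℤ)).eval (x / L) ∂ρ := by
  refine integral_congr_ae ?_
  filter_upwards [ae_mem_of_mem_probOn hρ] with x hx
  exact chebCos_eq_T n (abs_div_le_one_of_mem hL hx)

theorem log_two_mul_add_log_two_div {R : ℝ} (hR : 0 < R) :
    log (2 * R) + log (2 / R) = log 4 := by
  rw [← log_mul (by positivity) (by positivity)]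
  congr 1
  field_simp
  norm_num

namespace IsAdmissible

variable {V : ℝ → ℝ} (hV : IsAdmissible V)

include hV

/-- These are the coefficients of the logarithmic potential: opposite to those of V, so the two
cancel up to a constant. At n = 0 the convention 2/0 = 0 applies. -/
theorem two_div_mul_chebMoment_gasMeasure {R : ℝ} (hR : 0 < R) (hS : virial V R ≤ 1) (n : ℕ) :
    2 / n * chebMoment R (gasMeasure V R) n = if n = 0 then 0 else -chebCoeff V n R := by
  split_ifs with hn
  · simp [hn]
  · rw [chebMoment_eq_integral_T hR (hV.gasMeasure_mem_probOn hR hS le_rfl),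
      hV.integral_T_gasMeasure hR hS hn]
    field_simp

theorem logEnergy_gasMeasure_le {R L : ℝ} (hR : 0 < R) (hS : virial V R ≤ 1) (hRL : R ≤ L) :
    logEnergy (log (2 * L)) (gasMeasure V R) (gasMeasure V R) ≤
      ENNReal.ofReal (log (2 * L) + log (2 / R) + (∑' n : ℕ, n * chebCoeff V n R ^ 2) / 2) := by
  have hmem := hV.gasMeasure_mem_probOn hR hS le_rfl
  have := hmem.1
  have hs := hV.hasSum_integral_gasMeasure hR hS
  have h1 : HasSum (fun n : ℕ => 2 / n * chebMoment R (gasMeasure V R) n ^ 2)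
      ((∑' n : ℕ, n * chebCoeff V n R ^ 2) / 2) := by
    convert! hs.summable.hasSum.div_const 2 using 1
    ext n
    rw [pow_two, ← mul_assoc, hV.two_div_mul_chebMoment_gasMeasure hR hS]
    split_ifs with hn
    · simp [hn]
    · rw [chebMoment_eq_integral_T hR hmem, hV.integral_T_gasMeasure hR hS hn]
      ring
  have h2 := logEnergy_self_le hR hmem h1
  have h3 : logEnergy (log (2 * L)) (gasMeasure V R) (gasMeasure V R) =
      logEnergy (log (2 * R)) (gasMeasure V R) (gasMeasure V R) +
        ENNReal.ofReal (log (2 * L) - log (2 * R)) := by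
    have e : ∫⁻ p, logKernel (log (2 * L)) p.1 p.2 ∂((gasMeasure V R).prod (gasMeasure V R)) =
      ∫⁻ p, (logKernel (log (2 * R)) p.1 p.2 + ENNReal.ofReal (log (2 * L) - log (2 * R)))
        ∂((gasMeasure V R).prod (gasMeasure V R)) := by
      refine lintegral_congr_ae ?_
      filter_upwards [ae_prod_mem_of_mem_probOn hmem hmem] with p hp
      exact logKernel_shift hR hRL hp.1 hp.2
    rw [logEnergy, e, lintegral_add_right _ measurable_const, lintegral_const, measure_univ,
      mul_one, logEnergy]
  have hnn : 0 ≤ (∑' n : ℕ, n * chebCoeff V n R ^ 2) / 2 :=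
    div_nonneg (tsum_nonneg fun n => by positivity) two_pos.le
  rw [h3]
  calc _ ≤ ENNReal.ofReal (log 4 + (∑' n : ℕ, n * chebCoeff V n R ^ 2) / 2) +
        ENNReal.ofReal (log (2 * L) - log (2 * R)) := by gcongr
    _ = _ := by
      rw [← ENNReal.ofReal_add (add_nonneg (log_nonneg (by norm_num)) hnn)
        (sub_nonneg.2 (log_le_log (by positivity) (by linarith)))]
      congr 1
      linarith [log_two_mul_add_log_two_div hR]

theorem energy_gasMeasure_le {R : ℝ} (hR : 0 < R) (hS : virial V R ≤ 1) :
    energy V (gasMeasure V R) ≤ (gasEnergy V R : EReal) := by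
  have hmem := hV.gasMeasure_mem_probOn hR hS le_rfl
  rw [energy_eq_logEnergy hV.continuous hmem]
  have hI := (hV.hasSum_integral_gasMeasure hR hS).tsum_eq
  have hnn : 0 ≤ (∑' n : ℕ, n * chebCoeff V n R ^ 2) / 2 :=
    div_nonneg (tsum_nonneg fun n => by positivity) two_pos.le
  have hl : (2⁻¹ : ℝ≥0∞) * logEnergy (log (2 * R)) (gasMeasure V R) (gasMeasure V R) ≤
      ENNReal.ofReal (2⁻¹ * (log 4 + (∑' n : ℕ, n * chebCoeff V n R ^ 2) / 2)) := by
    rw [ENNReal.ofReal_mul (by norm_num), ENNReal.ofReal_inv_of_pos two_pos,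
      ENNReal.ofReal_ofNat, ← log_two_mul_add_log_two_div hR]
    gcongr
    exact hV.logEnergy_gasMeasure_le hR hS le_rfl
  calc _ ≤ ((ENNReal.ofReal (2⁻¹ * (log 4 + (∑' n : ℕ, n * chebCoeff V n R ^ 2) / 2)) : ℝ≥0∞) :
        EReal) + ((∫ x, V x ∂(gasMeasure V R) - log (2 * R) / 2 : ℝ) : EReal) :=
        add_le_add_left (EReal.coe_ennreal_le_coe_ennreal_iff.2 hl) _
    _ = _ := by
      have h4 : 0 ≤ log 4 := log_nonneg (by norm_num)
      rw [EReal.coe_ennreal_ofReal, max_eq_left (by positivity), ← EReal.coe_add, gasEnergy]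
      congr 1
      linarith [log_two_mul_add_log_two_div hR]

/-- The potential of `gasMeasure` on `[-R, R]`. -/
theorem le_potential_of_mem {R L : ℝ} (hR : 0 < R) (hS : virial V R ≤ 1) (hRL : R ≤ L) {x : ℝ}
    (hx : x ∈ Metric.closedBall 0 R) :
    ENNReal.ofReal (log (2 * L) + log (2 / R) + chebCoeff V 0 R - V x) ≤
      ∫⁻ y, logKernel (log (2 * L)) x y ∂(gasMeasure V R) := by
  have hmem := hV.gasMeasure_mem_probOn hR hS le_rfl
  have := hmem.1
  have hm := hV.two_div_mul_chebMoment_gasMeasure hR hS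
  have hxR := abs_div_le_one_of_mem hR hx
  have h1 := le_lintegral_logKernel hR hmem hx (by
    simp only [hm]
    rw [← summable_nat_add_iff 1]
    simpa using hV.summable_abs_chebCoeff R)
  have h2 : ∑' n : ℕ, 2 / n * chebCos n (x / R) * chebMoment R (gasMeasure V R) n =
      chebCoeff V 0 R - V x := by
    have h3 : ∀ n : ℕ, 2 / n * chebCos n (x / R) * chebMoment R (gasMeasure V R) n =
        if n = 0 then 0 else -(chebCoeff V n R * chebCos n (x / R)) := by
      intro n
      rw [mul_right_comm, hm]
      split_ifs <;> ring
    have h4 := hV.hasSum_chebCoeff_T R hxR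
    have h5 : HasSum (fun n : ℕ => if n = 0 then 0 else -(chebCoeff V n R * chebCos n (x / R)))
        (chebCoeff V 0 R - V x) := by
      rw [← hasSum_nat_add_iff' 1]
      convert! h4.neg using 1
      · ext n
        rw [if_neg n.succ_ne_zero, chebCos_eq_T _ hxR]
      · rw [mul_div_cancel₀ _ hR.ne']
        simp
    simp only [h3]
    exact h5.tsum_eq
  rw [h2] at h1
  have e : ∫⁻ y, logKernel (log (2 * L)) x y ∂(gasMeasure V R) =
      ∫⁻ y, logKernel (log (2 * R)) x y ∂(gasMeasure V R) +
        ENNReal.ofReal (log (2 * L) - log (2 * R)) := by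
    have e1 : ∫⁻ y, logKernel (log (2 * L)) x y ∂(gasMeasure V R) =
      ∫⁻ y, (logKernel (log (2 * R)) x y + ENNReal.ofReal (log (2 * L) - log (2 * R)))
        ∂(gasMeasure V R) := by
      refine lintegral_congr_ae ?_
      filter_upwards [ae_mem_of_mem_probOn hmem] with y hy
      exact logKernel_shift hR hRL hx hy
    rw [e1, lintegral_add_right _ measurable_const, lintegral_const, measure_univ, mul_one]
  rw [e]
  calc _ = ENNReal.ofReal ((log 4 + (chebCoeff V 0 R - V x)) + (log (2 * L) - log (2 * R))) := by
        congr 1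
        linarith [log_two_mul_add_log_two_div hR]
    _ ≤ _ := ENNReal.ofReal_add_le
    _ ≤ _ := by gcongr

/-- With g the candidate, positive definiteness bounds ½I(ρ,ρ) below by I(ρ,g) - ½I(g,g).
Integrating the one-sided potential bound against ρ produces -∫ V dρ, which cancels the confinement
energy. In `ℝ≥0∞` no finiteness of I(ρ,ρ) is needed. -/
theorem gasEnergy_le_energy {R L : ℝ} (hR : 0 < R) (hS : virial V R ≤ 1) (hRL : R ≤ L)
    (hpot : ∀ x ∈ Metric.closedBall 0 L,
      ENNReal.ofReal (log (2 * L) + log (2 / R) + chebCoeff V 0 R - V x) ≤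
        ∫⁻ y, logKernel (log (2 * L)) x y ∂(gasMeasure V R))
    {ρ : Measure ℝ} (hρ : ρ ∈ probOn (Metric.closedBall 0 L)) :
    (gasEnergy V R : EReal) ≤ energy V ρ := by
  have hmem := hV.gasMeasure_mem_probOn hR hS hRL
  have := hmem.1
  have := hρ.1
  have hi := integrable_of_mem_probOn hV.continuous hρ
  rw [energy_eq_logEnergy hV.continuous hρ]
  have h1 := two_mul_logEnergy_le (hR.trans_le hRL) hρ hmem
  have h2 := hV.logEnergy_gasMeasure_le hR hS hRL
  have h3 : ENNReal.ofReal (log (2 * L) + log (2 / R) + chebCoeff V 0 R - ∫ x, V x ∂ρ) ≤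
      logEnergy (log (2 * L)) ρ (gasMeasure V R) := by
    have e : log (2 * L) + log (2 / R) + chebCoeff V 0 R - ∫ x, V x ∂ρ =
        ∫ x, (log (2 * L) + log (2 / R) + chebCoeff V 0 R - V x) ∂ρ := by
      rw [integral_sub (integrable_const _) hi]
      simp
    rw [e, logEnergy, lintegral_prod _ (measurable_logKernel _).aemeasurable]
    refine ofReal_integral_le_lintegral.trans (lintegral_mono_ae ?_)
    filter_upwards [ae_mem_of_mem_probOn hρ] with x hx using hpot x hx
  have hnn : 0 ≤ ∑' n : ℕ, n * chebCoeff V n R ^ 2 := tsum_nonneg fun n => by positivity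
  have hd : 0 ≤ log (2 * L) + log (2 / R) + (∑' n : ℕ, n * chebCoeff V n R ^ 2) / 2 := by
    have a1 := log_two_mul_add_log_two_div hR
    have a2 : log (2 * R) ≤ log (2 * L) := log_le_log (by positivity) (by linarith)
    have a3 : 0 ≤ log 4 := log_nonneg (by norm_num)
    linarith
  have h4 : 2 * ENNReal.ofReal (log (2 * L) + log (2 / R) + chebCoeff V 0 R - ∫ x, V x ∂ρ) ≤
      logEnergy (log (2 * L)) ρ ρ +
        ENNReal.ofReal (log (2 * L) + log (2 / R) + (∑' n : ℕ, n * chebCoeff V n R ^ 2) / 2) :=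
    (mul_le_mul_right h3 2).trans (h1.trans (add_le_add_right h2 _))
  clear h1 h2 h3
  generalize logEnergy (log (2 * L)) ρ ρ = A at *
  induction A with
  | top =>
    have : (2⁻¹ : ℝ≥0∞) * ⊤ = ⊤ := ENNReal.mul_top (by simp)
    rw [this, EReal.coe_ennreal_top, EReal.top_add_coe]
    exact le_top
  | coe a =>
    have ha : (0 : ℝ) ≤ a := a.2
    have e1 : (a : ℝ≥0∞) = ENNReal.ofReal (a : ℝ) := by simp
    have e2 : (2⁻¹ : ℝ≥0∞) * (a : ℝ≥0∞) = ENNReal.ofReal (2⁻¹ * (a : ℝ)) := by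
      rw [ENNReal.ofReal_mul (by norm_num), ENNReal.ofReal_inv_of_pos two_pos, ← e1]
      norm_num
    rw [e1, ← ENNReal.ofReal_add ha hd, show (2 : ℝ≥0∞) = ENNReal.ofReal 2 by simp,
      ← ENNReal.ofReal_mul two_pos.le, ENNReal.ofReal_le_ofReal_iff (by positivity)] at h4
    rw [e2, EReal.coe_ennreal_ofReal, max_eq_left (by positivity), ← EReal.coe_add,
      EReal.coe_le_coe_iff, gasEnergy]
    linarith

theorem isEquilibrium_gasMeasure {R : ℝ} (hR : 0 < R) (hS : virial V R ≤ 1) :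
    IsEquilibrium V (Metric.closedBall 0 R) (gasMeasure V R) :=
  ⟨hV.gasMeasure_mem_probOn hR hS le_rfl, fun _ hρ => (hV.energy_gasMeasure_le hR hS).trans
    (hV.gasEnergy_le_energy hR hS le_rfl (fun _ hx => hV.le_potential_of_mem hR hS le_rfl hx) hρ)⟩

/-- The lower bound applied to the candidate itself upgrades the Fatou upper bound to equality. -/
theorem energy_gasMeasure {R : ℝ} (hR : 0 < R) (hS : virial V R ≤ 1) :
    energy V (gasMeasure V R) = (gasEnergy V R : EReal) :=
  (hV.energy_gasMeasure_le hR hS).antisymm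
    (hV.gasEnergy_le_energy hR hS le_rfl (fun _ hx => hV.le_potential_of_mem hR hS le_rfl hx)
      (hV.gasMeasure_mem_probOn hR hS le_rfl))

end IsAdmissible
end LogGas

namespace LogGas
open Real

/-! ### The potential outside the support -/

/-- At an endpoint the two angles have equal cosines, so a single logarithm remains. With r =
exp(-t) it represents log(cosh t - σv), the kernel seen from outside the support. -/
theorem regKernel_sign {r : ℝ} (hr : 0 ≤ r) (hr1 : r < 1) {σ v : ℝ} (hσ : σ = 1 ∨ σ = -1)
    (hv : |v| ≤ 1) : regKernel r σ v = -log (1 - 2 * r * (σ * v) + r ^ 2) := by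
  obtain ⟨h1, h2⟩ := abs_le.1 hv
  rw [regKernel_eq hr hr1]
  rcases hσ with rfl | rfl
  · rw [arccos_one, zero_add, zero_sub, cos_neg, cos_arccos h1 h2, one_mul]
    ring
  · rw [arccos_neg_one, cos_pi_sub, add_comm π, cos_add_pi, cos_arccos h1 h2]
    ring_nf

theorem chebCos_sign (n : ℕ) {σ : ℝ} (hσ : σ = 1 ∨ σ = -1) : chebCos n σ = σ ^ n := by
  rcases hσ with rfl | rfl
  · simp [chebCos]
  · simp [chebCos, cos_nat_mul_pi]

theorem log_cosh_sub {t : ℝ} {w : ℝ} (hw : |w| ≤ 1) (ht : 0 < t) :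
    log (cosh t - w) = t - log 2 + log (1 - 2 * exp (-t) * w + exp (-t) ^ 2) := by
  have h1 : 1 < cosh t := one_lt_cosh.2 ht.ne'
  have h2 := (abs_le.1 hw).2
  have h3 : 1 - 2 * exp (-t) * w + exp (-t) ^ 2 = 2 * exp (-t) * (cosh t - w) := by
    have : exp t * exp (-t) = 1 := by rw [← exp_add]; simp
    rw [cosh_eq]
    linear_combination -this
  rw [h3, log_mul (by positivity) (by linarith), log_mul two_ne_zero (exp_pos _).ne', log_exp]
  ring

namespace IsAdmissible

variable {V : ℝ → ℝ} (hV : IsAdmissible V)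

include hV

/-- The right side Ψ(t) is the effective potential at R cosh t, with Ψ(0) = c_0. In the summation
formula with e_n = exp(-nt), e_1 - cosh t = -sinh t cancels the V' term of Ψ' and S = 1 cancels the
-1, leaving Ψ' = sinh² t times `meanDivDiff`, which is nonnegative. -/
theorem le_sub_tsum_exp {R : ℝ} (hR : 0 < R) (hS : virial V R = 1) {t : ℝ} (ht : 0 ≤ t) :
    chebCoeff V 0 R ≤ V (R * cosh t) - t -
      ∑' n : ℕ, chebCoeff V (n + 1) R * exp (-((n + 1 : ℕ) * t)) := by
  set Ψ : ℝ → ℝ := fun t => V (R * cosh t) - t -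
    ∑' n : ℕ, chebCoeff V (n + 1) R * exp (-((n + 1 : ℕ) * t)) with hΨ
  have hexp : ∀ (n : ℕ) (t : ℝ), 0 ≤ t → |exp (-(n * t))| ≤ 1 := by
    intro n t ht
    rw [abs_of_pos (exp_pos _), exp_le_one_iff, neg_nonpos]
    positivity
  have hc := hV.continuous
  have hcont : ContinuousOn Ψ (Ici 0) := by
    refine ContinuousOn.sub (by fun_prop) (continuousOn_tsum (fun n => by fun_prop)
      (hV.summable_abs_chebCoeff R) fun n t ht => ?_)
    rw [norm_mul]
    exact mul_le_of_le_one_right (abs_nonneg _) (hexp _ t ht)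
  have hsum' := (summable_nat_add_iff 1).2 (hV.summable_abs_nat_mul_chebCoeff R)
  have hderiv : ∀ t ∈ Ioi (0 : ℝ), HasDerivAt Ψ (sinh t ^ 2 * meanDivDiff V R (cosh t)) t := by
    intro t ht
    have h1 := hasDerivAt_tsum_of_isPreconnected (t := Ioi (0 : ℝ)) hsum' isOpen_Ioi isPreconnected_Ioi
      (g := fun (n : ℕ) t => chebCoeff V (n + 1) R * exp (-((n + 1 : ℕ) * t)))
      (g' := fun (n : ℕ) t => -(((n + 1 : ℕ) : ℝ) * chebCoeff V (n + 1) R * exp (-((n + 1 : ℕ) * t))))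
      (y₀ := t) (fun n y _ => by
        have := (((hasDerivAt_id y).const_mul ((n + 1 : ℕ) : ℝ)).neg.exp).const_mul
          (chebCoeff V (n + 1) R)
        convert! this using 1
        simp
        ring)
      (fun n y hy => by
        rw [norm_neg, norm_mul]
        exact mul_le_of_le_one_right (abs_nonneg _) (hexp _ y (le_of_lt hy))) ht
      (hV.summable_chebCoeff_mul R (e := fun n => exp (-(n * t)))
        (fun n => hexp n t (le_of_lt ht))) ht
    have h2 := hV.hasSum_nat_mul_chebCoeff R (cosh t) (e := fun n => exp (-(n * t))) (by simp)
      (fun n => by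
        have e1 : -(((n + 2 : ℕ) : ℝ) * t) = -((n : ℝ) * t) + -t + -t := by push_cast; ring
        have e2 : -(((n + 1 : ℕ) : ℝ) * t) = -((n : ℝ) * t) + -t := by push_cast; ring
        have e3 : exp t * exp (-t) = 1 := by rw [← exp_add]; simp
        rw [e1, e2, exp_add, exp_add, cosh_eq]
        linear_combination (-exp (-(n * t))) * e3)
      (fun n => hexp n t (le_of_lt ht))
    have h3 := (hasSum_nat_add_iff' 1).2 h2
    have h4 := ((hV.hasDerivAt (R * cosh t)).comp t ((hasDerivAt_cosh t).const_mul R)).sub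
      (hasDerivAt_id t)
    have h5 := h4.sub h1
    rw [tsum_neg, h3.tsum_eq, hS] at h5
    convert! h5 using 1
    have e : exp (-((1 : ℕ) * t)) - cosh t = - sinh t := by
      rw [Nat.cast_one, one_mul, ← cosh_sub_sinh]
      ring
    rw [e, cosh_sq]
    simp
    ring
  have hmono : MonotoneOn Ψ (Ici 0) := by
    refine monotoneOn_of_hasDerivWithinAt_nonneg (convex_Ici 0) hcont
      (f' := fun t => sinh t ^ 2 * meanDivDiff V R (cosh t)) (fun t ht => ?_) (fun t _ => ?_)
    · rw [interior_Ici] at ht ⊢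
      exact (hderiv t ht).hasDerivWithinAt
    · exact mul_nonneg (sq_nonneg _) (hV.meanDivDiff_nonneg hR.le _)
  have h0 : Ψ 0 = chebCoeff V 0 R := by
    have h := hV.hasSum_chebCoeff R 1 (e := fun _ => 1) rfl rfl (fun _ => by norm_num)
      (fun _ => by simp)
    simp only [mul_one] at h
    simp [hΨ, h.tsum_eq]
  rw [← h0]
  exact hmono (self_mem_Ici) ht ht

/-- The potential of the unconstrained gas outside its support. -/
theorem le_potential_of_lt {R L : ℝ} (hR : 0 < R) (hS : virial V R = 1) {x : ℝ} (hx : R < |x|) :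
    ENNReal.ofReal (log (2 * L) + log (2 / R) + chebCoeff V 0 R - V x) ≤
      ∫⁻ y, logKernel (log (2 * L)) x y ∂(gasMeasure V R) := by
  have hmem := hV.gasMeasure_mem_probOn hR hS.le le_rfl
  have := hmem.1
  obtain ⟨σ, hσ, hxσ⟩ : ∃ σ : ℝ, (σ = 1 ∨ σ = -1) ∧ x = σ * |x| := by
    rcases le_total 0 x with h | h
    · exact ⟨1, Or.inl rfl, by rw [abs_of_nonneg h, one_mul]⟩
    · exact ⟨-1, Or.inr rfl, by rw [abs_of_nonpos h]; ring⟩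
  have hσσ : σ * σ = 1 := by rcases hσ with rfl | rfl <;> norm_num
  have hσa : |σ| = 1 := by rcases hσ with rfl | rfl <;> norm_num
  have h1R : 1 < |x| / R := by rwa [one_lt_div hR]
  set t := arcosh (|x| / R) with htdef
  have ht : 0 < t := arcosh_pos h1R
  have hcosh : cosh t = |x| / R := cosh_arcosh h1R.le
  have hxt : |x| = R * cosh t := by rw [hcosh]; field_simp
  set r := exp (-t) with hr
  have hr0 : 0 < r := exp_pos _
  have hr1 : r < 1 := by rw [hr, exp_lt_one_iff]; linarith
  -- With |x| = R cosh t, the kernel from an outside point is exactly a regularised kernel at r =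
  -- exp(-t) < 1 and endpoint σ = sign x; no limit in q is needed.
  have hker : ∀ y ∈ Metric.closedBall (0 : ℝ) R,
      ENNReal.ofReal (log (2 * L) + log (2 / R) - t + regKernel r σ (y / R)) =
        logKernel (log (2 * L)) x y := by
    intro y hy
    have hyR := abs_div_le_one_of_mem hR hy
    have hy' : |y| ≤ R := by simpa using hy
    have hxy : x ≠ y := by rintro rfl; linarith
    have hw : |σ * (y / R)| ≤ 1 := by rwa [abs_mul, hσa, one_mul]
    have hlt : 0 < cosh t - σ * (y / R) := by
      have := (abs_le.1 hw).2
      rw [hcosh]; linarith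
    have e : |x - y| = R * (cosh t - σ * (y / R)) := by
      have e1 : x - y = σ * (R * (cosh t - σ * (y / R))) := by
        rw [hxσ, hxt]
        field_simp
        linear_combination y * hσσ
      rw [e1, abs_mul, hσa, one_mul, abs_of_pos (mul_pos hR hlt)]
    rw [logKernel, if_neg hxy, regKernel_sign hr0.le hr1 hσ hyR, e, log_mul hR.ne' hlt.ne',
      log_cosh_sub hw ht, log_div two_ne_zero hR.ne']
    congr 1
    ring
  have hint := hasSum_integral_regKernel hr0.le hr1 R σ (gasMeasure V R)
  have hint2 : HasSum (fun n : ℕ => 2 / n * r ^ n * chebCos n σ * chebMoment R (gasMeasure V R) n)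
      (-∑' n : ℕ, chebCoeff V (n + 1) R * exp (-((n + 1 : ℕ) * t))) := by
    rw [← hasSum_nat_add_iff' 1]
    have hs := hV.summable_chebCoeff_mul R (e := fun n => exp (-(n * t))) (fun n => by
      rw [abs_of_pos (exp_pos _), exp_le_one_iff, neg_nonpos]
      positivity)
    convert! hs.hasSum.neg using 1
    · ext n
      have e1 := hV.two_div_mul_chebMoment_gasMeasure hR hS.le (n + 1)
      rw [if_neg n.succ_ne_zero] at e1
      have e2 : σ ^ (n + 1) * chebCoeff V (n + 1) R = chebCoeff V (n + 1) R := by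
        rcases hσ with rfl | rfl
        · simp
        · exact hV.neg_one_pow_mul_chebCoeff _ _
      have e3 : r ^ (n + 1) = exp (-((n + 1 : ℕ) * t)) := by
        rw [hr, ← exp_nat_mul]
        congr 1
        ring
      rw [chebCos_sign _ hσ, e3]
      linear_combination exp (-((n + 1 : ℕ) * t)) * σ ^ (n + 1) * e1 -
        exp (-((n + 1 : ℕ) * t)) * e2
    · simp
  have hI := hint.unique hint2
  have hΨ := hV.le_sub_tsum_exp hR hS ht.le
  have hVx : V x = V (R * cosh t) := by
    rw [← hxt]
    rcases le_total 0 x with h | h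
    · rw [abs_of_nonneg h]
    · rw [abs_of_nonpos h, hV.even]
  have hi : Integrable (fun y => regKernel r σ (y / R)) (gasMeasure V R) := by
    have := integrable_regKernel hr0.le hr1 R (gasMeasure V R) (f := fun _ => R * σ)
      measurable_const measurable_id
    simpa [mul_div_cancel_left₀ _ hR.ne'] using this
  have e : log (2 * L) + log (2 / R) - t + ∫ y, regKernel r σ (y / R) ∂(gasMeasure V R) =
      ∫ y, (log (2 * L) + log (2 / R) - t + regKernel r σ (y / R)) ∂(gasMeasure V R) := by
    rw [integral_add (integrable_const _) hi]
    simp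
  calc _ ≤ ENNReal.ofReal (log (2 * L) + log (2 / R) - t +
        ∫ y, regKernel r σ (y / R) ∂(gasMeasure V R)) := by
        apply ENNReal.ofReal_le_ofReal
        rw [hI, hVx]
        linarith
    _ ≤ _ := by
      rw [e]
      refine ofReal_integral_le_lintegral.trans (lintegral_mono_ae ?_)
      filter_upwards [ae_mem_of_mem_probOn hmem] with y hy using (hker y hy).le

theorem gasEnergy_le_energy_of_ball {R L : ℝ} (hR : 0 < R) (hS : virial V R = 1) (hRL : R ≤ L)
    {ρ : Measure ℝ} (hρ : ρ ∈ probOn (Metric.closedBall 0 L)) :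
    (gasEnergy V R : EReal) ≤ energy V ρ := by
  refine hV.gasEnergy_le_energy hR hS.le hRL (fun x _ => ?_) hρ
  rcases le_or_gt |x| R with h | h
  · exact hV.le_potential_of_mem hR hS.le hRL (by simpa using h)
  · exact hV.le_potential_of_lt hR hS h

/-! ### From compactly supported measures to all probability measures. -/

theorem affine_le (x : ℝ) : V 1 + deriv V 1 * (|x| - 1) ≤ V x := by
  have h : ∀ y, V 1 + deriv V 1 * (y - 1) ≤ V y := by
    intro y
    have hd := (hV.hasDerivAt 1).differentiableAt
    rcases lt_trichotomy y 1 with h | h | h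
    · have := hV.strictConvex.convexOn.slope_le_deriv (mem_univ y) (mem_univ 1) h hd
      rw [slope_def_field, div_le_iff₀ (by linarith)] at this
      linarith
    · simp [h]
    · have := hV.strictConvex.convexOn.deriv_le_slope (mem_univ 1) (mem_univ y) h hd
      rw [slope_def_field, le_div_iff₀ (by linarith)] at this
      linarith
  have h2 := h |x|
  rcases abs_choice x with h3 | h3 <;> rw [h3] at h2 ⊢
  · exact h2
  · rwa [hV.even] at h2

theorem exists_neg_le_kernel :
    ∃ C : ℝ, ∀ x y, -C ≤ (-log |x - y| + V x + V y) / 2 := by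
  set a := deriv V 1 with ha
  have ha0 : 0 < a := hV.deriv_one_pos
  -- Bound log(1 + s) by its majorant of slope a = V'(1): the linear growth then cancels that of the
  -- affine minorants of V, leaving this constant.
  refine ⟨2 * a - V 1 - 1 - log a, fun x y => ?_⟩
  have hl : ∀ s : ℝ, 0 ≤ s → log (1 + s) ≤ a * (1 + s) - 1 - log a := by
    intro s hs
    have h1 := log_le_sub_one_of_pos (show 0 < a * (1 + s) by positivity)
    rw [log_mul ha0.ne' (by positivity)] at h1
    linarith
  have h1 := hl |x| (abs_nonneg x)
  have h2 := hl |y| (abs_nonneg y)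
  have h3 : log |x - y| ≤ log (1 + |x|) + log (1 + |y|) := by
    rw [← log_mul (by positivity) (by positivity)]
    by_cases hxy : |x - y| = 0
    · rw [hxy, log_zero]
      exact log_nonneg (by nlinarith [abs_nonneg x, abs_nonneg y])
    · refine log_le_log (lt_of_le_of_ne (abs_nonneg _) (Ne.symm hxy)) ?_
      nlinarith [abs_sub x y, abs_nonneg x, abs_nonneg y]
  have h4 := hV.affine_le x
  have h5 := hV.affine_le y
  rw [← ha] at h4 h5
  linarith

/-- Lower bounds for the energy extend from compactly supported measures to all of them. -/
theorem le_energy_of_forall_ball {E L₀ : ℝ}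
    (h : ∀ L, L₀ ≤ L → ∀ ρ ∈ probOn (Metric.closedBall 0 L), (E : EReal) ≤ energy V ρ)
    (ρ : Measure ℝ) [IsProbabilityMeasure ρ] : (E : EReal) ≤ energy V ρ := by
  classical
  obtain ⟨C, hC⟩ := hV.exists_neg_le_kernel
  set k : ℝ × ℝ → ℝ≥0∞ := fun p => if p.1 = p.2 then ⊤ else
    ENNReal.ofReal ((-log |p.1 - p.2| + V p.1 + V p.2) / 2 + C) with hk
  have hVm := hV.continuous.measurable
  have hkm : Measurable k := by
    refine Measurable.ite (measurableSet_eq_fun measurable_fst measurable_snd) measurable_const ?_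
    have h1 : Measurable fun p : ℝ × ℝ => log |p.1 - p.2| :=
      measurable_log.comp (measurable_fst.sub measurable_snd).abs
    exact ((((h1.neg.add (hVm.comp measurable_fst)).add (hVm.comp measurable_snd)).div_const
      2).add_const C).ennreal_ofReal
  have hker : ∀ p : ℝ × ℝ, energyKernel V p.1 p.2 = (k p : EReal) + ((-C : ℝ) : EReal) := by
    intro p
    by_cases hp : p.1 = p.2
    · simp [energyKernel, hk, hp, -EReal.coe_neg]
    · simp only [energyKernel, hk, if_neg hp]
      rw [EReal.coe_ennreal_ofReal, max_eq_left (by linarith [hC p.1 p.2]), ← EReal.coe_add]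
      congr 1
      ring
  have hen : ∀ μ : Measure ℝ, IsProbabilityMeasure μ →
      energy V μ = ((∫⁻ p, k p ∂(μ.prod μ) : ℝ≥0∞) : EReal) + ((-C : ℝ) : EReal) := by
    intro μ hμ
    rw [energy, eintegral_eq hkm (integrable_const (-C)) (ae_of_all _ hker)]
    simp
  have hle : ∀ (μ : Measure ℝ), IsProbabilityMeasure μ →
      ((E : EReal) ≤ energy V μ ↔ ENNReal.ofReal (E + C) ≤ ∫⁻ p, k p ∂(μ.prod μ)) := by
    intro μ hμ
    rw [hen μ hμ]
    generalize ∫⁻ p, k p ∂(μ.prod μ) = K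
    induction K with
    | top => simp [-EReal.coe_neg]
    | coe K =>
      rw [EReal.coe_nnreal_eq_coe_real, ← EReal.coe_add, EReal.coe_le_coe_iff,
        ENNReal.ofReal_le_iff_le_toReal ENNReal.coe_ne_top, ENNReal.coe_toReal]
      constructor <;> intro h <;> linarith
  rw [hle ρ inferInstance]
  set B : ℕ → Set ℝ := fun j => Metric.closedBall 0 j with hB
  have hBm : ∀ j, MeasurableSet (B j) := fun j => Metric.isClosed_closedBall.measurableSet
  have hlim : Tendsto (fun j => ρ (B j)) atTop (𝓝 1) := by
    have h1 := tendsto_measure_iUnion_atTop (μ := ρ) (s := B) (fun i j hij =>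
      Metric.closedBall_subset_closedBall (by exact_mod_cast hij))
    rwa [hB, Metric.iUnion_closedBall_nat, measure_univ] at h1
  have hev : ∀ᶠ j in atTop, ENNReal.ofReal (E + C) * (ρ (B j) * ρ (B j)) ≤
      ∫⁻ p, k p ∂(ρ.prod ρ) := by
    filter_upwards [hlim.eventually (lt_mem_nhds zero_lt_one), eventually_ge_atTop ⌈L₀⌉₊]
      with j hj0 hjL
    have hne : ρ (B j) ≠ 0 := hj0.ne'
    have hnt : ρ (B j) ≠ ⊤ := measure_ne_top _ _
    set μ : Measure ℝ := (ρ (B j))⁻¹ • ρ.restrict (B j) with hμ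
    have hμp : IsProbabilityMeasure μ := by
      constructor
      rw [hμ, Measure.smul_apply, Measure.restrict_apply_univ, smul_eq_mul,
        ENNReal.inv_mul_cancel hne hnt]
    have hμB : μ ∈ probOn (B j) := by
      refine ⟨hμp, ?_⟩
      rw [hμ, Measure.smul_apply, Measure.restrict_apply (hBm j).compl, compl_inter_self]
      simp
    have h1 := (hle μ hμp).1 (h j (Nat.ceil_le.1 hjL) μ hμB)
    -- Normalising the restriction to B_j costs ρ(B_j)² in the double integral, and k ≥ 0 lets the
    -- domain shrink. The factor tends to 1.
    have h2 : (∫⁻ p, k p ∂(μ.prod μ)) * (ρ (B j) * ρ (B j)) ≤ ∫⁻ p, k p ∂(ρ.prod ρ) := by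
      rw [lintegral_prod _ hkm.aemeasurable, lintegral_prod _ hkm.aemeasurable, hμ,
        lintegral_smul_measure]
      simp only [lintegral_smul_measure, smul_eq_mul]
      rw [lintegral_const_mul _ (by exact hkm.lintegral_prod_right')]
      have h3 : ∀ I : ℝ≥0∞, (ρ (B j))⁻¹ * ((ρ (B j))⁻¹ * I) * (ρ (B j) * ρ (B j)) = I := by
        intro I
        calc _ = ((ρ (B j))⁻¹ * ρ (B j)) * ((ρ (B j))⁻¹ * ρ (B j)) * I := by ring
          _ = I := by rw [ENNReal.inv_mul_cancel hne hnt, one_mul, one_mul]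
      rw [h3]
      refine (lintegral_mono fun x => ?_).trans (setLIntegral_le_lintegral _ _)
      exact setLIntegral_le_lintegral _ _
    exact (mul_le_mul_left h1 _).trans h2
  have hlim2 : Tendsto (fun j => ENNReal.ofReal (E + C) * (ρ (B j) * ρ (B j))) atTop
      (𝓝 (ENNReal.ofReal (E + C))) := by
    have h1 := ENNReal.Tendsto.mul hlim (Or.inl one_ne_zero) hlim (Or.inl one_ne_zero)
    have h2 := ENNReal.Tendsto.const_mul (a := ENNReal.ofReal (E + C)) h1
      (Or.inr ENNReal.ofReal_ne_top)
    simpa using h2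
  exact le_of_tendsto hlim2 hev

theorem isEquilibrium_univ {R : ℝ} (hR : 0 < R) (hS : virial V R = 1) :
    IsEquilibrium V univ (gasMeasure V R) := by
  refine ⟨⟨hV.isProbabilityMeasure_gasMeasure hR hS.le, by simp⟩, fun ρ hρ => ?_⟩
  have := hρ.1
  rw [hV.energy_gasMeasure hR hS.le]
  exact hV.le_energy_of_forall_ball
    (fun L hL ρ hρ => hV.gasEnergy_le_energy_of_ball hR hS hL hρ) ρ

end IsAdmissible
end LogGas

namespace LogGas
open Real

/-! ### Dependence on the radius -/

theorem hasDerivAt_integral_comp_mul_cos {f f' a : ℝ → ℝ} (hf : ∀ x, HasDerivAt f (f' x) x)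
    (hf' : Continuous f') (ha : Continuous a) (R : ℝ) :
    HasDerivAt (fun R => ∫ φ in (0 : ℝ)..π, f (R * cos φ) * a φ)
      (∫ φ in (0 : ℝ)..π, f' (R * cos φ) * (cos φ * a φ)) R := by
  have hfc : Continuous f := continuous_iff_continuousAt.2 fun x => (hf x).continuousAt
  have hF' : Continuous fun p : ℝ × ℝ => f' (p.1 * cos p.2) * (cos p.2 * a p.2) := by fun_prop
  obtain ⟨M, hM⟩ := ((isCompact_closedBall R 1).prod isCompact_Icc).exists_bound_of_continuousOn
    (s := Metric.closedBall R 1 ×ˢ Icc 0 π) hF'.continuousOn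
  refine (intervalIntegral.hasDerivAt_integral_of_dominated_loc_of_deriv_le
    (s := Metric.ball R 1) (bound := fun _ => M) (F := fun R φ => f (R * cos φ) * a φ)
    (F' := fun R φ => f' (R * cos φ) * (cos φ * a φ)) (Metric.ball_mem_nhds R one_pos)
    (Eventually.of_forall fun r => by apply Continuous.aestronglyMeasurable; fun_prop)
    (by apply Continuous.intervalIntegrable; fun_prop)
    (by apply Continuous.aestronglyMeasurable; fun_prop)
    (ae_of_all _ fun φ hφ r hr => ?_) (by simp) (ae_of_all _ fun φ _ r _ => ?_)).2
  · rw [uIoc_of_le pi_pos.le] at hφ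
    exact hM (r, φ) ⟨Metric.ball_subset_closedBall hr, hφ.1.le, hφ.2⟩
  · have h1 := (hasDerivAt_id r).mul_const (cos φ)
    rw [one_mul] at h1
    have h2 := (HasDerivAt.comp (h₂ := f) r (hf _) h1).mul_const (a φ)
    convert! h2 using 1
    simp only [id]
    ring

/-- Induction over all weights `a`, since each R-derivative multiplies the weight by cos φ. -/
theorem contDiff_integral_comp_mul_cos (n : ℕ) : ∀ {f a : ℝ → ℝ}, ContDiff ℝ n f → Continuous a →
    ContDiff ℝ n (fun R => ∫ φ in (0 : ℝ)..π, f (R * cos φ) * a φ) := by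
  induction n with
  | zero =>
    intro f a hf ha
    have hfc := hf.continuous
    rw [Nat.cast_zero, contDiff_zero]
    apply intervalIntegral.continuous_parametric_intervalIntegral_of_continuous'
    fun_prop
  | succ n ih =>
    intro f a hf ha
    rw [Nat.cast_add, Nat.cast_one, contDiff_succ_iff_deriv] at hf ⊢
    have hd := hasDerivAt_integral_comp_mul_cos (fun x => (hf.1 x).hasDerivAt) hf.2.2.continuous ha
    refine ⟨fun R => (hd R).differentiableAt, fun h => by simp at h, ?_⟩
    have e : deriv (fun R => ∫ φ in (0 : ℝ)..π, f (R * cos φ) * a φ) =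
        fun R => ∫ φ in (0 : ℝ)..π, deriv f (R * cos φ) * (cos φ * a φ) :=
      funext fun R => (hd R).deriv
    rw [e]
    exact ih hf.2.2 (continuous_cos.mul ha)

/-- The cosine coefficients of `x V'(x)`, `x = R cos φ`. -/
noncomputable def virialCoeff (V : ℝ → ℝ) (n : ℕ) (R : ℝ) : ℝ :=
  2 * π⁻¹ * ∫ φ in (0 : ℝ)..π, R * cos φ * deriv V (R * cos φ) * cos (n * φ)

theorem virialCoeff_zero (V : ℝ → ℝ) (R : ℝ) : virialCoeff V 0 R = 2 * virial V R := by
  simp [virialCoeff, virial, mul_assoc]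

theorem virialCoeff_eq_mul (V : ℝ → ℝ) (n : ℕ) (R : ℝ) : virialCoeff V n R =
    R * (2 * π⁻¹ * ∫ φ in (0 : ℝ)..π, deriv V (R * cos φ) * (cos φ * cos (n * φ))) := by
  have : ∀ φ, R * cos φ * deriv V (R * cos φ) * cos (n * φ) =
      R * (deriv V (R * cos φ) * (cos φ * cos (n * φ))) := fun φ => by ring
  simp only [virialCoeff, this, intervalIntegral.integral_const_mul]
  ring

namespace IsAdmissible

variable {V : ℝ → ℝ} (hV : IsAdmissible V)

include hV

theorem hasDerivAt_chebCoeff (n : ℕ) (R : ℝ) :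
    HasDerivAt (chebCoeff V n) ((if n = 0 then π else π / 2)⁻¹ *
      ∫ φ in (0 : ℝ)..π, deriv V (R * cos φ) * (cos φ * cos (n * φ))) R := by
  have e : chebCoeff V n = fun R => (if n = 0 then π else π / 2)⁻¹ *
      ∫ φ in (0 : ℝ)..π, V (R * cos φ) * cos (n * φ) := funext (chebCoeff_eq_integral_cos V n)
  rw [e]
  exact (hasDerivAt_integral_comp_mul_cos hV.hasDerivAt hV.continuous_deriv (by fun_prop)
    R).const_mul _

theorem hasDerivAt_chebCoeff_zero {R : ℝ} (hR : R ≠ 0) :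
    HasDerivAt (chebCoeff V 0) (virial V R / R) R := by
  have h := hV.hasDerivAt_chebCoeff 0 R
  have e := virialCoeff_eq_mul V 0 R
  rw [virialCoeff_zero] at e
  convert! h using 1
  rw [if_pos rfl, div_eq_iff hR]
  linarith

theorem hasDerivAt_chebCoeff_of_ne_zero {n : ℕ} (hn : n ≠ 0) {R : ℝ} (hR : R ≠ 0) :
    HasDerivAt (chebCoeff V n) (virialCoeff V n R / R) R := by
  have h := hV.hasDerivAt_chebCoeff n R
  convert! h using 1
  rw [if_neg hn, virialCoeff_eq_mul, mul_div_cancel_left₀ _ hR]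
  field_simp

/-- cos φ (cos nφ - cos (n+2)φ) and sin φ (sin nφ + sin (n+2)φ) both equal 2 sin φ cos φ sin (n+1)φ.
-/
theorem virialCoeff_sub (n : ℕ) (R : ℝ) : virialCoeff V n R - virialCoeff V (n + 2) R =
    n * chebCoeff V n R + (n + 2 : ℕ) * chebCoeff V (n + 2) R := by
  have hc := hV.continuous_deriv
  have i1 : ∀ m : ℕ, IntervalIntegrable
      (fun φ => deriv V (R * cos φ) * (cos φ * cos (m * φ))) volume 0 π := fun m => by
    apply Continuous.intervalIntegrable; fun_prop
  have i2 : ∀ m : ℕ, IntervalIntegrable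
      (fun φ => deriv V (R * cos φ) * sin φ * sin (m * φ)) volume 0 π := fun m => by
    apply Continuous.intervalIntegrable; fun_prop
  have h : (∫ φ in (0 : ℝ)..π, deriv V (R * cos φ) * (cos φ * cos (n * φ))) -
      (∫ φ in (0 : ℝ)..π, deriv V (R * cos φ) * (cos φ * cos ((n + 2 : ℕ) * φ))) =
      (∫ φ in (0 : ℝ)..π, deriv V (R * cos φ) * sin φ * sin (n * φ)) +
      (∫ φ in (0 : ℝ)..π, deriv V (R * cos φ) * sin φ * sin ((n + 2 : ℕ) * φ)) := by
    rw [← intervalIntegral.integral_sub (i1 _) (i1 _), ← intervalIntegral.integral_add (i2 _) (i2 _)]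
    congr 1
    ext φ
    rw [show ((n : ℕ) : ℝ) * φ = (n + 1 : ℕ) * φ - φ by push_cast; ring,
      show ((n + 2 : ℕ) : ℝ) * φ = (n + 1 : ℕ) * φ + φ by push_cast; ring, cos_add, cos_sub,
      sin_add, sin_sub]
    ring
  rw [virialCoeff_eq_mul, virialCoeff_eq_mul, hV.nat_mul_chebCoeff, hV.nat_mul_chebCoeff]
  linear_combination (R * (2 * π⁻¹)) * h

theorem chebCoeff_one (R : ℝ) : chebCoeff V 1 R = 0 := by
  have := hV.neg_one_pow_mul_chebCoeff 1 R
  linarith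

theorem virialCoeff_one (R : ℝ) : virialCoeff V 1 R = 0 := by
  rcases eq_or_ne R 0 with rfl | hR
  · simp [virialCoeff]
  have h := hV.hasDerivAt_chebCoeff_of_ne_zero one_ne_zero hR
  have e : chebCoeff V 1 = fun _ => 0 := funext hV.chebCoeff_one
  rw [e] at h
  exact (div_eq_zero_iff.1 (h.unique (hasDerivAt_const R 0))).resolve_right hR

theorem tendsto_virialCoeff (R : ℝ) : Tendsto (fun n => virialCoeff V n R) atTop (𝓝 0) := by
  have hc := hV.continuous_deriv
  have h := (tendsto_integral_mul_cos_nat (f := fun φ => R * cos φ * deriv V (R * cos φ))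
    (by apply Continuous.intervalIntegrable; fun_prop)).const_mul (2 * π⁻¹)
  rwa [mul_zero] at h

/-- With b_n = n c_n and d_n = `virialCoeff V n R`, one has d_{n+2} + b_{n+2} = d_n - b_n. So b_n
d_n is a difference of the squares ((d + b)/2)² at n and n + 2, and the sum telescopes. What remains
is S² from n = 0; evenness kills n = 1. -/
theorem hasSum_mul_virialCoeff (R : ℝ) :
    HasSum (fun n : ℕ => n * chebCoeff V n R * virialCoeff V n R) (virial V R ^ 2) := by
  set ρ : ℕ → ℝ := fun n => ((virialCoeff V n R + n * chebCoeff V n R) / 2) ^ 2 with hρ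
  have hb := (summable_abs_iff.1 (hV.summable_abs_nat_mul_chebCoeff R)).tendsto_atTop_zero
  have hd := hV.tendsto_virialCoeff R
  have hρ0 : Tendsto ρ atTop (𝓝 0) := by
    have := (((hd.add hb).div_const 2).pow 2)
    simpa using this
  have hstep : ∀ n : ℕ, n * chebCoeff V n R * virialCoeff V n R = ρ n - ρ (n + 2) := by
    intro n
    have h := hV.virialCoeff_sub n R
    have h2 : virialCoeff V (n + 2) R + (n + 2 : ℕ) * chebCoeff V (n + 2) R =
        virialCoeff V n R - n * chebCoeff V n R := by linarith
    simp only [hρ]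
    rw [h2]
    ring
  have hpart : ∀ N : ℕ, ∑ n ∈ Finset.range N, (n * chebCoeff V n R * virialCoeff V n R) =
      ρ 0 + ρ 1 - (ρ N + ρ (N + 1)) := by
    intro N
    induction N with
    | zero => simp
    | succ N ih => rw [Finset.sum_range_succ, ih, hstep]; ring
  have h0 : ρ 0 = virial V R ^ 2 := by simp [hρ, virialCoeff_zero]
  have h1 : ρ 1 = 0 := by simp [hρ, hV.virialCoeff_one, hV.chebCoeff_one]
  obtain ⟨M, hM⟩ := hd.norm.bddAbove_range
  have hs : Summable (fun n : ℕ => n * chebCoeff V n R * virialCoeff V n R) := by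
    refine Summable.of_norm_bounded ((hV.summable_abs_nat_mul_chebCoeff R).mul_right M) fun n => ?_
    rw [norm_mul]
    exact mul_le_mul_of_nonneg_left (hM (mem_range_self n)) (abs_nonneg _)
  have hlim : Tendsto (fun N => ∑ n ∈ Finset.range N, (n * chebCoeff V n R * virialCoeff V n R))
      atTop (𝓝 (virial V R ^ 2)) := by
    simp only [hpart, h0, h1]
    have := (hρ0.add (hρ0.comp (tendsto_add_atTop_nat 1))).const_sub (virial V R ^ 2 + 0)
    simpa using this
  have := hs.hasSum
  rwa [tendsto_nhds_unique this.tendsto_sum_nat hlim] at this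

/-- Termwise differentiation: n c_n is O(n⁻²) locally uniformly and c_n' is bounded. The telescoped
sum gives the value. -/
theorem hasDerivAt_tsum_sq {R : ℝ} (hR : 0 < R) :
    HasDerivAt (fun R => ∑' n : ℕ, n * chebCoeff V n R ^ 2) (2 * virial V R ^ 2 / R) R := by
  set B := R + 1 with hB
  obtain ⟨K, hK0, hK⟩ := hV.exists_abs_nat_mul_chebCoeff_le B
  obtain ⟨M, hM⟩ := isCompact_Icc.exists_bound_of_continuousOn (s := Icc (-B) B)
    hV.continuous_deriv.continuousOn
  set c' : ℕ → ℝ → ℝ := fun n R => (if n = 0 then π else π / 2)⁻¹ *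
      ∫ φ in (0 : ℝ)..π, deriv V (R * cos φ) * (cos φ * cos (n * φ)) with hc'
  have hc'b : ∀ (n : ℕ) (r : ℝ), r ∈ Ioo 0 B → |c' n r| ≤ 2 * M := by
    intro n r hr
    have hM0 : 0 ≤ M := (norm_nonneg _).trans (hM 0 ⟨by linarith, by linarith⟩)
    have hin : ∀ φ, r * cos φ ∈ Icc (-B) B := by
      intro φ
      rw [mem_Icc, ← abs_le, abs_mul, abs_of_pos hr.1]
      exact (mul_le_of_le_one_right hr.1.le (abs_cos_le_one φ)).trans hr.2.le
    have h1 : |∫ φ in (0 : ℝ)..π, deriv V (r * cos φ) * (cos φ * cos (n * φ))| ≤ M * π := by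
      have := intervalIntegral.norm_integral_le_of_norm_le_const (a := 0) (b := π) (C := M)
        (f := fun φ => deriv V (r * cos φ) * (cos φ * cos (n * φ))) (fun φ _ => by
          rw [norm_mul]
          refine (mul_le_of_le_one_right (norm_nonneg _) ?_).trans (hM _ (hin φ))
          rw [norm_mul]
          exact mul_le_one₀ (abs_cos_le_one _) (norm_nonneg _) (abs_cos_le_one _))
      simpa [abs_of_pos pi_pos] using this
    have h2 : |(if n = 0 then π else π / 2)⁻¹| ≤ 2 * π⁻¹ := by
      split_ifs
      · rw [abs_of_pos (by positivity)]
        linarith [inv_pos.2 pi_pos]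
      · rw [abs_of_pos (by positivity), inv_div, div_eq_mul_inv]
    simp only [hc', abs_mul]
    calc _ ≤ 2 * π⁻¹ * (M * π) := by gcongr
      _ = _ := by field_simp
  have h := hasDerivAt_tsum_of_isPreconnected (t := Ioo 0 B)
    (u := fun n : ℕ => K * (1 / (n : ℝ) ^ 2) * (2 * (2 * M)))
    (g := fun (n : ℕ) r => n * chebCoeff V n r ^ 2)
    (g' := fun (n : ℕ) r => n * chebCoeff V n r * (2 * c' n r)) (y₀ := R) (y := R)
    (((Real.summable_one_div_nat_pow.2 (by norm_num)).mul_left K).mul_right _) isOpen_Ioo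
    isPreconnected_Ioo
    (fun n r _ => by
      convert! ((hV.hasDerivAt_chebCoeff n r).pow 2).const_mul (n : ℝ) using 1
      simp only [hc']
      push_cast
      ring)
    (fun n r hr => by
      rw [norm_mul]
      refine mul_le_mul (hK r ?_ n) ?_ (norm_nonneg _) (by positivity)
      · rw [abs_of_pos hr.1]; exact hr.2.le
      · rw [norm_mul, Real.norm_eq_abs (c' n r)]
        simpa using hc'b n r hr)
    ⟨hR, by linarith⟩
    (by
      refine Summable.of_norm_bounded (hV.summable_abs_nat_mul_chebCoeff R |>.mul_right
        (|chebCoeff V 0 R| + ∑' n, |chebCoeff V (n + 1) R|)) fun n => ?_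
      rw [pow_two, ← mul_assoc, norm_mul]
      refine mul_le_mul_of_nonneg_left ?_ (abs_nonneg _)
      rcases n with _ | n
      · exact le_add_of_nonneg_right (tsum_nonneg fun _ => abs_nonneg _)
      · exact (hV.summable_abs_chebCoeff R).le_tsum n (fun _ _ => abs_nonneg _) |>.trans
          (le_add_of_nonneg_left (abs_nonneg _)))
    ⟨hR, by linarith⟩
  convert! h using 1
  have h2 := (hV.hasSum_mul_virialCoeff R).mul_left (2 / R)
  have h3 : ∀ n : ℕ, n * chebCoeff V n R * (2 * c' n R) =
      2 / R * (n * chebCoeff V n R * virialCoeff V n R) := by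
    intro n
    rcases eq_or_ne n 0 with rfl | hn
    · simp
    · have := (hV.hasDerivAt_chebCoeff n R).unique (hV.hasDerivAt_chebCoeff_of_ne_zero hn hR.ne')
      have e : c' n R = virialCoeff V n R / R := this
      rw [e]
      ring
  simp only [h3]
  rw [h2.tsum_eq]
  ring

/-- The contributions -1/2, S and -S²/2 to R E' form a perfect square, which is the source of the
formula for F. -/
theorem hasDerivAt_gasEnergy {R : ℝ} (hR : 0 < R) :
    HasDerivAt (gasEnergy V) (-(1 - virial V R) ^ 2 / (2 * R)) R := by
  have h1 : HasDerivAt (fun R => log (2 / R) / 2) (-1 / R / 2) R := by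
    have := (((hasDerivAt_const R (2 : ℝ)).div (hasDerivAt_id R) hR.ne').log
      (by simp [hR.ne'])).div_const 2
    convert! this using 1
    simp
    field_simp
  have h := (h1.add (hV.hasDerivAt_chebCoeff_zero hR.ne')).sub
    ((hV.hasDerivAt_tsum_sq hR).div_const 4)
  convert! h using 1
  field_simp
  ring

/-! ### The critical radius -/

theorem contDiff_virial : ContDiff ℝ 2 (virial V) := by
  have h := (contDiff_integral_comp_mul_cos 2 (f := fun x => x * deriv V x) (a := fun _ => 1)
    (contDiff_id.mul hV.contDiff_deriv) continuous_const)
  have e : virial V = fun R => π⁻¹ * ∫ φ in (0 : ℝ)..π, R * cos φ * deriv V (R * cos φ) * 1 := by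
    ext R
    simp [virial]
  rw [e]
  exact contDiff_const.mul h

/-- S(R)/R is the mean of cos φ V'(R cos φ), nondecreasing in R because V' is increasing. -/
theorem mul_virial_le {r R : ℝ} (hr : 0 < r) (hrR : r ≤ R) : R * virial V r ≤ r * virial V R := by
  have hR := hr.trans_le hrR
  have hc := hV.continuous_deriv
  have e : ∀ s, virial V s = s * (π⁻¹ * ∫ φ in (0 : ℝ)..π, cos φ * deriv V (s * cos φ)) := by
    intro s
    simp only [virial, mul_assoc s, intervalIntegral.integral_const_mul]
    ring
  have h : ∫ φ in (0 : ℝ)..π, cos φ * deriv V (r * cos φ) ≤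
      ∫ φ in (0 : ℝ)..π, cos φ * deriv V (R * cos φ) := by
    refine intervalIntegral.integral_mono_on pi_pos.le
      (by apply Continuous.intervalIntegrable; fun_prop)
      (by apply Continuous.intervalIntegrable; fun_prop) fun φ _ => ?_
    rcases le_total 0 (cos φ) with h | h
    · exact mul_le_mul_of_nonneg_left
        (hV.strictMono_deriv.monotone (mul_le_mul_of_nonneg_right hrR h)) h
    · exact mul_le_mul_of_nonpos_left
        (hV.strictMono_deriv.monotone (mul_le_mul_of_nonpos_right hrR h)) h
  rw [e r, e R]
  have h2 : π⁻¹ * ∫ φ in (0 : ℝ)..π, cos φ * deriv V (r * cos φ) ≤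
      π⁻¹ * ∫ φ in (0 : ℝ)..π, cos φ * deriv V (R * cos φ) :=
    mul_le_mul_of_nonneg_left h (by positivity)
  nlinarith [mul_pos hr hR]

theorem virial_one_pos : 0 < virial V 1 := by
  have hc := hV.continuous_deriv
  refine mul_pos (by positivity) (intervalIntegral.integral_pos pi_pos (by fun_prop)
    (fun φ _ => ?_) ⟨0, left_mem_Icc.2 pi_pos.le, ?_⟩)
  · exact hV.mul_deriv_nonneg _
  · exact hV.mul_deriv_pos (by simp)

theorem exists_virial_eq_one : ∃ R, 0 < R ∧ virial V R = 1 := by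
  have h1 := hV.virial_one_pos
  -- Monotonicity of S(R)/R gives S(M) ≥ M S(1) ≥ 1.
  set M := max 1 (virial V 1)⁻¹ with hM
  have hM1 : 1 ≤ M := le_max_left _ _
  have hM2 : 1 ≤ virial V M := by
    have h2 := hV.mul_virial_le one_pos hM1
    have h3 : (virial V 1)⁻¹ ≤ M := le_max_right _ _
    have h4 : 1 ≤ M * virial V 1 := by
      calc (1 : ℝ) = (virial V 1)⁻¹ * virial V 1 := (inv_mul_cancel₀ h1.ne').symm
        _ ≤ _ := mul_le_mul_of_nonneg_right h3 h1.le
    linarith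
  have h0 : virial V 0 = 0 := by simp [virial]
  obtain ⟨R, hR, hR1⟩ := intermediate_value_Icc (by linarith : (0 : ℝ) ≤ M)
    hV.contDiff_virial.continuous.continuousOn
    (show (1 : ℝ) ∈ Icc (virial V 0) (virial V M) from ⟨by rw [h0]; norm_num, hM2⟩)
  refine ⟨R, lt_of_le_of_ne hR.1 ?_, hR1⟩
  rintro rfl
  rw [h0] at hR1
  norm_num at hR1

theorem virial_lt_one {Rs R : ℝ} (hS : virial V Rs = 1) (hR : 0 < R) (h : R < Rs) :
    virial V R < 1 := by
  have h1 := hV.mul_virial_le hR h.le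
  rw [hS] at h1
  have h2 := hR.trans h
  by_contra! h3
  nlinarith

theorem one_le_virial {Rs R : ℝ} (hRs : 0 < Rs) (hS : virial V Rs = 1) (h : Rs ≤ R) :
    1 ≤ virial V R := by
  have h1 := hV.mul_virial_le hRs h
  rw [hS] at h1
  have h2 := hRs.trans_le h
  by_contra! h3
  nlinarith

theorem isCriticalRadius {Rs : ℝ} (hRs : 0 < Rs) (hS : virial V Rs = 1) :
    IsCriticalRadius V Rs := by
  refine ⟨⟨hRs, hS ▸ hV.hasSum_virial Rs⟩, fun R hR => ?_⟩
  have h1 := hR.2.unique (hV.hasSum_virial R)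
  by_contra! h2
  exact (hV.virial_lt_one hS hR.1 h2).ne h1.symm

/-- From S(r) ≤ r/Rs to the left, left difference quotients are at least 1/Rs. This makes the zero
of 1 - S simple and the transition exactly of third order. -/
theorem deriv_virial_pos {Rs : ℝ} (hRs : 0 < Rs) (hS : virial V Rs = 1) :
    0 < deriv (virial V) Rs := by
  have hd : HasDerivAt (virial V) (deriv (virial V) Rs) Rs :=
    (hV.contDiff_virial.differentiable (by norm_num)).differentiableAt.hasDerivAt
  have hlin : ∀ᶠ r in 𝓝[<] Rs, 1 / Rs ≤ slope (virial V) Rs r := by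
    filter_upwards [Ioo_mem_nhdsLT hRs] with r hr
    have h1 := hV.mul_virial_le hr.1 hr.2.le
    rw [hS] at h1
    rw [slope_def_field, hS, ← neg_div_neg_eq (virial V r - 1), div_le_div_iff₀ hRs (by linarith [hr.2])]
    linarith
  have h1 : Tendsto (slope (virial V) Rs) (𝓝[<] Rs) (𝓝 (deriv (virial V) Rs)) :=
    hd.tendsto_slope.mono_left
      (nhdsWithin_mono Rs fun x (hx : x ∈ Iio Rs) => (ne_of_lt hx : x ≠ Rs))
  have := ge_of_tendsto h1 hlin
  exact lt_of_lt_of_le (by positivity) this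

end IsAdmissible
end LogGas

namespace LogGas
open Real

/-! ### Regularity at the transition -/

section Gluing

theorem hasDerivAt_glue {F f g : ℝ → ℝ} {f' a : ℝ} (hf : HasDerivAt f f' a)
    (hg : HasDerivAt g f' a) (hl : F =ᶠ[𝓝[≤] a] f) (hr : F =ᶠ[𝓝[≥] a] g) :
    HasDerivAt F f' a := by
  have h1 : HasDerivWithinAt F f' (Iic a) a :=
    hf.hasDerivWithinAt.congr_of_eventuallyEq hl (hl.self_of_nhdsWithin self_mem_Iic)
  have h2 : HasDerivWithinAt F f' (Ici a) a :=
    hg.hasDerivWithinAt.congr_of_eventuallyEq hr (hr.self_of_nhdsWithin self_mem_Ici)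
  have h := h1.union h2
  rwa [Iic_union_Ici, hasDerivWithinAt_univ] at h

theorem hasDerivAt_max_zero_sq (x : ℝ) :
    HasDerivAt (fun x : ℝ => max x 0 ^ 2) (2 * max x 0) x := by
  have hsq : HasDerivAt (fun x : ℝ => x ^ 2) (2 * x) x := by simpa using hasDerivAt_pow 2 x
  have h0 : HasDerivAt (fun _ : ℝ => (0 : ℝ)) 0 x := hasDerivAt_const x 0
  rcases lt_trichotomy x 0 with hx | rfl | hx
  · rw [max_eq_right hx.le, mul_zero]
    refine h0.congr_of_eventuallyEq ?_
    filter_upwards [Iio_mem_nhds hx] with y hy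
    simp [max_eq_right ((show y < 0 from hy).le)]
  · rw [max_self, mul_zero]
    refine hasDerivAt_glue h0 (by simpa using hsq) ?_ ?_
    · filter_upwards [self_mem_nhdsWithin] with y hy
      simp [max_eq_right (show y ≤ 0 from hy)]
    · filter_upwards [self_mem_nhdsWithin] with y hy
      simp [max_eq_left (show 0 ≤ y from hy)]
  · rw [max_eq_left hx.le]
    refine hsq.congr_of_eventuallyEq ?_
    filter_upwards [Ioi_mem_nhds hx] with y hy
    simp [max_eq_left ((show 0 < y from hy).le)]

/-- Squaring the positive part gains one derivative; applied to 1 - S, it makes F' of class C¹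
across the transition. -/
theorem contDiff_max_zero_sq : ContDiff ℝ 1 (fun x : ℝ => max x 0 ^ 2) := by
  rw [contDiff_one_iff_deriv]
  refine ⟨fun x => (hasDerivAt_max_zero_sq x).differentiableAt, ?_⟩
  rw [show deriv (fun x : ℝ => max x 0 ^ 2) = fun x => 2 * max x 0 from
    funext fun x => (hasDerivAt_max_zero_sq x).deriv]
  fun_prop

end Gluing

/-! ### Third-order contact of an energy branch with zero; in the application h = 1 - S. -/

section Transition

variable {G F h : ℝ → ℝ} {a : ℝ} (ha : 0 < a) (hh : ContDiff ℝ 2 h) (h0 : h a = 0)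
  (hpos : ∀ x, 0 < x → x < a → 0 ≤ h x) (hneg : ∀ x, a ≤ x → h x ≤ 0)
  (hG : ∀ x, 0 < x → HasDerivAt G (-(h x) ^ 2 / (2 * x)) x) (hGa : G a = 0)
  (hFl : ∀ x, 0 < x → x < a → F x = G x) (hFr : ∀ x, a ≤ x → F x = 0)

include hh in
theorem contDiffOn_neg_sq_div : ContDiffOn ℝ 2 (fun x => -(h x) ^ 2 / (2 * x)) (Ioi 0) := by
  refine ContDiffOn.div (by fun_prop) (by fun_prop) fun x hx => ?_
  have : (0 : ℝ) < x := hx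
  positivity

include hh hG in
theorem contDiffOn_three_of_hasDerivAt : ContDiffOn ℝ 3 G (Ioi 0) := by
  rw [show (3 : WithTop ℕ∞) = 2 + 1 by norm_num, contDiffOn_succ_iff_deriv_of_isOpen isOpen_Ioi]
  refine ⟨fun x hx => (hG x hx).differentiableAt.differentiableWithinAt, by simp, ?_⟩
  exact (contDiffOn_neg_sq_div hh).congr fun x hx => (hG x hx).deriv

include hG in
theorem iteratedDeriv_succ_eq_neg_sq_div (n : ℕ) {x : ℝ} (hx : 0 < x) :
    iteratedDeriv (n + 1) G x = iteratedDeriv n (fun x => -(h x) ^ 2 / (2 * x)) x := by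
  rw [iteratedDeriv_succ']
  refine Filter.EventuallyEq.iteratedDeriv_eq n ?_
  filter_upwards [Ioi_mem_nhds hx] with y hy using (hG y hy).deriv

include hh in
theorem hasDerivAt_neg_sq_div {x : ℝ} (hx : 0 < x) :
    HasDerivAt (fun x => -(h x) ^ 2 / (2 * x))
      (-(h x * deriv h x / x) + h x ^ 2 / (2 * x ^ 2)) x := by
  have hd : HasDerivAt h (deriv h x) x :=
    (hh.differentiable (by norm_num)).differentiableAt.hasDerivAt
  have := ((hd.fun_pow 2).fun_neg).fun_div ((hasDerivAt_id' x).const_mul 2) (by positivity)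
  refine this.congr_deriv ?_
  field_simp
  ring

include ha hh h0 in
-- Differentiating a square with h(a) = 0 twice, only the product of the two first derivatives
-- survives.
theorem iteratedDeriv_two_neg_sq_div :
    iteratedDeriv 2 (fun x => -(h x) ^ 2 / (2 * x)) a = -(deriv h a ^ 2 / a) := by
  have hd : HasDerivAt h (deriv h a) a :=
    (hh.differentiable (by norm_num)).differentiableAt.hasDerivAt
  have hd' : HasDerivAt (deriv h) (deriv (deriv h) a) a := by
    have : ContDiff ℝ 1 (deriv h) := by
      rw [show (2 : WithTop ℕ∞) = 1 + 1 by norm_num, contDiff_succ_iff_deriv] at hh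
      exact hh.2.2
    exact (this.differentiable (by norm_num)).differentiableAt.hasDerivAt
  have hev : deriv (fun x => -(h x) ^ 2 / (2 * x)) =ᶠ[𝓝 a]
      fun x => -(h x * deriv h x / x) + h x ^ 2 / (2 * x ^ 2) := by
    filter_upwards [Ioi_mem_nhds ha] with y hy using (hasDerivAt_neg_sq_div hh hy).deriv
  rw [iteratedDeriv_succ, iteratedDeriv_one, hev.deriv_eq]
  have h1 := ((hd.fun_mul hd').fun_div (hasDerivAt_id' a) ha.ne').fun_neg
  have h2 := (hd.fun_pow 2).fun_div (((hasDerivAt_id' a).fun_pow 2).const_mul 2)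
    (by positivity)
  rw [(h1.fun_add h2).deriv, h0]
  field_simp
  ring

include ha hh h0 hG in
theorem iteratedDeriv_three_of_hasDerivAt : iteratedDeriv 3 G a = -(deriv h a ^ 2 / a) := by
  rw [iteratedDeriv_succ_eq_neg_sq_div hG 2 ha, iteratedDeriv_two_neg_sq_div ha hh h0]

include ha hh h0 hG in
theorem tendsto_iteratedDeriv_three_of_hasDerivAt :
    Tendsto (iteratedDeriv 3 G) (𝓝 a) (𝓝 (-(deriv h a ^ 2 / a))) := by
  have hc := (contDiffOn_three_of_hasDerivAt hh hG).continuousOn_iteratedDerivWithin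
    (m := 3) le_rfl (uniqueDiffOn_Ioi 0)
  have hc' := hc.congr (iteratedDerivWithin_of_isOpen (n := 3) (f := G) isOpen_Ioi).symm
  have := (hc'.continuousAt (Ioi_mem_nhds ha)).tendsto
  rwa [iteratedDeriv_three_of_hasDerivAt ha hh h0 hG] at this

include ha hh h0 hG hGa in
-- Third-order Taylor expansion: G and its first two derivatives vanish at a, and the cubic
-- coefficient is -h'(a)²/a over 3!.
theorem isLittleO_sub_cube :
    (fun x => G x - deriv h a ^ 2 / (6 * a) * (a - x) ^ 3) =o[𝓝 a] fun x => (x - a) ^ 3 := by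
  have ht := taylor_isLittleO (convex_Ioi 0) (mem_Ioi.2 ha) (contDiffOn_three_of_hasDerivAt hh hG)
  rw [isOpen_Ioi.nhdsWithin_eq (mem_Ioi.2 ha)] at ht
  refine ht.congr_left fun x => ?_
  have e (n : ℕ) : iteratedDerivWithin n G (Ioi 0) a = iteratedDeriv n G a :=
    iteratedDerivWithin_of_isOpen isOpen_Ioi (mem_Ioi.2 ha)
  have e1 : iteratedDeriv 1 G a = 0 := by
    rw [iteratedDeriv_one, (hG a ha).deriv, h0]; simp
  have e2 : iteratedDeriv 2 G a = 0 := by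
    rw [iteratedDeriv_succ_eq_neg_sq_div hG 1 ha, iteratedDeriv_one,
      (hasDerivAt_neg_sq_div hh ha).deriv, h0]
    simp
  simp only [taylorWithinEval_succ, taylor_within_zero_eval, e, zero_add, Nat.reduceAdd, e1, e2,
    iteratedDeriv_three_of_hasDerivAt ha hh h0 hG, hGa]
  simp [Nat.factorial]
  field_simp
  ring

include ha hh h0 hG hGa hFl hFr in
theorem isEquivalent_cube (hd : deriv h a ≠ 0) :
    Asymptotics.IsEquivalent (𝓝 a) F
      (fun x => if x ≤ a then deriv h a ^ 2 / (6 * a) * (a - x) ^ 3 else 0) := by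
  have hC : 0 < deriv h a ^ 2 / (6 * a) := by positivity
  rw [Asymptotics.IsEquivalent, Asymptotics.isLittleO_iff]
  intro c hc
  -- The tolerance c times the leading coefficient turns the error into c times the comparison
  -- function. To the right of a both functions are identically zero.
  have hl := (Asymptotics.isLittleO_iff.1 (isLittleO_sub_cube ha hh h0 hG hGa))
    (mul_pos hc hC)
  filter_upwards [hl, Ioi_mem_nhds ha] with x hx hx0
  rcases lt_trichotomy x a with hxa | rfl | hxa
  · rw [Pi.sub_apply, if_pos hxa.le, hFl x hx0 hxa]
    refine hx.trans_eq ?_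
    rw [norm_mul, Real.norm_of_nonneg hC.le, norm_pow, norm_pow, norm_sub_rev]
    ring
  · simp [hFr x le_rfl]
  · simp [hFr x hxa.le, not_le.2 hxa]

include ha h0 hpos hneg hG hGa hFl hFr in
-- The positive part of h puts both branches into one derivative formula, whose regularity can then
-- be read off directly.
theorem hasDerivAt_transition {x : ℝ} (hx : 0 < x) :
    HasDerivAt F (-(max (h x) 0) ^ 2 / (2 * x)) x := by
  have hz : HasDerivAt (fun _ : ℝ => (0 : ℝ)) 0 x := hasDerivAt_const x 0
  rcases lt_trichotomy x a with hxa | rfl | hxa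
  · rw [max_eq_left (hpos x hx hxa)]
    refine (hG x hx).congr_of_eventuallyEq ?_
    filter_upwards [Ioo_mem_nhds hx hxa] with y hy using hFl y hy.1 hy.2
  · have h1 := hG x hx
    rw [h0] at h1 ⊢
    simp only [max_self, ne_eq, OfNat.ofNat_ne_zero, not_false_eq_true, zero_pow, neg_zero,
      zero_div] at h1 ⊢
    refine hasDerivAt_glue h1 hz ?_ ?_
    · filter_upwards [Ioc_mem_nhdsLE hx] with y hy
      rcases hy.2.lt_or_eq with hlt | rfl
      · exact hFl y hy.1 hlt
      · rw [hGa, hFr y le_rfl]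
    · filter_upwards [self_mem_nhdsWithin] with y hy using hFr y hy
  · rw [max_eq_right (hneg x hxa.le)]
    simp only [ne_eq, OfNat.ofNat_ne_zero, not_false_eq_true, zero_pow, neg_zero, zero_div]
    refine hz.congr_of_eventuallyEq ?_
    filter_upwards [Ioi_mem_nhds hxa] with y hy using hFr y (le_of_lt hy)

include ha hh h0 hpos hneg hG hGa hFl hFr in
theorem contDiffAt_two_transition : ContDiffAt ℝ 2 F a := by
  have hd : ∀ x, 0 < x → HasDerivAt F (-(max (h x) 0) ^ 2 / (2 * x)) x := fun x hx =>
    hasDerivAt_transition ha h0 hpos hneg hG hGa hFl hFr hx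
  have : ContDiffOn ℝ 2 F (Ioi 0) := by
    rw [show (2 : WithTop ℕ∞) = 1 + 1 by norm_num,
      contDiffOn_succ_iff_deriv_of_isOpen isOpen_Ioi]
    refine ⟨fun x hx => (hd x hx).differentiableAt.differentiableWithinAt, by simp, ?_⟩
    refine ContDiffOn.congr (f := fun x => -(max (h x) 0) ^ 2 / (2 * x)) ?_
      fun x hx => (hd x hx).deriv
    have h1 : ContDiff ℝ 1 fun x => max (h x) 0 ^ 2 :=
      contDiff_max_zero_sq.comp (hh.of_le (by norm_num))
    refine ContDiffOn.div h1.neg.contDiffOn (by fun_prop) fun x hx => ?_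
    have : (0 : ℝ) < x := hx
    positivity
  exact this.contDiffAt (Ioi_mem_nhds ha)

include ha h0 hpos hneg hG hGa hFl hFr in
theorem deriv_transition : deriv F a = 0 := by
  rw [(hasDerivAt_transition ha h0 hpos hneg hG hGa hFl hFr ha).deriv, h0]
  simp

include ha hh h0 hpos hneg hG hGa hFl hFr in
theorem iteratedDeriv_two_transition : iteratedDeriv 2 F a = 0 := by
  have hev : deriv F =ᶠ[𝓝 a] fun x => -(max (h x) 0) ^ 2 / (2 * x) := by
    filter_upwards [Ioi_mem_nhds ha] with y hy
      using (hasDerivAt_transition ha h0 hpos hneg hG hGa hFl hFr hy).deriv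
  have hd : HasDerivAt h (deriv h a) a :=
    (hh.differentiable (by norm_num)).differentiableAt.hasDerivAt
  have h1 := ((hasDerivAt_max_zero_sq (h a)).comp a hd).fun_neg.fun_div
    ((hasDerivAt_id' a).const_mul 2) (by positivity)
  rw [iteratedDeriv_succ, iteratedDeriv_one, hev.deriv_eq]
  refine h1.deriv.trans ?_
  simp [h0]

include hh hG hFl in
theorem contDiffOn_three_transition : ContDiffOn ℝ 3 F (Ioo 0 a) :=
  ((contDiffOn_three_of_hasDerivAt hh hG).mono fun _ hx => hx.1).congr
    fun x hx => hFl x hx.1 hx.2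

include ha hh h0 hG hFl in
theorem tendsto_iteratedDeriv_three_left :
    Tendsto (iteratedDeriv 3 F) (𝓝[<] a) (𝓝 (-(deriv h a ^ 2 / a))) := by
  refine ((tendsto_iteratedDeriv_three_of_hasDerivAt ha hh h0 hG).mono_left
    nhdsWithin_le_nhds).congr' ?_
  filter_upwards [Ioo_mem_nhdsLT ha] with x hx
  refine (Filter.EventuallyEq.iteratedDeriv_eq 3 ?_).symm
  filter_upwards [Ioo_mem_nhds hx.1 hx.2] with y hy using hFl y hy.1 hy.2

include hFr in
theorem tendsto_iteratedDeriv_three_right :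
    Tendsto (iteratedDeriv 3 F) (𝓝[>] a) (𝓝 0) := by
  refine tendsto_const_nhds.congr' ?_
  filter_upwards [self_mem_nhdsWithin] with x hx
  have : F =ᶠ[𝓝 x] fun _ => (0 : ℝ) := by
    filter_upwards [Ioi_mem_nhds hx] with y hy using hFr y (le_of_lt hy)
  rw [this.iteratedDeriv_eq 3]
  simp

end Transition

/-! ### The excess free energy -/

namespace IsAdmissible
variable {V : ℝ → ℝ} (hV : IsAdmissible V)
include hV

theorem excessFreeEnergy_of_lt {R Rs : ℝ} (hR : 0 < R) (hRs : R < Rs) (hS : virial V Rs = 1) :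
    excessFreeEnergy V (gasMeasure V Rs) R = ((gasEnergy V R - gasEnergy V Rs : ℝ) : EReal) := by
  have h1 : virial V R ≤ 1 := (hV.virial_lt_one hS hR hRs).le
  have heq := hV.isEquilibrium_gasMeasure hR h1
  have hinf : (⨅ ρ ∈ probOn (Metric.closedBall 0 R), energy V ρ) = energy V (gasMeasure V R) :=
    le_antisymm (iInf₂_le _ heq.1) (le_iInf₂ heq.2)
  rw [excessFreeEnergy, hinf, hV.energy_gasMeasure hR h1,
    hV.energy_gasMeasure (hR.trans hRs) hS.le, EReal.coe_sub]

theorem excessFreeEnergy_of_le {R Rs : ℝ} (h0 : 0 < Rs) (hRs : Rs ≤ R) (hS : virial V Rs = 1) :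
    excessFreeEnergy V (gasMeasure V Rs) R = 0 := by
  have heq := hV.isEquilibrium_univ h0 hS
  have hinf : (⨅ ρ ∈ probOn (Metric.closedBall 0 R), energy V ρ) = energy V (gasMeasure V Rs) := by
    refine le_antisymm (iInf₂_le _ (hV.gasMeasure_mem_probOn h0 hS.le hRs)) ?_
    exact le_iInf₂ fun ρ hρ => heq.2 ρ ⟨hρ.1, by simp⟩
  rw [excessFreeEnergy, hinf, hV.energy_gasMeasure h0 hS.le, ← EReal.coe_sub, sub_self,
    EReal.coe_zero]

theorem gasEnergy_sub_eq_integral {R Rs : ℝ} (hR : 0 < R) (hRs : R ≤ Rs) :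
    gasEnergy V R - gasEnergy V Rs = 1 / 2 * ∫ r in R..Rs, P V r r ^ 2 / r := by
  have hsub : uIcc R Rs ⊆ Ioi 0 := by
    rw [uIcc_of_le hRs]
    exact fun x hx => hR.trans_le hx.1
  have hint : IntervalIntegrable (fun r => -(1 - virial V r) ^ 2 / (2 * r)) volume R Rs := by
    refine ContinuousOn.intervalIntegrable ?_
    refine (contDiffOn_neg_sq_div (h := fun r => 1 - virial V r) ?_).continuousOn.mono hsub
    exact contDiff_const.sub hV.contDiff_virial
  have := intervalIntegral.integral_eq_sub_of_hasDerivAt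
    (fun x hx => hV.hasDerivAt_gasEnergy (hsub hx)) hint
  rw [← neg_sub, ← this, ← intervalIntegral.integral_neg, ← intervalIntegral.integral_const_mul]
  refine intervalIntegral.integral_congr fun r hr => ?_
  have hr0 : 0 < r := hsub hr
  rw [hV.P_self hr0]
  field_simp

theorem gasEnergy_lt {R Rs : ℝ} (hR : 0 < R) (hRs : R < Rs) (hS : virial V Rs = 1) :
    gasEnergy V Rs < gasEnergy V R := by
  have hd : StrictAntiOn (gasEnergy V) (Icc R Rs) := by
    refine strictAntiOn_of_deriv_neg (convex_Icc R Rs) (fun x hx => ?_) fun x hx => ?_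
    · exact (hV.hasDerivAt_gasEnergy (hR.trans_le hx.1)).continuousAt.continuousWithinAt
    · rw [interior_Icc] at hx
      have hx0 : 0 < x := hR.trans hx.1
      have h1 : 0 < 1 - virial V x := sub_pos.2 (hV.virial_lt_one hS hx0 hx.2)
      rw [(hV.hasDerivAt_gasEnergy hx0).deriv, neg_div, neg_lt_zero]
      positivity
  exact hd (left_mem_Icc.2 hRs.le) (right_mem_Icc.2 hRs.le) hRs

end IsAdmissible
end LogGas

/-! ### The theorem: assembling the energy formula and the transition. -/

theorem theorem2 (V : ℝ → ℝ) (hV : IsAdmissible V) :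
    ∃ (Rs : ℝ) (ρs : Measure ℝ) (C : ℝ),
      -- the unperturbed gas, its edge `Rs`, and the constrained equilibria in the pushed phase
      IsCriticalRadius V Rs ∧
      IsEquilibrium V univ ρs ∧ ρs.support = Icc (-Rs) Rs ∧
      (∀ R, 0 < R → Summable (fun n : ℕ => |(n : ℝ) * chebCoeff V n R|)) ∧
      (∀ R, 0 < R → R < Rs → IsEquilibrium V (Metric.closedBall 0 R) (gasMeasure V R)) ∧
      -- the formula for the excess free energy (in particular, it is finite)
      (∀ R, 0 < R → excessFreeEnergy V ρs R =
        ((1 / 2 * ∫ r in (min R Rs)..Rs, P V r r ^ 2 / r : ℝ) : EReal)) ∧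
      -- pushed and pulled phases
      (∀ R, 0 < R → R < Rs → 0 < excessFreeEnergy V ρs R) ∧
      (∀ R, Rs ≤ R → excessFreeEnergy V ρs R = 0) ∧
      -- behaviour at the transition
      0 < C ∧
      Asymptotics.IsEquivalent (𝓝 Rs) (excessFreeEnergyReal V ρs)
        (fun R => if R ≤ Rs then C * (Rs - R) ^ 3 else 0) ∧
      ContDiffAt ℝ 2 (excessFreeEnergyReal V ρs) Rs ∧
      excessFreeEnergyReal V ρs Rs = 0 ∧
      deriv (excessFreeEnergyReal V ρs) Rs = 0 ∧
      iteratedDeriv 2 (excessFreeEnergyReal V ρs) Rs = 0 ∧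
      ContDiffOn ℝ 3 (excessFreeEnergyReal V ρs) (Ioo 0 Rs) ∧
      Tendsto (iteratedDeriv 3 (excessFreeEnergyReal V ρs)) (𝓝[<] Rs)
        (𝓝 (-((Nat.factorial 3 : ℕ) : ℝ) * C)) ∧
      Tendsto (iteratedDeriv 3 (excessFreeEnergyReal V ρs)) (𝓝[>] Rs) (𝓝 0) := by
  obtain ⟨Rs, hRs, hS⟩ := hV.exists_virial_eq_one
  set F := excessFreeEnergyReal V (gasMeasure V Rs) with hF
  -- For R > 0 this is P_R(R), the edge value in the energy formula.
  set h : ℝ → ℝ := fun R => 1 - virial V R with hh_def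
  set G : ℝ → ℝ := fun R => gasEnergy V R - gasEnergy V Rs with hG_def
  have hh : ContDiff ℝ 2 h := contDiff_const.sub hV.contDiff_virial
  have h0 : h Rs = 0 := by simp [h, hS]
  have hpos : ∀ x, 0 < x → x < Rs → 0 ≤ h x := fun x hx hxs =>
    (sub_pos.2 (hV.virial_lt_one hS hx hxs)).le
  have hneg : ∀ x, Rs ≤ x → h x ≤ 0 := fun x hx => sub_nonpos.2 (hV.one_le_virial hRs hS hx)
  have hG : ∀ x, 0 < x → HasDerivAt G (-(h x) ^ 2 / (2 * x)) x := fun x hx =>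
    (hV.hasDerivAt_gasEnergy hx).sub_const _
  have hGa : G Rs = 0 := sub_self _
  have hFl : ∀ x, 0 < x → x < Rs → F x = G x := fun x hx hxs => by
    rw [hF, excessFreeEnergyReal, hV.excessFreeEnergy_of_lt hx hxs hS, EReal.toReal_coe]
  have hFr : ∀ x, Rs ≤ x → F x = 0 := fun x hx => by
    rw [hF, excessFreeEnergyReal, hV.excessFreeEnergy_of_le hRs hx hS, EReal.toReal_zero]
  have hdS : HasDerivAt h (-deriv (virial V) Rs) Rs :=
    ((hV.contDiff_virial.differentiable (by norm_num)).differentiableAt.hasDerivAt).const_sub 1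
  have hdh : deriv h Rs ≠ 0 := by
    rw [hdS.deriv]
    exact neg_ne_zero.2 (hV.deriv_virial_pos hRs hS).ne'
  refine ⟨Rs, gasMeasure V Rs, deriv h Rs ^ 2 / (6 * Rs), hV.isCriticalRadius hRs hS,
    hV.isEquilibrium_univ hRs hS, hV.support_gasMeasure hRs hS.le,
    fun R _ => hV.summable_abs_nat_mul_chebCoeff R,
    fun R hR hR' => hV.isEquilibrium_gasMeasure hR (hV.virial_lt_one hS hR hR').le,
    fun R hR => ?_, fun R hR hR' => ?_, fun R hR => hV.excessFreeEnergy_of_le hRs hR hS,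
    by positivity, isEquivalent_cube hRs hh h0 hG hGa hFl hFr hdh,
    contDiffAt_two_transition hRs hh h0 hpos hneg hG hGa hFl hFr, hFr Rs le_rfl,
    deriv_transition hRs h0 hpos hneg hG hGa hFl hFr,
    iteratedDeriv_two_transition hRs hh h0 hpos hneg hG hGa hFl hFr,
    contDiffOn_three_transition hh hG hFl, ?_, tendsto_iteratedDeriv_three_right hFr⟩
  · rcases lt_or_ge R Rs with hlt | hle
    · rw [min_eq_left hlt.le, hV.excessFreeEnergy_of_lt hR hlt hS,
        hV.gasEnergy_sub_eq_integral hR hlt.le]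
    · rw [min_eq_right hle, hV.excessFreeEnergy_of_le hRs hle hS]
      simp
  · rw [hV.excessFreeEnergy_of_lt hR hR' hS]
    exact_mod_cast sub_pos.2 (hV.gasEnergy_lt hR hR' hS)
  · have := tendsto_iteratedDeriv_three_left hRs hh h0 hG hFl
    have e : -((Nat.factorial 3 : ℕ) : ℝ) * (deriv h Rs ^ 2 / (6 * Rs)) = -(deriv h Rs ^ 2 / Rs) := by
      rw [show Nat.factorial 3 = 6 from rfl]
      field_simp
      norm_num
    rwa [e]
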